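/- Theorem. Let $n\ge 1$ and $S=\mathbb C[a_1,\dots,a_n]$. Let $W_{\mathrm{af}}=\langle s_0,\dots,s_n\rangle=Q^\vee\rtimes W$ be the affine Weyl group of type $C_n^{(1)}$, where $Q^\vee=\bigoplus_{i=1}^n\mathbb Z\varepsilon_i$ and $W=\langle s_1,\dots,s_n\rangle$, with length function $\ell$, and let $W_{\mathrm{af}}^0$ be the set of minimal length representatives of the cosets $W_{\mathrm{af}}/W$. Put $\alpha_0=-2a_1$, $\alpha_i=a_i-a_{i+1}$ for $1\le i\le n-1$, $\alpha_n=2a_n$, and $\Omega(u|y)=\prod_{j\ge1}\frac{1+uy_j}{1-uy_j}$. Let $W_{\mathrm{af}}$ act on the symmetric formal power series $f(y|a)$ in $y=(y_1,y_2,\dots)$ with coefficients in $S$ as follows: for $1\le i\le n-1$, $s_i$ exchanges $a_i$ and $a_{i+1}$ in the coefficients; $s_n$ replaces $a_n$ by $-a_n$; and $(s_0f)(y|a)=\Omega(a_1|y)\,f(y|-a_1,a_2,\dots,a_n)$. Let $A_i=\alpha_i^{-1}(1-s_i)$ for $0\le i\le n$, let $A_w=A_{i_1}\cdots A_{i_l}$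 for a reduced expression $w=s_{i_1}\cdots s_{i_l}$, and for $w\in W_{\mathrm{af}}^0$ let $\hat P^{(n)}_w(y|a)=A_w(1)$. Put $\rho_i=s_{i-1}\cdots s_1s_0$ for $1\le i\le n$ and $\rho_i=s_{2n+1-i}\cdots s_{n-1}s_ns_{n-1}\cdots s_1s_0$ for $n+1\le i\le 2n$. Let $\mathscr P_C^n$ be the set of partitions with all parts at most $2n$ and at most one part of each size $k$, $1\le k\le n$. The map $\lambda=(\lambda_1\ge\dots\ge\lambda_l)\mapsto\rho_{\lambda_l}\cdots\rho_{\lambda_2}\rho_{\lambda_1}$ is a bijection $\mathscr P_C^n\to W_{\mathrm{af}}^0$; denote its inverse by $w\mapsto\lambda_w$. For a strict partition $\lambda$ with $\ell(\lambda)$ parts and $N\ge\ell(\lambda)$, let $$Q_\lambda(x_1,\dots,x_N|a)=\frac1{(N-\ell(\lambda))!}\sum_{v\in S_N}v\Bigl(\prod_{i=1}^{\ell(\lambda)}2x_i(x_i-a_1)\cdots(x_i-a_{\lambda_i-1})\prod_{i=1}^{\ell(\lambda)}\prod_{j=i+1}^N\frac{x_i+x_j}{x_i-x_j}\Bigr)$$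 be Ivanov's factorial $Q$-function in the parameters $a=(a_1,a_2,\dots)$, and let $Q_\lambda(x|a)$ be its stable limit as $N\to\infty$. The Nakagawa–Naruse dual factorial $P$-functions $\hat P_\lambda(y|a)$, indexed by the strict partitions, are defined by $$\prod_{i,j}\frac{1+x_iy_j}{1-x_iy_j}=\sum_\lambda\hat P_\lambda(y|a)\,Q_\lambda(x|a),$$ where the $\hat P_\lambda(y|a)$ are power series in $y$ over $\mathbb C[a_1,a_2,\dots]$ such that each monomial in $y$ occurs in only finitely many of them. Finally, let $a^{(n)}$ be the $2n$-periodic sequence with $(a^{(n)}_1,\dots,a^{(n)}_{2n})=(a_1,\dots,a_n,-a_n,\dots,-a_1)$. If $w\in W_{\mathrm{af}}^0$ satisfies $\ell(w)\le 2n$, then $\lambda_w$ is a strict partition and $$\hat P^{(n)}_w(y|a)=\hat P_{\lambda_w}(y|a^{(n)}).$$ -/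

import Mathlib

noncomputable section

namespace AffineC

open Finset

/-! ### The affine Weyl group of type `C_n^{(1)}` -/

/-- The permutation of the coordinates underlying the classical projection of the simple reflection
`s_i`: it exchanges the `i`-th and `(i+1)`-st coordinate (counted from 1) if `1 ≤ i ≤ n - 1`, and is
trivial for `i = 0` and `i = n`. -/
def coordPerm (n : ℕ) (i : Fin (n + 1)) : Equiv.Perm (Fin n) :=
  if h : 1 ≤ i.val ∧ i.val < n then Equiv.swap ⟨i.val - 1, by omega⟩ ⟨i.val, h.2⟩ else 1

/-- The sign of the classical projection of `s_i` at a coordinate: `s_0` negates the first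
coordinate and `s_n` the last one. -/
def coordSign (n : ℕ) (i : Fin (n + 1)) (k : Fin n) : ℤ :=
  if (i.val = 0 ∧ k.val = 0) ∨ (i.val = n ∧ k.val + 1 = n) then -1 else 1

/-- The simple reflection `s_i`, as an affine transformation of the coroot lattice
`Q^∨ = ⨁ ℤ ε_k = ℤ^n`: `s_i` exchanges two adjacent coordinates for `1 ≤ i ≤ n - 1`, `s_n` negates
the last coordinate, and `s_0 = t_{ε_1} s_θ` sends the first coordinate `x` to `1 - x`. -/
def simpleReflFun (n : ℕ) (i : Fin (n + 1)) (x : Fin n → ℤ) : Fin n → ℤ := fun k =>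
  coordSign n i k * x (coordPerm n i k) + if i.val = 0 ∧ k.val = 0 then 1 else 0

theorem simpleReflFun_involutive (n : ℕ) (i : Fin (n + 1)) :
    Function.Involutive (simpleReflFun n i) := by
  intro x
  funext k
  by_cases h : 1 ≤ i.val ∧ i.val < n
  · have h0 : ¬ i.val = 0 := by omega
    have h1 : ¬ i.val = n := by omega
    simp [simpleReflFun, coordSign, coordPerm, h, h0, h1]
  · simp only [simpleReflFun, coordSign, coordPerm, h, dif_neg, not_false_eq_true,
      Equiv.Perm.coe_one, id]
    by_cases h0 : i.val = 0
    · by_cases hk : k.val = 0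
      · simp [h0, hk]
      · have hn : ¬ (0 = n ∧ k.val + 1 = n) := by omega
        simp [h0, hk, hn]
    · simp only [h0, false_and, if_false, add_zero, false_or]
      split_ifs <;> ring

/-- The simple reflection `s_i` as a bijection of the coroot lattice. -/
def simpleRefl (n : ℕ) (i : Fin (n + 1)) : Equiv.Perm (Fin n → ℤ) :=
  (simpleReflFun_involutive n i).toPerm

/-- The affine Weyl group `W_af = Q^∨ ⋊ W = ⟨s_0, …, s_n⟩`, in its faithful action on `Q^∨`. -/
def affineWeyl (n : ℕ) : Subgroup (Equiv.Perm (Fin n → ℤ)) :=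
  Subgroup.closure (Set.range (simpleRefl n))

/-- The generator `s_i` as an element of `W_af`. -/
def gen (n : ℕ) (i : Fin (n + 1)) : affineWeyl n :=
  ⟨simpleRefl n i, Subgroup.subset_closure ⟨i, rfl⟩⟩

/-- The finite Weyl group `W = ⟨s_1, …, s_n⟩ ⊆ W_af`. -/
def finiteWeyl (n : ℕ) : Subgroup (affineWeyl n) :=
  Subgroup.closure {g | ∃ i : Fin (n + 1), i.val ≠ 0 ∧ g = gen n i}

/-- The product `s_{i_1} ⋯ s_{i_l}` of a word `[i_1, …, i_l]`. -/
def wordProd (n : ℕ) (ω : List (Fin (n + 1))) : affineWeyl n := (ω.map (gen n)).prod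

/-- The Coxeter length: the least length of a word with product `w`. -/
def len (n : ℕ) (w : affineWeyl n) : ℕ :=
  sInf {l | ∃ ω : List (Fin (n + 1)), wordProd n ω = w ∧ ω.length = l}

/-- `ω` is a reduced word of `w`. -/
def IsReducedWord (n : ℕ) (w : affineWeyl n) (ω : List (Fin (n + 1))) : Prop :=
  wordProd n ω = w ∧ ω.length = len n w

theorem exists_word (n : ℕ) (w : affineWeyl n) :
    ∃ ω : List (Fin (n + 1)), wordProd n ω = w := by
  obtain ⟨w, hw⟩ := w
  have key : ∃ ω : List (Fin (n + 1)), (ω.map (simpleRefl n)).prod = w := by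
    refine Subgroup.closure_induction (p := fun g _ =>
      ∃ ω : List (Fin (n + 1)), (ω.map (simpleRefl n)).prod = g) ?_ ?_ ?_ ?_ hw
    · rintro _ ⟨i, rfl⟩
      exact ⟨[i], by simp⟩
    · exact ⟨[], by simp⟩
    · rintro _ _ _ _ ⟨u, rfl⟩ ⟨v, rfl⟩
      exact ⟨u ++ v, by simp⟩
    · rintro _ _ ⟨u, rfl⟩
      refine ⟨u.reverse, ?_⟩
      rw [List.prod_inv_reverse, List.map_map, ← List.map_reverse]
      congr 1
  obtain ⟨ω, rfl⟩ := key
  refine ⟨ω, Subtype.ext ?_⟩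
  rw [wordProd, Subgroup.val_list_prod, List.map_map]
  rfl

theorem exists_reducedWord (n : ℕ) (w : affineWeyl n) : ∃ ω, IsReducedWord n w ω := by
  obtain ⟨ω, hω⟩ := exists_word n w
  exact Nat.sInf_mem (s := {l | ∃ ω : List (Fin (n + 1)), wordProd n ω = w ∧ ω.length = l})
    ⟨ω.length, ω, hω, rfl⟩

/-- A chosen reduced word of `w`. -/
def reducedWord (n : ℕ) (w : affineWeyl n) : List (Fin (n + 1)) := (exists_reducedWord n w).choose

/-- `w ∈ W_af^0`: `w` has minimal length in its coset `wW`. -/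
def IsAffineGrassmannian (n : ℕ) (w : affineWeyl n) : Prop :=
  ∀ u ∈ finiteWeyl n, len n w ≤ len n (w * u)

/-! ### The bijection `w ↦ λ_w` -/

/-- The node `j` if `j ≤ n` and `2n - j` if `n < j < 2n`. -/
def residue (n j : ℕ) : Fin (n + 1) := ⟨if j ≤ n then j else 2 * n - j, by split <;> omega⟩

/-- `ρ_i = s_{i-1} ⋯ s_1 s_0` for `1 ≤ i ≤ n`, and
`ρ_i = s_{2n+1-i} ⋯ s_{n-1} s_n s_{n-1} ⋯ s_1 s_0` for `n + 1 ≤ i ≤ 2n`. -/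
def rho (n i : ℕ) : affineWeyl n := wordProd n ((List.range i).reverse.map (residue n))

/-- `𝒫_C^n`: the partitions whose parts are at most `2n`, with at most one part of each size `k` for
`1 ≤ k ≤ n`. A partition is a weakly decreasing list of positive integers. -/
def PartitionC (n : ℕ) : Type :=
  {l : List ℕ // l.Pairwise (· ≥ ·) ∧ (∀ p ∈ l, 0 < p ∧ p ≤ 2 * n) ∧ ∀ k ≤ n, l.count k ≤ 1}

instance (n : ℕ) : Nonempty (PartitionC n) := ⟨⟨[], by simp⟩⟩

/-- The element `w_λ = ρ_{λ_l} ⋯ ρ_{λ_2} ρ_{λ_1}`. -/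
def ofPartition (n : ℕ) (l : PartitionC n) : affineWeyl n := (l.val.reverse.map (rho n)).prod

/-- `w ↦ λ_w`, the inverse of the bijection `λ ↦ w_λ` from `𝒫_C^n` onto `W_af^0`. -/
def toPartition (n : ℕ) (w : affineWeyl n) : PartitionC n := Function.invFun (ofPartition n) w

/-! ### The series `Ω(u|y)` -/

/-- The one-variable series `(1 + u y) / (1 - u y) = 1 + 2 ∑_{k ≥ 1} u^k y^k`. -/
def omegaFactor {R : Type*} [CommRing R] (u : R) : PowerSeries R :=
  PowerSeries.mk fun k => if k = 0 then 1 else 2 * u ^ k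

theorem omegaFactor_spec {R : Type*} [CommRing R] (u : R) :
    (1 - PowerSeries.C u * PowerSeries.X) * omegaFactor u =
      1 + PowerSeries.C u * PowerSeries.X := by
  ext k
  rw [sub_mul, one_mul, mul_assoc]
  rcases k with _ | _ | k
  · simp [omegaFactor]
  · simp [omegaFactor, PowerSeries.coeff_succ_X_mul, PowerSeries.coeff_one]
    ring
  · simp [omegaFactor, PowerSeries.coeff_succ_X_mul, PowerSeries.coeff_one]
    ring

/-- `Ω(u|y) = ∏_{j ≥ 1} (1 + u y_j) / (1 - u y_j)`, as a power series in `y_1, y_2, …`: the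
coefficient of the monomial `∏_j y_j^{β_j}` is the product of the coefficients of `y_j^{β_j}` in the
factors. -/
def Omega {R : Type*} [CommRing R] (u : R) : MvPowerSeries ℕ R :=
  fun β => β.prod fun _ m => PowerSeries.coeff m (omegaFactor u)

theorem coeff_Omega {R : Type*} [CommRing R] (u : R) (β : ℕ →₀ ℕ) :
    MvPowerSeries.coeff β (Omega u) = β.prod fun _ m => PowerSeries.coeff m (omegaFactor u) :=
  rfl

/-! ### The action of the affine nil-Hecke algebra

Symmetric series in `y` with coefficients in `S = ℂ[a_1, …, a_n]` are elements of the ring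
`MvPowerSeries ℕ S` of all formal power series in `y_1, y_2, …` over `S`. -/

/-- `S = ℂ[a_1, …, a_n]`. -/
abbrev S (n : ℕ) : Type := MvPolynomial (Fin n) ℂ

/-- The variable `a_{k+1}` of `S`, for `k < n`. -/
def aVar (n k : ℕ) : S n := if h : k < n then MvPolynomial.X ⟨k, h⟩ else 0

/-- The simple roots `α_i = a_i - a_{i+1}` (`1 ≤ i ≤ n - 1`), `α_n = 2 a_n`, and the classical
projection `α_0 = -θ = -2 a_1` of the affine one. -/
def simpleRoot (n : ℕ) (i : Fin (n + 1)) : S n :=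
  if i.val = 0 then -2 * aVar n 0
  else if i.val = n then 2 * aVar n (n - 1)
  else aVar n (i.val - 1) - aVar n i.val

/-- The level zero action of `s_i` on `S`. -/
def reflS (n : ℕ) (i : Fin (n + 1)) : S n →ₐ[ℂ] S n :=
  MvPolynomial.aeval fun k => (coordSign n i k : S n) * MvPolynomial.X (coordPerm n i k)

/-- The action of `s_i` on series in `y`: for `i ≠ 0` it acts on the coefficients only, and
`(s_0 f)(y|a) = Ω(a_1|y) f(y|-a_1, a_2, …, a_n)`. -/
def reflSeries (n : ℕ) (i : Fin (n + 1)) (f : MvPowerSeries ℕ (S n)) : MvPowerSeries ℕ (S n) :=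
  (if i.val = 0 then Omega (aVar n 0) else 1) * MvPowerSeries.map (reflS n i).toRingHom f

theorem dvd_sub_reflS (n : ℕ) (i : Fin (n + 1)) (p : S n) :
    simpleRoot n i ∣ p - reflS n i p := by
  induction p using MvPolynomial.induction_on with
  | C c => simp [reflS]
  | add p q hp hq =>
    have : p + q - reflS n i (p + q) = (p - reflS n i p) + (q - reflS n i q) := by
      rw [map_add]; ring
    rw [this]
    exact dvd_add hp hq
  | mul_X p k hp =>
    have hX : simpleRoot n i ∣ MvPolynomial.X k - reflS n i (MvPolynomial.X k) := by
      have hk := k.isLt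
      simp only [reflS, MvPolynomial.aeval_X, coordSign, coordPerm, simpleRoot, aVar]
      by_cases h : 1 ≤ i.val ∧ i.val < n
      · have h0 : ¬ i.val = 0 := by omega
        have h1 : ¬ i.val = n := by omega
        have h2 : i.val - 1 < n := by omega
        simp only [h, h0, h1, h2, and_self, dif_pos, if_false, false_and, or_self, Int.cast_one,
          one_mul]
        by_cases hk1 : k = ⟨i.val - 1, h2⟩
        · subst hk1
          simp
        · by_cases hk2 : k = ⟨i.val, h.2⟩
          · subst hk2
            rw [Equiv.swap_apply_right, dvd_sub_comm]
          · rw [Equiv.swap_apply_of_ne_of_ne hk1 hk2]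
            simp
      · simp only [h, dif_neg, not_false_eq_true, Equiv.Perm.coe_one, id]
        by_cases h0 : i.val = 0
        · have hn : 0 < n := by omega
          have h1 : ¬ i.val = n := by omega
          by_cases hk0 : k.val = 0
          · have : k = ⟨0, hn⟩ := Fin.ext hk0
            subst this
            simp only [h0, hn, true_and, true_or, dif_pos, if_true]
            exact ⟨-1, by push_cast; ring⟩
          · simp only [h0, hk0, hn.ne, and_false, false_and, or_self, if_false]
            simp
        · have h1 : i.val = n := by omega
          by_cases hk0 : k.val + 1 = n
          · have hn : n - 1 < n := by omega
            have : k = ⟨n - 1, hn⟩ := Fin.ext (by simp; omega)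
            subst this
            have hn0 : n ≠ 0 := by omega
            simp only [h1, hn, hn0, hk0, and_self, or_true, dif_pos, if_true, if_false]
            exact ⟨1, by push_cast; ring⟩
          · simp only [h0, hk0, and_false, false_and, or_self, if_false]
            simp
    have : p * MvPolynomial.X k - reflS n i (p * MvPolynomial.X k) =
        (p - reflS n i p) * MvPolynomial.X k +
          reflS n i p * (MvPolynomial.X k - reflS n i (MvPolynomial.X k)) := by
      rw [map_mul]; ring
    rw [this]
    exact dvd_add (hp.mul_right _) (hX.mul_left _)

theorem exists_C_mul_eq {R : Type*} [CommRing R] (c : R) (f : MvPowerSeries ℕ R)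
    (h : ∀ β, c ∣ MvPowerSeries.coeff β f) : ∃ g, MvPowerSeries.C c * g = f := by
  choose g hg using h
  refine ⟨(g : MvPowerSeries ℕ R), ?_⟩
  ext β
  rw [hg β]
  exact MvPowerSeries.coeff_C_mul β g c

theorem exists_quotient (n : ℕ) (i : Fin (n + 1)) (f : MvPowerSeries ℕ (S n)) :
    ∃ g, MvPowerSeries.C (simpleRoot n i) * g = f - reflSeries n i f := by
  obtain ⟨g, hg⟩ := exists_C_mul_eq (simpleRoot n i)
    (f - MvPowerSeries.map (reflS n i).toRingHom f) fun β => by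
      rw [map_sub, MvPowerSeries.coeff_map]
      exact dvd_sub_reflS n i _
  by_cases h0 : i.val = 0
  · obtain ⟨h, hh⟩ := exists_C_mul_eq (simpleRoot n i) (1 - Omega (aVar n 0)) fun β => by
      by_cases hβ : β = 0
      · subst hβ
        rw [map_sub, coeff_Omega]
        simp
      · obtain ⟨j, hj⟩ : ∃ j, j ∈ β.support := by
          by_contra hne
          push Not at hne
          exact hβ (Finsupp.support_eq_empty.mp (Finset.eq_empty_of_forall_notMem hne))
        have hd : simpleRoot n i ∣ MvPowerSeries.coeff β (Omega (aVar n 0)) := by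
          have hj' : β j ≠ 0 := Finsupp.mem_support_iff.mp hj
          rw [coeff_Omega]
          refine dvd_trans ?_ (Finset.dvd_prod_of_mem _ hj)
          simp only [omegaFactor, PowerSeries.coeff_mk, hj', if_false, simpleRoot, h0, if_true]
          rw [neg_mul, neg_dvd]
          exact mul_dvd_mul_left _ (dvd_pow_self _ hj')
        rw [map_sub, MvPowerSeries.coeff_one, if_neg hβ, zero_sub, dvd_neg]
        exact hd
    refine ⟨g + h * MvPowerSeries.map (reflS n i).toRingHom f, ?_⟩
    rw [mul_add, ← mul_assoc, hg, hh, reflSeries, if_pos h0]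
    ring
  · refine ⟨g, ?_⟩
    rw [hg, reflSeries, if_neg h0, one_mul]

/-- The operator `A_i = α_i^{-1} (1 - s_i)`: `A_i f` is the series `g` with `α_i g = f - s_i f`. -/
def nilHecke (n : ℕ) (i : Fin (n + 1)) (f : MvPowerSeries ℕ (S n)) : MvPowerSeries ℕ (S n) :=
  (exists_quotient n i f).choose

theorem simpleRoot_mul_nilHecke (n : ℕ) (i : Fin (n + 1)) (f : MvPowerSeries ℕ (S n)) :
    MvPowerSeries.C (simpleRoot n i) * nilHecke n i f = f - reflSeries n i f :=
  (exists_quotient n i f).choose_spec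

/-- The operator `A_w = A_{i_1} ⋯ A_{i_l}` for a reduced expression `w = s_{i_1} ⋯ s_{i_l}`. -/
def nilHeckeW (n : ℕ) (w : affineWeyl n) (f : MvPowerSeries ℕ (S n)) : MvPowerSeries ℕ (S n) :=
  (reducedWord n w).foldr (nilHecke n) f

/-- The dual affine Schur `P`-function `P̂_w^{(n)}(y|a) = A_w(1)`. -/
def dualAffineSchurP (n : ℕ) (w : affineWeyl n) : MvPowerSeries ℕ (S n) := nilHeckeW n w 1

/-! ### Factorial `Q`-functions and their duals -/

/-- A strictly decreasing list of positive integers. -/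
def IsStrictPartition (l : List ℕ) : Prop := l.Pairwise (· > ·) ∧ ∀ p ∈ l, 0 < p

/-- The set `𝒮𝒫` of strict partitions. -/
def StrictPartition : Type := {l : List ℕ // IsStrictPartition l}

/-- `ℂ[a] = ℂ[a_1, a_2, …]`, where `X j` stands for `a_{j+1}`. -/
abbrev Ca : Type := MvPolynomial ℕ ℂ

/-- The field of fractions of `ℂ[a][x_1, …, x_N]`. -/
abbrev FracX (N : ℕ) : Type := FractionRing (MvPolynomial (Fin N) Ca)

/-- `x_{i+1}` in the field of fractions. -/
def xVar (N : ℕ) (i : Fin N) : FracX N :=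
  algebraMap (MvPolynomial (Fin N) Ca) (FracX N) (MvPolynomial.X i)

/-- The inclusion of `ℂ[a]` in the field of fractions. -/
def ofCa (N : ℕ) : Ca →+* FracX N :=
  (algebraMap (MvPolynomial (Fin N) Ca) (FracX N)).comp MvPolynomial.C

/-- `((x|a))^k = 2x (x - a_1) ⋯ (x - a_{k-1})`, for `k ≥ 1`. -/
def facPow {N : ℕ} (x : FracX N) (k : ℕ) : FracX N :=
  2 * x * ∏ j ∈ range (k - 1), (x - ofCa N (MvPolynomial.X j))

/-- Ivanov's factorial `Q`-function in finitely many variables,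
`Q_λ(x_1, …, x_N|a) = 1/(N - ℓ)! ∑_{w ∈ S_N}
  w (∏_{i ≤ ℓ} ((x_i|a))^{λ_i} ∏_{i ≤ ℓ} ∏_{i < j ≤ N} (x_i + x_j)/(x_i - x_j))`
where `ℓ = ℓ(λ)`; it is zero if `ℓ > N`. -/
def factorialQ (N : ℕ) (l : StrictPartition) : FracX N :=
  if l.val.length ≤ N then
    ((N - l.val.length).factorial : FracX N)⁻¹ * ∑ w : Equiv.Perm (Fin N),
      ∏ i ∈ univ.filter (fun i : Fin N => i.val < l.val.length),
        (facPow (xVar N (w i)) (l.val.getD i.val 0) *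
          ∏ j ∈ univ.filter (fun j : Fin N => i < j),
            (xVar N (w i) + xVar N (w j)) / (xVar N (w i) - xVar N (w j)))
  else 0

/-- The family `(F_λ(y|a))_λ` of power series in `y` over `ℂ[a]` is dual to the factorial
`Q`-functions: the sum `∑_λ F_λ(y|a) Q_λ(x|a)` is locally finite, and
`∏_{i,j} (1 + x_i y_j)/(1 - x_i y_j) = ∑_λ F_λ(y|a) Q_λ(x|a)`. As the functions `Q_λ(x|a)` are stable
(setting `x_{N+1} = 0` turns `Q_λ(x_1, …, x_{N+1}|a)` into `Q_λ(x_1, …, x_N|a)`), the identity in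
infinitely many variables `x` is the family of its truncations to `x_1, …, x_N`. -/
def IsDualFamily (F : StrictPartition → MvPowerSeries ℕ Ca) : Prop :=
  (∀ β : ℕ →₀ ℕ, {l | MvPowerSeries.coeff β (F l) ≠ 0}.Finite) ∧
  ∀ (N : ℕ) (β : ℕ →₀ ℕ),
    MvPowerSeries.coeff β (∏ i : Fin N, Omega (xVar N i)) =
      ∑ᶠ l : StrictPartition, ofCa N (MvPowerSeries.coeff β (F l)) * factorialQ N l

/-- The dual factorial `P`-functions `P̂_λ(y|a)` of Nakagawa and Naruse: the unique family dual to
the factorial `Q`-functions `Q_λ(x|a)`. -/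
def dualFactorialP : StrictPartition → MvPowerSeries ℕ Ca := Classical.epsilon IsDualFamily

/-! ### The periodic specialization -/

/-- `a^{(n)}_{j+1}`: the sequence `a^{(n)}` has period `2n` and starts with
`a_1, …, a_n, -a_n, …, -a_1`. -/
def aPeriodic (n j : ℕ) : S n :=
  if j % (2 * n) < n then aVar n (j % (2 * n)) else -aVar n (2 * n - 1 - j % (2 * n))

/-- `f(y|a) ↦ f(y|a^{(n)})`. -/
def specialize (n : ℕ) : MvPowerSeries ℕ Ca →+* MvPowerSeries ℕ (S n) :=
  MvPowerSeries.map (MvPolynomial.aeval (R := ℂ) (aPeriodic n)).toRingHom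

end AffineC

end

noncomputable section
namespace AffineC

/-! ### Braid relations for divided difference operators -/

/-! Let the parameters become infinitely many. Over `ℂ[a_1, a_2, …]` the operators A_0, A_1, … (with
s_0 twisted by Ω(a_1|y)) satisfy the nil-Hecke relations of type C_∞. These give
`nilInf_succ_nilSeries`: on P_λ = A_{ρ_{λ_l}} ⋯ A_{ρ_{λ_1}}(1), for λ strict, A_i with i ≥ 1
lengthens the row of length i by one box if the result is a strict partition, and gives zero
otherwise; A_0 adds a row of length 1 or gives zero.

The P_λ are the dual factorial P-functions. Exchanging a_i and a_{i+1} changes Q_λ(x|a) by a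
multiple of the Q-function with one box removed (`pointQ_swap`), and setting one variable to a_1
negates a_1 for the other variables, up to a term in which the part 1 is dropped
(`pointQ_insert_first`). So the kernel K(x; a) = ∑ P_λ Q_λ is symmetric in the parameters
(`kernelSum_reflCa`), and K(x, a_1; a) = Ω(a_1|y) K(x; -a_1, a_2, …) (`kernelSum_insert_zero`). By
induction on the number of variables, the Cauchy identity holds when the new variable is any a_k.
Coefficientwise both sides are rational in that variable with a fixed denominator, and infinitely
many values suffice (`kernelSum_eq`). The dual family is unique because the values of the
Q-functions at parameters are triangular (`eq_zero_of_finsum_factorialQ`).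

Under a ↦ a^{(n)}, A_0 and A_n of the affine group come from the operators of the same index. For 0
< i < n, s_i acts on one period as s_i s_{2n-i}, so A_i becomes A_i + s_i A_{2n-i}
(`nilHecke_mid_specialize`). With fewer than 2n boxes the rows i and 2n-i do not both occur; hence
one summand vanishes, s_i is harmless in the other, and A_i still adds a single box. Induction along
a reduced word of w concludes (`exists_rhoProd_eq_wordProd`): a letter that does not add a box
either removes one, against reducedness, or fixes the image of the origin, against minimality in the
coset. That the partition found is λ_w is read off from images of the origin (`eq_of_rhoProd_eq`).
-/

theorem braid_two_field {K : Type*} [Field K] [CharZero K] (τ σ : K →+* K) (a b u v : K)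
    (ha : a ≠ 0) (hb : b ≠ 0) (hab : a - b ≠ 0) (hab' : a + b ≠ 0) (hu : u ≠ 0) (hv : v ≠ 0)
    (τa : τ a = -a) (τb : τ b = b) (σa : σ a = b) (σb : σ b = a)
    (τu : τ u = u⁻¹) (τv : τ v = v) (σu : σ u = v) (σv : σ v = u)
    (A B : K → K) (hA : ∀ x, A x = (x - u * τ x) / (-2 * a)) (hB : ∀ x, B x = (x - σ x) / (a - b))
    (f f1 f2 f3 f4 f5 f6 f7 : K)
    (h0 : τ f = f1) (h0' : σ f = f2) (h1 : τ f1 = f) (h1' : σ f1 = f4) (h2 : τ f2 = f3)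
    (h2' : σ f2 = f) (h3 : τ f3 = f2) (h3' : σ f3 = f5) (h4 : τ f4 = f6) (h4' : σ f4 = f1)
    (h5 : τ f5 = f7) (h6' : σ f6 = f7) :
    A (B (A (B f))) = B (A (B (A f))) := by
  have e1 : b - a = -(a - b) := by ring
  have e2 : -a - b = -(a + b) := by ring
  have e3 : -b - a = -(a + b) := by ring
  have e4 : b + a = a + b := by ring
  have e5 : -b + a = a - b := by ring
  -- The images of f that occur all lie in its orbit f, f1, …, f7 under the dihedral group of order
  -- 8, so the claim is a rational identity in these, a, b, u and v.
  simp only [hA, hB, map_sub, map_mul, map_div₀, map_neg, map_inv₀, τa, τb, σa, σb, τu, τv, σu, σv,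
    h0, h0', h1, h1', h2, h2', h3, h3', h4, h4', h5, h6', map_ofNat, sub_neg_eq_add]
  -- The denominators a - b and a + b are kept as atoms while they are cleared.
  obtain ⟨d, hd⟩ : ∃ d, d = a - b := ⟨_, rfl⟩
  obtain ⟨e, he⟩ : ∃ e, e = a + b := ⟨_, rfl⟩
  rw [← hd] at hab
  rw [← he] at hab'
  simp only [neg_neg, e1, e2, e3, e4, e5]
  simp only [← hd, ← he]
  field_simp
  subst hd he
  ring

theorem braid_three_field {K : Type*} [Field K] (τ σ : K →+* K) (a b c : K)
    (hab : a - b ≠ 0) (hbc : b - c ≠ 0) (hac : a - c ≠ 0)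
    (τa : τ a = b) (τb : τ b = a) (τc : τ c = c) (σa : σ a = a) (σb : σ b = c) (σc : σ c = b)
    (A B : K → K) (hA : ∀ x, A x = (x - τ x) / (a - b)) (hB : ∀ x, B x = (x - σ x) / (b - c))
    (f f1 f2 f3 f4 f5 : K)
    (h0 : τ f = f1) (h0' : σ f = f2) (h1 : τ f1 = f) (h1' : σ f1 = f4) (h2 : τ f2 = f3)
    (h2' : σ f2 = f) (h3' : σ f3 = f5) (h4 : τ f4 = f5) :
    A (B (A f)) = B (A (B f)) := by
  have hba : b - a ≠ 0 := by rw [← neg_sub]; exact neg_ne_zero.mpr hab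
  have hcb : c - b ≠ 0 := by rw [← neg_sub]; exact neg_ne_zero.mpr hbc
  simp only [hA, hB, map_sub, map_div₀, τa, τb, σa, σb, τc, σc, h0, h0', h1, h1', h2, h2', h3', h4]
  field_simp
  ring

/-! ### Divided differences on integral domains -/

section Domain

theorem injective_algebraMap_comp {R : Type*} [CommRing R] {τ : R →+* R} (hτ : ∀ x, τ (τ x) = x) :
    Function.Injective ((algebraMap R (FractionRing R)).comp τ) := by
  rw [RingHom.coe_comp]
  exact (IsFractionRing.injective R (FractionRing R)).comp
    (Function.LeftInverse.injective (g := τ) hτ)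

variable {R : Type*} [CommRing R] [IsDomain R]

/-- Involutions are injective, so τ and σ extend to the fraction field, where the relation is a
rational identity. The factor u with `u * τ u = 1` is the twist of s_0, and v is its image under σ.
-/
theorem braid_two [CharZero R] (τ σ : R →+* R) (a b u v : R)
    (ha : a ≠ 0) (hb : b ≠ 0) (hab : a - b ≠ 0) (hab' : a + b ≠ 0)
    (hττ : ∀ x, τ (τ x) = x) (hσσ : ∀ x, σ (σ x) = x)
    (hτσ : ∀ x, τ (σ (τ (σ x))) = σ (τ (σ (τ x))))
    (τa : τ a = -a) (τb : τ b = b) (σa : σ a = b) (τu : u * τ u = 1) (τv : τ v = v) (σu : σ u = v)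
    (A B : R → R) (hA : ∀ x, -2 * a * A x = x - u * τ x) (hB : ∀ x, (a - b) * B x = x - σ x)
    (f : R) : A (B (A (B f))) = B (A (B (A f))) := by
  have inj := IsFractionRing.injective R (FractionRing R)
  set ι := algebraMap R (FractionRing R)
  have ne {x : R} (hx : x ≠ 0) : ι x ≠ 0 := (map_ne_zero_iff ι inj).mpr hx
  set T := IsFractionRing.lift (K := FractionRing R) (injective_algebraMap_comp hττ)
  set U := IsFractionRing.lift (K := FractionRing R) (injective_algebraMap_comp hσσ)
  have hT : ∀ x, T (ι x) = ι (τ x) := IsFractionRing.lift_algebraMap _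
  have hU : ∀ x, U (ι x) = ι (σ x) := IsFractionRing.lift_algebraMap _
  have hu : u ≠ 0 := by rintro rfl; simp at τu
  have hv : v ≠ 0 := by
    rintro rfl
    exact hu (by rw [← hσσ u, σu, map_zero])
  have hA' : ∀ x, ι (A x) = (fun y => (y - ι u * T y) / (-2 * ι a)) (ι x) := fun x => by
    have e2 : (-2 * ι a) ≠ 0 := mul_ne_zero (by norm_num) (ne ha)
    simp only [hT]
    rw [eq_div_iff e2, ← map_mul, ← map_sub, ← hA, map_mul, map_mul, map_neg, map_ofNat]
    ring
  have hB' : ∀ x, ι (B x) = (fun y => (y - U y) / (ι a - ι b)) (ι x) := fun x => by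
    have e2 : ι a - ι b ≠ 0 := by rw [← map_sub]; exact ne hab
    simp only [hU]
    rw [eq_div_iff e2, ← map_sub, ← map_sub, ← hB, map_mul]
    ring
  apply inj
  simp only [hA', hB']
  refine braid_two_field T U (ι a) (ι b) (ι u) (ι v) (ne ha) (ne hb)
    (by rw [← map_sub]; exact ne hab) (by rw [← map_add]; exact ne hab') (ne hu) (ne hv)
    (by rw [hT, τa, map_neg]) (by rw [hT, τb]) (by rw [hU, σa]) (by rw [hU, ← σa, hσσ])
    ?_ (by rw [hT, τv]) (by rw [hU, σu]) (by rw [hU, ← σu, hσσ]) _ _ (fun _ => rfl) (fun _ => rfl)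
    (ι f) (ι (τ f)) (ι (σ f)) (ι (τ (σ f))) (ι (σ (τ f))) (ι (σ (τ (σ f)))) (ι (τ (σ (τ f))))
    (ι (τ (σ (τ (σ f))))) (hT _) (hU _) ?_ (hU _) (hT _) ?_ ?_ (hU _) (hT _) ?_ (hT _) ?_
  · rw [hT, ← mul_right_inj' (ne hu), mul_inv_cancel₀ (ne hu), ← map_mul, τu, map_one]
  · rw [hT, hττ]
  · rw [hU, hσσ]
  · rw [hT, hττ]
  · rw [hU, hσσ]
  · rw [hU, hτσ]

theorem braid_three (τ σ : R →+* R) (a b c : R)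
    (hab : a - b ≠ 0) (hbc : b - c ≠ 0) (hac : a - c ≠ 0)
    (hττ : ∀ x, τ (τ x) = x) (hσσ : ∀ x, σ (σ x) = x)
    (hτσ : ∀ x, τ (σ (τ x)) = σ (τ (σ x)))
    (τa : τ a = b) (τc : τ c = c) (σa : σ a = a) (σb : σ b = c)
    (A B : R → R) (hA : ∀ x, (a - b) * A x = x - τ x) (hB : ∀ x, (b - c) * B x = x - σ x)
    (f : R) : A (B (A f)) = B (A (B f)) := by
  have inj := IsFractionRing.injective R (FractionRing R)
  set ι := algebraMap R (FractionRing R)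
  have ne {x y : R} (hx : x - y ≠ 0) : ι x - ι y ≠ 0 := by
    rw [← map_sub]
    exact (map_ne_zero_iff ι inj).mpr hx
  set T := IsFractionRing.lift (K := FractionRing R) (injective_algebraMap_comp hττ)
  set U := IsFractionRing.lift (K := FractionRing R) (injective_algebraMap_comp hσσ)
  have hT : ∀ x, T (ι x) = ι (τ x) := IsFractionRing.lift_algebraMap _
  have hU : ∀ x, U (ι x) = ι (σ x) := IsFractionRing.lift_algebraMap _
  have hA' : ∀ x, ι (A x) = (fun y => (y - T y) / (ι a - ι b)) (ι x) := fun x => by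
    simp only [hT]
    rw [eq_div_iff (ne hab), ← map_sub, ← map_sub, ← hA, map_mul]
    ring
  have hB' : ∀ x, ι (B x) = (fun y => (y - U y) / (ι b - ι c)) (ι x) := fun x => by
    simp only [hU]
    rw [eq_div_iff (ne hbc), ← map_sub, ← map_sub, ← hB, map_mul]
    ring
  apply inj
  simp only [hA', hB']
  refine braid_three_field T U (ι a) (ι b) (ι c) (ne hab) (ne hbc) (ne hac)
    (by rw [hT, τa]) (by rw [hT, ← τa, hττ]) (by rw [hT, τc]) (by rw [hU, σa])
    (by rw [hU, σb]) (by rw [hU, ← σb, hσσ]) _ _ (fun _ => rfl) (fun _ => rfl)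
    (ι f) (ι (τ f)) (ι (σ f)) (ι (τ (σ f))) (ι (σ (τ f))) (ι (σ (τ (σ f))))
    (hT _) (hU _) ?_ (hU _) (hT _) ?_ (hU _) ?_
  · rw [hT, hττ]
  · rw [hU, hσσ]
  · rw [hT, hτσ]

theorem commute_dividedDiff (s t : R → R) (a b : R) (ha : a ≠ 0) (hb : b ≠ 0)
    (hs : ∀ x, s (b * x) = b * s x) (ht : ∀ x, t (a * x) = a * t x)
    (hs' : ∀ x y, s (x - y) = s x - s y) (ht' : ∀ x y, t (x - y) = t x - t y)
    (hst : ∀ x, s (t x) = t (s x))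
    (A B : R → R) (hA : ∀ x, a * A x = x - s x) (hB : ∀ x, b * B x = x - t x) (f : R) :
    A (B f) = B (A f) := by
  apply mul_left_cancel₀ (mul_ne_zero ha hb)
  have h1 : a * b * A (B f) = b * B f - s (b * B f) := by
    rw [mul_comm a, mul_assoc, hA, mul_sub, hs]
  have h2 : a * b * B (A f) = a * A f - t (a * A f) := by
    rw [mul_assoc, hB, mul_sub, ht]
  rw [h1, h2, hA, hB, hs', ht', hst]
  ring

/-- `A f` is invariant under s, since both the numerator f - s f and the root a change sign. -/
theorem dividedDiff_dividedDiff (s : R → R) (a : R) (ha : a ≠ 0)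
    (hs : ∀ x, s (a * x) = -a * s x) (hs' : ∀ x y, s (x - y) = s x - s y) (hss : ∀ x, s (s x) = x)
    (A : R → R) (hA : ∀ x, a * A x = x - s x) (f : R) : A (A f) = 0 := by
  have h : s (A f) = A f := by
    apply mul_left_cancel₀ ha
    have := hs (A f)
    rw [hA, hs', hss] at this
    rw [hA]
    linear_combination this
  have h3 := hA (A f)
  rw [h, sub_self] at h3
  exact (mul_eq_zero.mp h3).resolve_left ha

end Domain

/-! ### The nil-Hecke operators in infinitely many parameters -/

/-- The simple roots `-2 a_1` and `a_i - a_{i+1}`, `i ≥ 1`. -/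
def rootInf : ℕ → Ca
  | 0 => -(MvPolynomial.X 0 + MvPolynomial.X 0)
  | i + 1 => MvPolynomial.X i - MvPolynomial.X (i + 1)

/-- The image of `a_{k+1}` under `s_i`. -/
def reflVar : ℕ → ℕ → Ca
  | 0, k => if k = 0 then -MvPolynomial.X 0 else MvPolynomial.X k
  | i + 1, k => MvPolynomial.X (Equiv.swap i (i + 1) k)

/-- The action of `s_i` on `ℂ[a]`. -/
def reflCa (i : ℕ) : Ca →ₐ[ℂ] Ca := MvPolynomial.aeval (reflVar i)

@[simp] theorem reflCa_X (i k : ℕ) : reflCa i (MvPolynomial.X k) = reflVar i k :=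
  MvPolynomial.aeval_X _ _

theorem reflCa_comp_self (i : ℕ) : (reflCa i).comp (reflCa i) = AlgHom.id ℂ Ca := by
  apply MvPolynomial.algHom_ext
  intro k
  cases i with
  | zero => by_cases hk : k = 0 <;> simp [reflVar, hk]
  | succ i => simp [reflVar]

theorem reflCa_reflCa (i : ℕ) (p : Ca) : reflCa i (reflCa i p) = p :=
  DFunLike.congr_fun (reflCa_comp_self i) p

theorem reflCa_rootInf (i : ℕ) : reflCa i (rootInf i) = -rootInf i := by
  cases i with
  | zero => simp [rootInf, reflVar]
  | succ i => simp [rootInf, reflVar]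

theorem rootInf_ne_zero (i : ℕ) : rootInf i ≠ 0 := by
  cases i with
  | zero => simp [rootInf]
  | succ i =>
    rw [rootInf, sub_ne_zero]
    exact fun h => absurd (MvPolynomial.X_injective h) (by omega)

theorem reflCa_reflCa_comm {i j : ℕ} (h : i + 2 ≤ j) (p : Ca) :
    reflCa i (reflCa j p) = reflCa j (reflCa i p) := by
  have : (reflCa i).comp (reflCa j) = (reflCa j).comp (reflCa i) := by
    apply MvPolynomial.algHom_ext
    intro k
    obtain ⟨j, rfl⟩ : ∃ j', j = j' + 1 := ⟨j - 1, by omega⟩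
    cases i with
    | zero =>
      simp only [AlgHom.comp_apply, reflCa_X, reflVar, Equiv.swap_apply_def]
      have hj : j ≠ 0 := by omega
      by_cases hk : k = 0
      · subst hk
        simp [reflVar, Equiv.swap_apply_def, hj.symm]
      · rw [if_neg hk]
        simp only [reflCa_X, reflVar, Equiv.swap_apply_def]
        split_ifs <;> first | rfl | omega | simp_all
    | succ i =>
      simp only [AlgHom.comp_apply, reflCa_X, reflVar]
      congr 1
      simp only [Equiv.swap_apply_def]
      split_ifs <;> omega
  exact DFunLike.congr_fun this p

theorem reflCa_rootInf_of_lt {i j : ℕ} (h : i + 2 ≤ j) :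
    reflCa i (rootInf j) = rootInf j ∧ reflCa j (rootInf i) = rootInf i := by
  obtain ⟨j, rfl⟩ : ∃ j', j = j' + 1 := ⟨j - 1, by omega⟩
  have h1 : j ≠ 0 := by omega
  cases i with
  | zero =>
    simp [rootInf, reflVar, Equiv.swap_apply_def, h1, h1.symm]
  | succ i =>
    have h2 : ¬ j = i ∧ ¬ j = i + 1 ∧ ¬ j + 1 = i ∧ ¬ i = j ∧ ¬ i = j + 1 ∧ ¬ i + 1 = j := by omega
    simp [rootInf, reflVar, Equiv.swap_apply_def, h2]

theorem dvd_sub_reflCa (i : ℕ) (p : Ca) : rootInf i ∣ p - reflCa i p := by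
  induction p using MvPolynomial.induction_on with
  | C c => simp [reflCa]
  | add p q hp hq =>
    rw [map_add, add_sub_add_comm]
    exact dvd_add hp hq
  | mul_X p k hp =>
    have hX : rootInf i ∣ MvPolynomial.X k - reflCa i (MvPolynomial.X k) := by
      rw [reflCa_X]
      cases i with
      | zero =>
        by_cases hk : k = 0
        · subst hk
          exact ⟨-1, by simp [reflVar, rootInf]⟩
        · simp [reflVar, hk]
      | succ i =>
        rw [reflVar, Equiv.swap_apply_def]
        split_ifs with h1 h2
        · subst h1; rfl
        · subst h2; rw [dvd_sub_comm]; rfl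
        · simp
    have : p * MvPolynomial.X k - reflCa i (p * MvPolynomial.X k) =
        (p - reflCa i p) * MvPolynomial.X k +
          reflCa i p * (MvPolynomial.X k - reflCa i (MvPolynomial.X k)) := by
      rw [map_mul]; ring
    rw [this]
    exact dvd_add (hp.mul_right _) (hX.mul_left _)

/-- The action of `s_i` on coefficients. -/
def coeffRefl (i : ℕ) : MvPowerSeries ℕ Ca →+* MvPowerSeries ℕ Ca :=
  MvPowerSeries.map (reflCa i).toRingHom

/-- The factor `Ω(a_1|y)` for `i = 0`, and `1` otherwise. -/
def twist (i : ℕ) : MvPowerSeries ℕ Ca := if i = 0 then Omega (MvPolynomial.X 0) else 1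

/-- The action of `s_i` on power series in `y` over `ℂ[a]`. -/
def reflInf (i : ℕ) (f : MvPowerSeries ℕ Ca) : MvPowerSeries ℕ Ca := twist i * coeffRefl i f

theorem two_mul_dvd_Omega_sub_one {R : Type*} [CommRing R] (u : R) (β : ℕ →₀ ℕ) :
    2 * u ∣ MvPowerSeries.coeff β (1 - Omega u) := by
  by_cases hβ : β = 0
  · subst hβ
    rw [map_sub, coeff_Omega]
    simp
  · obtain ⟨j, hj⟩ := Finsupp.support_nonempty_iff.mpr hβ
    have hj' : β j ≠ 0 := Finsupp.mem_support_iff.mp hj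
    rw [map_sub, MvPowerSeries.coeff_one, if_neg hβ, zero_sub, dvd_neg, coeff_Omega]
    refine dvd_trans ?_ (Finset.dvd_prod_of_mem _ hj)
    simp only [omegaFactor, PowerSeries.coeff_mk, hj', if_false]
    exact mul_dvd_mul_left _ (dvd_pow_self _ hj')

/-- Here f - Ω·sf = (f - sf) + (1 - Ω)·sf, and the second summand is divisible as well, because
every nonconstant coefficient of Ω(a_1|y) contains 2 a_1. -/
theorem exists_quotientInf (i : ℕ) (f : MvPowerSeries ℕ Ca) :
    ∃ g, MvPowerSeries.C (rootInf i) * g = f - reflInf i f := by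
  obtain ⟨g, hg⟩ := exists_C_mul_eq (rootInf i) (f - coeffRefl i f) fun β => by
    rw [map_sub, coeffRefl, MvPowerSeries.coeff_map]
    exact dvd_sub_reflCa i _
  obtain ⟨h, hh⟩ := exists_C_mul_eq (rootInf i) (1 - twist i) fun β => by
    cases i with
    | zero =>
      rw [twist, if_pos rfl, rootInf, ← two_mul, neg_dvd]
      exact two_mul_dvd_Omega_sub_one _ _
    | succ i => simp [twist]
  refine ⟨g + h * coeffRefl i f, ?_⟩
  rw [mul_add, ← mul_assoc, hg, hh, reflInf]
  ring

/-- The operator `A_i = α_i^{-1} (1 - s_i)` on power series over `ℂ[a]`. -/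
def nilInf (i : ℕ) (f : MvPowerSeries ℕ Ca) : MvPowerSeries ℕ Ca := (exists_quotientInf i f).choose

theorem rootInf_mul_nilInf (i : ℕ) (f : MvPowerSeries ℕ Ca) :
    MvPowerSeries.C (rootInf i) * nilInf i f = f - reflInf i f :=
  (exists_quotientInf i f).choose_spec

instance : IsDomain (MvPowerSeries ℕ Ca) := NoZeroDivisors.to_isDomain _

theorem C_ne_zero {σ R : Type*} [CommRing R] {c : R} (hc : c ≠ 0) :
    (MvPowerSeries.C c : MvPowerSeries σ R) ≠ 0 :=
  fun h => hc (MvPowerSeries.C_injective (h.trans (map_zero _).symm))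

/-! ### Relations among the nil-Hecke operators -/

theorem omegaFactor_mul_neg {R : Type*} [CommRing R] (u : R) :
    omegaFactor u * omegaFactor (-u) = 1 := by
  have h1 := omegaFactor_spec u
  have h2 := omegaFactor_spec (-u)
  rw [map_neg] at h2
  have hu : IsUnit (1 - PowerSeries.C u * PowerSeries.X) := by
    rw [PowerSeries.isUnit_iff_constantCoeff]
    simp
  apply hu.mul_left_cancel
  rw [← mul_assoc, h1]
  linear_combination h2

theorem coeff_zero_omegaFactor {R : Type*} [CommRing R] (u : R) :
    PowerSeries.coeff 0 (omegaFactor u) = 1 := by simp [omegaFactor]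

/-- The antidiagonal of β is the product of the antidiagonals of its exponents, so the coefficient
of the product factors over the variables y_j, where the one-variable identity applies. -/
theorem Omega_mul_neg {R : Type*} [CommRing R] (u : R) : Omega u * Omega (-u) = 1 := by
  classical
  ext β
  rw [MvPowerSeries.coeff_mul]
  have key : ∑ p ∈ Finset.HasAntidiagonal.antidiagonal β, MvPowerSeries.coeff p.1 (Omega u) *
      MvPowerSeries.coeff p.2 (Omega (-u)) =
      ∏ j ∈ β.support, PowerSeries.coeff (β j) (omegaFactor u * omegaFactor (-u)) := by
    simp only [PowerSeries.coeff_mul]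
    rw [Finset.prod_sum]
    refine Finset.sum_bij' (fun p _ j _ => (p.1 j, p.2 j))
      (fun q _ => (Finsupp.indicator β.support fun j h => (q j h).1,
        Finsupp.indicator β.support fun j h => (q j h).2)) ?_ ?_ ?_ ?_ ?_
    · intro p hp
      simp only [Finset.mem_pi, Finset.HasAntidiagonal.mem_antidiagonal] at hp ⊢
      intro j _
      rw [← hp, Finsupp.add_apply]
    · intro q hq
      simp only [Finset.mem_pi, Finset.HasAntidiagonal.mem_antidiagonal] at hq ⊢
      ext j
      rw [Finsupp.add_apply, Finsupp.indicator_apply, Finsupp.indicator_apply]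
      by_cases hj : j ∈ β.support
      · rw [dif_pos hj, dif_pos hj, hq j hj]
      · rw [dif_neg hj, dif_neg hj, Finsupp.notMem_support_iff.mp hj, add_zero]
    · intro p hp
      rw [Finset.HasAntidiagonal.mem_antidiagonal] at hp
      have h0 : ∀ j, j ∉ β.support → p.1 j = 0 ∧ p.2 j = 0 := fun j hj => by
        rw [Finsupp.notMem_support_iff, ← hp, Finsupp.add_apply] at hj
        omega
      refine Prod.ext ?_ ?_ <;>
      · ext j
        rw [Finsupp.indicator_apply]
        split_ifs with hj
        · rfl
        · simp [h0 j hj]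
    · intro q hq
      funext j hj
      simp only [Finsupp.indicator_apply, dif_pos hj]
    · intro p hp
      rw [Finset.HasAntidiagonal.mem_antidiagonal] at hp
      rw [coeff_Omega, coeff_Omega, Finsupp.prod_of_support_subset (s := β.support),
        Finsupp.prod_of_support_subset (s := β.support), ← Finset.prod_mul_distrib,
        Finset.prod_attach β.support (fun j => PowerSeries.coeff (p.1 j) (omegaFactor u) *
          PowerSeries.coeff (p.2 j) (omegaFactor (-u)))]
      · rw [← hp]; intro j hj; simp at hj ⊢; omega
      · intros; exact coeff_zero_omegaFactor _
      · rw [← hp]; intro j hj; simp at hj ⊢; omega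
      · intros; exact coeff_zero_omegaFactor _
  rw [key, omegaFactor_mul_neg, MvPowerSeries.coeff_one]
  by_cases hβ : β = 0
  · simp [hβ]
  · rw [if_neg hβ]
    obtain ⟨j, hj⟩ := Finsupp.support_nonempty_iff.mpr hβ
    exact Finset.prod_eq_zero hj
      (by rw [PowerSeries.coeff_one, if_neg (Finsupp.mem_support_iff.mp hj)])

theorem map_Omega {R T : Type*} [CommRing R] [CommRing T] (φ : R →+* T) (u : R) :
    MvPowerSeries.map φ (Omega u) = Omega (φ u) := by
  ext β
  rw [MvPowerSeries.coeff_map, coeff_Omega, coeff_Omega, Finsupp.prod, Finsupp.prod, map_prod]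
  refine Finset.prod_congr rfl fun j hj => ?_
  simp [omegaFactor, apply_ite φ, map_ofNat]

theorem coeffRefl_C (i : ℕ) (c : Ca) :
    coeffRefl i (MvPowerSeries.C c) = MvPowerSeries.C (reflCa i c) :=
  MvPowerSeries.map_C _ _

theorem coeffRefl_coeffRefl (i : ℕ) (f : MvPowerSeries ℕ Ca) : coeffRefl i (coeffRefl i f) = f := by
  ext β : 1
  simp only [coeffRefl, MvPowerSeries.coeff_map]
  exact reflCa_reflCa i _

theorem twist_succ (i : ℕ) : twist (i + 1) = 1 := rfl

theorem reflInf_succ (i : ℕ) (f : MvPowerSeries ℕ Ca) : reflInf (i + 1) f = coeffRefl (i + 1) f :=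
  one_mul _

theorem twist_mul_coeffRefl_twist (i : ℕ) : twist i * coeffRefl i (twist i) = 1 := by
  cases i with
  | zero =>
    rw [twist, if_pos rfl, coeffRefl, map_Omega]
    have : (reflCa 0).toRingHom (MvPolynomial.X 0) = -MvPolynomial.X 0 := reflCa_X 0 0
    rw [this, Omega_mul_neg]
  | succ i => simp [twist_succ]

theorem reflInf_reflInf (i : ℕ) (f : MvPowerSeries ℕ Ca) : reflInf i (reflInf i f) = f := by
  rw [reflInf, reflInf, map_mul, coeffRefl_coeffRefl, ← mul_assoc, twist_mul_coeffRefl_twist,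
    one_mul]

theorem reflInf_sub (i : ℕ) (f g : MvPowerSeries ℕ Ca) :
    reflInf i (f - g) = reflInf i f - reflInf i g := by
  rw [reflInf, map_sub, mul_sub]; rfl

theorem reflInf_C_mul (i : ℕ) (c : Ca) (f : MvPowerSeries ℕ Ca) :
    reflInf i (MvPowerSeries.C c * f) = MvPowerSeries.C (reflCa i c) * reflInf i f := by
  rw [reflInf, map_mul, coeffRefl_C, reflInf]
  ring

theorem nilInf_nilInf (i : ℕ) (f : MvPowerSeries ℕ Ca) : nilInf i (nilInf i f) = 0 :=
  dividedDiff_dividedDiff (reflInf i) (MvPowerSeries.C (rootInf i)) (C_ne_zero (rootInf_ne_zero i))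
    (fun x => by rw [reflInf_C_mul, reflCa_rootInf, map_neg])
    (reflInf_sub i) (reflInf_reflInf i) (nilInf i) (rootInf_mul_nilInf i) f

theorem coeffRefl_comm {i j : ℕ} (h : i + 2 ≤ j) (f : MvPowerSeries ℕ Ca) :
    coeffRefl i (coeffRefl j f) = coeffRefl j (coeffRefl i f) := by
  ext β : 1
  simp only [coeffRefl, MvPowerSeries.coeff_map]
  exact reflCa_reflCa_comm h _

theorem coeffRefl_twist_zero {j : ℕ} (h : 2 ≤ j) : coeffRefl j (twist 0) = twist 0 := by
  obtain ⟨j, rfl⟩ : ∃ j', j = j' + 1 := ⟨j - 1, by omega⟩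
  have hj : (0 : ℕ) ≠ j := by omega
  rw [twist, if_pos rfl, coeffRefl, map_Omega]
  congr 1
  exact (reflCa_X _ _).trans (by simp [reflVar, Equiv.swap_apply_def, hj])

theorem nilInf_comm {i j : ℕ} (h : i + 2 ≤ j) (f : MvPowerSeries ℕ Ca) :
    nilInf i (nilInf j f) = nilInf j (nilInf i f) := by
  refine commute_dividedDiff (reflInf i) (reflInf j) (MvPowerSeries.C (rootInf i))
    (MvPowerSeries.C (rootInf j)) (C_ne_zero (rootInf_ne_zero i)) (C_ne_zero (rootInf_ne_zero j))
    (fun x => by rw [reflInf_C_mul, (reflCa_rootInf_of_lt h).1])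
    (fun x => by rw [reflInf_C_mul, (reflCa_rootInf_of_lt h).2])
    (reflInf_sub i) (reflInf_sub j) (fun x => ?_)
    (nilInf i) (nilInf j) (rootInf_mul_nilInf i) (rootInf_mul_nilInf j) f
  obtain ⟨j, rfl⟩ : ∃ j', j = j' + 1 := ⟨j - 1, by omega⟩
  rw [reflInf_succ, reflInf_succ, reflInf, reflInf, map_mul, coeffRefl_comm h]
  cases i with
  | zero => rw [coeffRefl_twist_zero h]
  | succ i => rw [twist_succ, map_one]

theorem C_X_sub_ne_zero {i j : ℕ} (h : i ≠ j) :
    (MvPowerSeries.C (MvPolynomial.X i : Ca) : MvPowerSeries ℕ Ca) -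
      MvPowerSeries.C (MvPolynomial.X j) ≠ 0 := by
  rw [← map_sub]
  exact C_ne_zero (sub_ne_zero.mpr fun e => h (MvPolynomial.X_injective e))

theorem nilInf_braid (i : ℕ) (f : MvPowerSeries ℕ Ca) :
    nilInf (i + 1) (nilInf (i + 2) (nilInf (i + 1) f)) =
      nilInf (i + 2) (nilInf (i + 1) (nilInf (i + 2) f)) := by
  have hr : ∀ j x, (MvPowerSeries.C (MvPolynomial.X j) - MvPowerSeries.C (MvPolynomial.X (j + 1))) *
      nilInf (j + 1) x = x - coeffRefl (j + 1) x := fun j x => by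
    rw [← reflInf_succ, ← rootInf_mul_nilInf, rootInf, map_sub]
  refine braid_three (coeffRefl (i + 1)) (coeffRefl (i + 2)) (MvPowerSeries.C (MvPolynomial.X i))
    (MvPowerSeries.C (MvPolynomial.X (i + 1))) (MvPowerSeries.C (MvPolynomial.X (i + 2)))
    (C_X_sub_ne_zero (by omega)) (C_X_sub_ne_zero (by omega)) (C_X_sub_ne_zero (by omega))
    (coeffRefl_coeffRefl _) (coeffRefl_coeffRefl _) (fun x => ?_) ?_ ?_ ?_ ?_
    (nilInf (i + 1)) (nilInf (i + 2)) (hr i) (hr (i + 1)) f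
  · ext β : 1
    simp only [coeffRefl, MvPowerSeries.coeff_map]
    have : (reflCa (i + 1)).comp ((reflCa (i + 2)).comp (reflCa (i + 1))) =
        (reflCa (i + 2)).comp ((reflCa (i + 1)).comp (reflCa (i + 2))) := by
      apply MvPolynomial.algHom_ext
      intro k
      simp only [AlgHom.comp_apply, reflCa_X, reflVar]
      congr 1
      simp only [Equiv.swap_apply_def]
      split_ifs <;> omega
    exact DFunLike.congr_fun this _
  all_goals
    rw [coeffRefl_C, reflCa_X, reflVar]
    congr 2
    simp [Equiv.swap_apply_def]
    try omega

/-- The type C relation survives the twist because a_1 ↦ -a_1 inverts Ω(a_1|y) and s_1 carries it to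
Ω(a_2|y), which s_0 fixes. -/
theorem nilInf_braid_zero (f : MvPowerSeries ℕ Ca) :
    nilInf 0 (nilInf 1 (nilInf 0 (nilInf 1 f))) = nilInf 1 (nilInf 0 (nilInf 1 (nilInf 0 f))) := by
  have hr : ∀ x, (MvPowerSeries.C (MvPolynomial.X 0) - MvPowerSeries.C (MvPolynomial.X 1)) *
      nilInf 1 x = x - coeffRefl 1 x := fun x => by
    rw [← reflInf_succ, ← rootInf_mul_nilInf, rootInf, map_sub]
  have hr0 : ∀ x, -2 * MvPowerSeries.C (MvPolynomial.X 0) * nilInf 0 x =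
      x - Omega (MvPolynomial.X 0) * coeffRefl 0 x := fun x => by
    have := rootInf_mul_nilInf 0 x
    rw [rootInf, map_neg, map_add, reflInf, twist, if_pos rfl] at this
    rw [← this]
    ring
  have hX : ∀ i, (MvPowerSeries.C (MvPolynomial.X i : Ca) : MvPowerSeries ℕ Ca) ≠ 0 :=
    fun i => C_ne_zero (MvPolynomial.X_ne_zero i)
  have hcz : CharZero (MvPowerSeries ℕ Ca) :=
    charZero_of_injective_ringHom (MvPowerSeries.C_injective (σ := ℕ) (R := Ca))
  refine braid_two (coeffRefl 0) (coeffRefl 1) (MvPowerSeries.C (MvPolynomial.X 0))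
    (MvPowerSeries.C (MvPolynomial.X 1)) (Omega (MvPolynomial.X 0)) (Omega (MvPolynomial.X 1))
    (hX 0) (hX 1) (C_X_sub_ne_zero zero_ne_one) ?_ (coeffRefl_coeffRefl _) (coeffRefl_coeffRefl _)
    (fun x => ?_) ?_ ?_ ?_ (twist_mul_coeffRefl_twist 0) ?_ ?_
    (nilInf 0) (nilInf 1) hr0 hr f
  · rw [← map_add]
    refine C_ne_zero fun h => ?_
    have := congrArg (MvPolynomial.eval fun _ => (1 : ℂ)) h
    norm_num at this
  · ext β : 1
    simp only [coeffRefl, MvPowerSeries.coeff_map]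
    have : (reflCa 0).comp ((reflCa 1).comp ((reflCa 0).comp (reflCa 1))) =
        (reflCa 1).comp ((reflCa 0).comp ((reflCa 1).comp (reflCa 0))) := by
      apply MvPolynomial.algHom_ext
      intro k
      rcases k with _ | _ | k <;>
        simp [AlgHom.comp_apply, reflCa_X, reflVar, Equiv.swap_apply_def]
    exact DFunLike.congr_fun this _
  · rw [coeffRefl_C, reflCa_X, reflVar, if_pos rfl, map_neg]
  · rw [coeffRefl_C, reflCa_X, reflVar, if_neg one_ne_zero]
  · rw [coeffRefl_C, reflCa_X, reflVar]
    congr 2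
  · rw [coeffRefl, map_Omega]
    congr 1
    exact (reflCa_X _ _).trans (by simp [reflVar])
  · rw [coeffRefl, map_Omega]
    congr 1
    exact (reflCa_X _ _).trans (by simp [reflVar])

/-! ### The series `A_λ(1)` -/

/-- `A_{k-1} ⋯ A_1 A_0`. -/
def nilRho : ℕ → MvPowerSeries ℕ Ca → MvPowerSeries ℕ Ca
  | 0, f => f
  | k + 1, f => nilInf k (nilRho k f)

/-- `A_{ρ_{m_1}} A_{ρ_{m_2}} ⋯ (1)`, for the increasing sequence `m` of the parts of a strict
partition. -/
def nilSeries (m : List ℕ) : MvPowerSeries ℕ Ca := m.foldr nilRho 1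

theorem nilSeries_cons (k : ℕ) (m : List ℕ) : nilSeries (k :: m) = nilRho k (nilSeries m) := rfl

theorem nilInf_zero_right (i : ℕ) : nilInf i 0 = 0 := by
  have h := rootInf_mul_nilInf i 0
  rw [reflInf, map_zero, mul_zero, sub_zero] at h
  exact (mul_eq_zero.mp h).resolve_left (C_ne_zero (rootInf_ne_zero i))

theorem nilInf_succ_one (i : ℕ) : nilInf (i + 1) 1 = 0 := by
  have h := rootInf_mul_nilInf (i + 1) 1
  rw [reflInf_succ, map_one, sub_self] at h
  exact (mul_eq_zero.mp h).resolve_left (C_ne_zero (rootInf_ne_zero _))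

theorem nilRho_zero_right (k : ℕ) : nilRho k 0 = 0 := by
  induction k with
  | zero => rfl
  | succ k ih => rw [nilRho, ih, nilInf_zero_right]

theorem nilInf_nilRho_of_lt {i k : ℕ} (h : k < i) (f : MvPowerSeries ℕ Ca) :
    nilInf i (nilRho k f) = nilRho k (nilInf i f) := by
  induction k with
  | zero => rfl
  | succ k ih => rw [nilRho, nilRho, ← nilInf_comm (by omega), ih (by omega)]

/-- A_{i+1} commutes with the letters of index above i + 2. The braid relation moves it past A_{i+2}
A_{i+1} as A_{i+2}, which commutes with the remaining A_i ⋯ A_0. -/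
theorem nilInf_nilRho_of_gt {i k : ℕ} (h : i + 2 < k) (f : MvPowerSeries ℕ Ca) :
    nilInf (i + 1) (nilRho k f) = nilRho k (nilInf (i + 2) f) := by
  induction k, h using Nat.le_induction with
  | base =>
    change nilInf (i + 1) (nilInf (i + 2) (nilInf (i + 1) (nilRho (i + 1) f))) = _
    rw [nilInf_braid, nilInf_nilRho_of_lt (by omega)]
    rfl
  | succ k hk ih => rw [nilRho, nilRho, nilInf_comm (by omega), ih]

/-- Two equal rows produce an A_1 on the right, starting from the relation of length four between
A_0 and A_1. Applied to longer rows this A_1 gives zero, which excludes repeated rows. -/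
theorem nilRho_nilRho (i : ℕ) (f : MvPowerSeries ℕ Ca) :
    nilRho (i + 2) (nilRho (i + 2) f) = nilRho (i + 1) (nilRho (i + 2) (nilInf 1 f)) := by
  induction i with
  | zero =>
    simp only [nilRho]
    rw [nilInf_braid_zero]
  | succ i ih =>
    have e : ∀ g, nilRho (i + 1 + 2) g = nilInf (i + 2) (nilRho (i + 2) g) := fun _ => rfl
    have e' : ∀ g, nilRho (i + 2) g = nilInf (i + 1) (nilRho (i + 1) g) := fun _ => rfl
    calc nilRho (i + 1 + 2) (nilRho (i + 1 + 2) f)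
        = nilInf (i + 2) (nilInf (i + 1) (nilInf (i + 2) (nilRho (i + 1) (nilRho (i + 2) f)))) := by
          rw [e, e f, e' (nilInf _ _), ← nilInf_nilRho_of_lt (by omega)]
      _ = nilInf (i + 1) (nilInf (i + 2) (nilRho (i + 2) (nilRho (i + 2) f))) := by
          rw [← nilInf_braid, ← e']
      _ = nilInf (i + 1) (nilRho (i + 1) (nilInf (i + 2) (nilRho (i + 2) (nilInf 1 f)))) := by
          rw [ih, nilInf_nilRho_of_lt (by omega)]

/-- Each row passed raises the index of the operator by one. The row lengths increase strictly, so
the operator stays small enough to pass them all and finally annihilates 1. -/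
theorem nilInf_nilSeries_of_gt (i : ℕ) (m : List ℕ) (hm : m.Pairwise (· < ·))
    (h : ∀ p ∈ m, i + 2 < p) : nilInf (i + 1) (nilSeries m) = 0 := by
  induction m generalizing i with
  | nil => exact nilInf_succ_one i
  | cons k m ih =>
    rw [List.pairwise_cons] at hm
    have hk := h k (by simp)
    rw [nilSeries_cons, nilInf_nilRho_of_gt hk, ih (i + 1) hm.2 fun p hp => ?_, nilRho_zero_right]
    have := hm.1 p hp
    omega

/-- Adding a box to the row of length `i ≥ 1`. -/
def raise (i : ℕ) (m : List ℕ) : List ℕ := m.map fun k => if k = i then i + 1 else k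

theorem raise_eq_self {i : ℕ} {m : List ℕ} (h : i ∉ m) : raise i m = m := by
  rw [raise]
  conv_rhs => rw [← List.map_id m]
  refine List.map_congr_left fun k hk => ?_
  rw [if_neg (by rintro rfl; exact h hk)]
  rfl

/-- Shorter rows commute with A_{i+1}, and a row of length i + 1 becomes one of length i + 2; if
that length is taken, two equal rows arise and the result is zero. A first row of length i + 2
already starts with A_{i+1}, whose square is zero, and longer rows give zero by
`nilInf_nilSeries_of_gt`. -/
theorem nilInf_succ_nilSeries (i : ℕ) (m : List ℕ) (hm : m.Pairwise (· < ·)) :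
    nilInf (i + 1) (nilSeries m) =
      if i + 1 ∈ m ∧ i + 2 ∉ m then nilSeries (raise (i + 1) m) else 0 := by
  induction m with
  | nil => rw [if_neg (by simp)]; exact nilInf_succ_one i
  | cons k m ih =>
    have hm' := List.pairwise_cons.mp hm
    rw [nilSeries_cons]
    rcases lt_trichotomy k (i + 1) with hk | hk | hk
    · rw [nilInf_nilRho_of_lt hk, ih hm'.2]
      have h1 : i + 1 ≠ k := by omega
      have h2 : i + 2 ≠ k := by omega
      simp only [List.mem_cons, h1, h2, false_or]
      split_ifs
      · rw [raise, raise, List.map_cons, if_neg h1.symm]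
        rfl
      · exact nilRho_zero_right k
    · subst hk
      by_cases h2 : i + 2 ∈ m
      · obtain ⟨k, m, rfl⟩ := List.exists_cons_of_ne_nil (List.ne_nil_of_mem h2)
        have hm'' := List.pairwise_cons.mp hm'.2
        have hk : k = i + 2 := by
          have h3 := hm'.1 k (by simp)
          rcases List.mem_cons.mp h2 with h4 | h4
          · exact h4.symm
          · have := hm''.1 _ h4
            omega
        subst hk
        rw [if_neg (by simp), nilSeries_cons]
        change nilRho (i + 2) (nilRho (i + 2) _) = 0
        rw [nilRho_nilRho, nilInf_nilSeries_of_gt 0 m hm''.2 fun p hp => ?_, nilRho_zero_right,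
          nilRho_zero_right]
        have := hm''.1 p hp
        omega
      · have h1 : i + 1 ∉ m := fun h => lt_irrefl _ (hm'.1 _ h)
        rw [if_pos (by simp [h2]), raise, List.map_cons, if_pos rfl, ← raise, raise_eq_self h1]
        rfl
    · have h1 : i + 1 ∉ k :: m := by
        rw [List.mem_cons, not_or]
        exact ⟨by omega, fun h => by have := hm'.1 _ h; omega⟩
      rw [if_neg fun h => h1 h.1]
      rcases eq_or_lt_of_le (show i + 2 ≤ k by omega) with hk2 | hk2
      · subst hk2
        exact nilInf_nilInf _ _
      · exact nilInf_nilSeries_of_gt i (k :: m) hm (List.forall_mem_cons.mpr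
          ⟨hk2, fun p hp => hk2.trans (hm'.1 p hp)⟩)

theorem nilInf_zero_nilSeries (m : List ℕ) : nilInf 0 (nilSeries m) = nilSeries (1 :: m) := rfl

theorem nilInf_zero_nilSeries_one (m : List ℕ) : nilInf 0 (nilSeries (1 :: m)) = 0 :=
  nilInf_nilInf 0 _

/-- The definition of A_{i+1}, solved for the series. In particular the series is invariant under
s_{i+1} when no row of length i + 1 can be lengthened. -/
theorem coeffRefl_nilSeries (i : ℕ) (m : List ℕ) (hm : m.Pairwise (· < ·)) :
    nilSeries m = coeffRefl (i + 1) (nilSeries m) + MvPowerSeries.C (rootInf (i + 1)) *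
      if i + 1 ∈ m ∧ i + 2 ∉ m then nilSeries (raise (i + 1) m) else 0 := by
  rw [← nilInf_succ_nilSeries i m hm, rootInf_mul_nilInf, reflInf_succ]
  ring

/-! ### Factorial `Q`-functions at finite sets of points of a field -/

open scoped Classical in
/-- The factorial `Q`-function of a list of parts with parameters `b`, at a finite set of points of
a field. -/
def pointQ {K : Type*} [Field K] (b : ℕ → K) : List ℕ → Finset K → K
  | [], _ => 1
  | k :: l, X => ∑ x ∈ X, 2 * x * (∏ j ∈ Finset.range (k - 1), (x - b j)) *
      (∏ y ∈ X.erase x, (x + y) / (x - y)) * pointQ b l (X.erase x)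

/-- `2 x (x - b_0) ⋯ (x - b_{k-2})`. -/
def pointPow {K : Type*} [Field K] (b : ℕ → K) (x : K) (k : ℕ) : K :=
  2 * x * ∏ j ∈ Finset.range (k - 1), (x - b j)

section

open scoped Classical

variable {K : Type*} [Field K] (b : ℕ → K)

theorem pointQ_cons (k : ℕ) (l : List ℕ) (X : Finset K) :
    pointQ b (k :: l) X = ∑ x ∈ X, pointPow b x k *
      (∏ y ∈ X.erase x, (x + y) / (x - y)) * pointQ b l (X.erase x) := rfl

/-- Interchanging the points x, y taken by the two equal rows changes only the sign of (x + y)/(x -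
y), so the terms cancel in pairs. -/
theorem pointQ_cons_cons_self (k : ℕ) (l : List ℕ) (X : Finset K) :
    pointQ b (k :: k :: l) X = 0 := by
  rw [pointQ_cons]
  simp only [pointQ_cons, Finset.mul_sum]
  rw [Finset.sum_sigma']
  refine Finset.sum_involution (fun p _ => ⟨p.2, p.1⟩) ?_ ?_ ?_ ?_
  · rintro ⟨x, y⟩ h
    simp only [Finset.mem_sigma, Finset.mem_erase] at h
    obtain ⟨hx, hyx, hy⟩ := h
    have h1 : y ∈ X.erase x := by simp [hyx, hy]
    have h2 : x ∈ X.erase y := by simp [hyx.symm, hx]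
    simp only
    rw [← Finset.mul_prod_erase _ _ h1, ← Finset.mul_prod_erase _ _ h2, Finset.erase_right_comm,
      ← neg_sub x y, add_comm y x, div_neg]
    ring
  · rintro ⟨x, y⟩ h _ e
    simp only [Finset.mem_sigma, Finset.mem_erase] at h
    simp only [Sigma.mk.injEq, heq_eq_eq] at e
    exact h.2.1 e.1
  · rintro ⟨x, y⟩ h
    simp only [Finset.mem_sigma, Finset.mem_erase] at h ⊢
    exact ⟨h.2.2, h.2.1.symm, h.1⟩
  · rintro ⟨x, y⟩ _
    rfl

/-- Removing a box from the row of length `i + 1`. -/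
def lower (i : ℕ) (m : List ℕ) : List ℕ := m.map fun k => if k = i + 1 then i else k

theorem lower_eq_self {i : ℕ} {m : List ℕ} (h : i + 1 ∉ m) : lower i m = m := by
  rw [lower]
  conv_rhs => rw [← List.map_id m]
  refine List.map_congr_left fun k hk => ?_
  rw [if_neg (by rintro rfl; exact h hk)]
  rfl

/-- Unless k = i + 2, the product contains both or neither of the factors with b_i and b_{i+1}. -/
theorem pointPow_swap (i k : ℕ) (hk : k ≠ i + 2) (x : K) :
    pointPow (fun j => b (Equiv.swap i (i + 1) j)) x k = pointPow b x k := by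
  rw [pointPow, pointPow]
  congr 1
  refine Finset.prod_equiv (Equiv.swap i (i + 1)) (fun j => ?_) (fun j _ => rfl)
  rw [Finset.mem_range, Finset.mem_range, Equiv.swap_apply_def]
  split_ifs <;> omega

theorem pointPow_swap_self (i : ℕ) (x : K) :
    pointPow (fun j => b (Equiv.swap i (i + 1) j)) x (i + 2) =
      pointPow b x (i + 2) + (b i - b (i + 1)) * pointPow b x (i + 1) := by
  have h : ∏ j ∈ Finset.range i, (x - b (Equiv.swap i (i + 1) j)) =
      ∏ j ∈ Finset.range i, (x - b j) := Finset.prod_congr rfl fun j hj => by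
    rw [Finset.mem_range] at hj
    rw [Equiv.swap_apply_of_ne_of_ne (by omega) (by omega)]
  simp only [pointPow, show i + 2 - 1 = i + 1 by omega, Nat.add_sub_cancel, Finset.prod_range_succ,
    h, Equiv.swap_apply_left]
  ring

/-- Only a row of length i + 2 feels the exchange, and its correction term is the same row shortened
by one box. If a row of length i + 1 is present too, the correction has two equal rows and vanishes.
-/
theorem pointQ_swap (i : ℕ) (l : List ℕ) (hl : l.Pairwise (· > ·)) (X : Finset K) :
    pointQ (fun j => b (Equiv.swap i (i + 1) j)) l X = pointQ b l X + (b i - b (i + 1)) *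
      if i + 2 ∈ l ∧ i + 1 ∉ l then pointQ b (lower (i + 1) l) X else 0 := by
  induction l generalizing X with
  | nil => simp [pointQ]
  | cons k l ih =>
    have hl' := List.pairwise_cons.mp hl
    rw [pointQ_cons]
    by_cases hk : k = i + 2
    · subst hk
      have h2 : i + 2 ∉ l := fun h => lt_irrefl _ (hl'.1 _ h)
      simp only [ih hl'.2, h2, false_and, if_false, mul_zero, add_zero, pointPow_swap_self]
      have hsum : ∑ x ∈ X, (pointPow b x (i + 2) + (b i - b (i + 1)) * pointPow b x (i + 1)) *
          (∏ y ∈ X.erase x, (x + y) / (x - y)) * pointQ b l (X.erase x) =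
          pointQ b ((i + 2) :: l) X + (b i - b (i + 1)) * pointQ b ((i + 1) :: l) X := by
        rw [pointQ_cons, pointQ_cons, Finset.mul_sum, ← Finset.sum_add_distrib]
        refine Finset.sum_congr rfl fun x _ => ?_
        ring
      rw [hsum]
      by_cases h1 : i + 1 ∈ l
      · obtain ⟨k, l, rfl⟩ := List.exists_cons_of_ne_nil (List.ne_nil_of_mem h1)
        have hk : k = i + 1 := by
          have h3 := hl'.1 k (by simp)
          rcases List.mem_cons.mp h1 with h4 | h4
          · exact h4.symm
          · have := (List.pairwise_cons.mp hl'.2).1 _ h4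
            omega
        subst hk
        simp [pointQ_cons_cons_self]
      · rw [if_pos (by simp [h1]), lower, List.map_cons, if_pos rfl, ← lower, lower_eq_self h2]
    · simp only [pointPow_swap b i k hk, ih hl'.2]
      have hc : (i + 2 ∈ k :: l ∧ i + 1 ∉ k :: l) ↔ i + 2 ∈ l ∧ i + 1 ∉ l := by
        simp only [List.mem_cons, Ne.symm hk, false_or, not_or]
        refine ⟨fun h => ⟨h.1, h.2.2⟩, fun h => ⟨h.1, ?_, h.2⟩⟩
        have := hl'.1 _ h.1
        omega
      simp only [hc]
      split_ifs with h
      · have hlow : lower (i + 1) (k :: l) = k :: lower (i + 1) l := by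
          rw [lower, List.map_cons, if_neg hk]
          rfl
        rw [hlow, pointQ_cons, pointQ_cons, Finset.mul_sum, ← Finset.sum_add_distrib]
        refine Finset.sum_congr rfl fun x _ => ?_
        ring
      · simp only [mul_zero, add_zero]
        rfl

/-! ### Partial fractions and the function Q_(1) -/

theorem prod_add_div_sub (Z : Finset K) (w : K) (hw : w ∉ Z) :
    ∏ y ∈ Z, (w + y) / (w - y) =
      1 + ∑ z ∈ Z, 2 * z / (w - z) * ∏ y ∈ Z.erase z, (z + y) / (z - y) := by
  have hne : ∀ z ∈ Z, w - z ≠ 0 := fun z hz => sub_ne_zero.mpr fun h => hw (h ▸ hz)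
  -- A difference of monic polynomials of degree |Z|, hence determined by its values at Z; at z ∈ Z
  -- only the first product survives.
  set P : Polynomial K := ∏ y ∈ Z, (Polynomial.X + Polynomial.C y) -
    ∏ y ∈ Z, (Polynomial.X - Polynomial.C y) with hP
  have hdeg : P.degree < Z.card := by
    have h1 : (∏ y ∈ Z, (Polynomial.X + Polynomial.C y)).degree = (Z.card : WithBot ℕ) := by
      simp [Polynomial.degree_prod]
    have h2 : (∏ y ∈ Z, (Polynomial.X - Polynomial.C y)).degree = (Z.card : WithBot ℕ) := by
      simp [Polynomial.degree_prod]
    have hm1 : (∏ y ∈ Z, (Polynomial.X + Polynomial.C y)).Monic :=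
      Polynomial.monic_prod_of_monic _ _ fun y _ => Polynomial.monic_X_add_C y
    have hm2 : (∏ y ∈ Z, (Polynomial.X - Polynomial.C y)).Monic :=
      Polynomial.monic_prod_of_monic _ _ fun y _ => Polynomial.monic_X_sub_C y
    rw [← h1]
    exact Polynomial.degree_sub_lt_left (h1.trans h2.symm) hm1.ne_zero (hm1.trans hm2.symm)
  have h := congrArg (Polynomial.eval w)
    (Lagrange.eq_interpolate (s := Z) (v := id) (Function.injective_id.injOn) hdeg)
  rw [Lagrange.eval_interpolate_not_at_node _ (v := id) (fun i hi => sub_ne_zero.mp (hne i hi)),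
    Lagrange.eval_nodal] at h
  have hD : ∏ y ∈ Z, (w - y) ≠ 0 := Finset.prod_ne_zero_iff.mpr hne
  have hPw : P.eval w = ∏ y ∈ Z, (w + y) - ∏ y ∈ Z, (w - y) := by
    simp [hP, Polynomial.eval_prod]
  rw [hPw] at h
  have hs : ∑ z ∈ Z, Lagrange.nodalWeight Z id z * (w - id z)⁻¹ * P.eval (id z) =
      ∑ z ∈ Z, 2 * z / (w - z) * ∏ y ∈ Z.erase z, (z + y) / (z - y) := by
    refine Finset.sum_congr rfl fun z hz => ?_
    have hPz : P.eval z = 2 * z * ∏ y ∈ Z.erase z, (z + y) := by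
      have h0 : ∏ y ∈ Z, (z - y) = 0 := Finset.prod_eq_zero hz (sub_self z)
      simp only [hP, Polynomial.eval_sub, Polynomial.eval_prod, Polynomial.eval_add,
        Polynomial.eval_X, Polynomial.eval_C, h0, sub_zero]
      rw [← Finset.mul_prod_erase _ _ hz]
      ring
    rw [id, hPz, Lagrange.nodalWeight, Finset.prod_div_distrib, Finset.prod_inv_distrib]
    simp only [id]
    rw [div_eq_mul_inv, div_eq_mul_inv]
    ring
  rw [hs] at h
  simp only [id] at h
  rw [Finset.prod_div_distrib, div_eq_iff hD]
  linear_combination h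

/-- Expanding the term of a new point w by partial fractions, its contribution at z cancels the
factor (z + w)/(z - w) acquired by the term of z. -/
theorem sum_mul_prod_add_div_sub (Z : Finset K) :
    ∑ z ∈ Z, z * ∏ y ∈ Z.erase z, (z + y) / (z - y) = ∑ z ∈ Z, z := by
  induction Z using Finset.induction_on with
  | empty => simp
  | insert w Z hw ih =>
    rw [Finset.sum_insert hw, Finset.sum_insert hw, Finset.erase_insert hw, prod_add_div_sub Z w hw,
      ← ih, mul_add, mul_one, add_assoc, Finset.mul_sum, ← Finset.sum_add_distrib]
    congr 1
    refine Finset.sum_congr rfl fun z hz => ?_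
    have hwz : w ≠ z := fun h => hw (h ▸ hz)
    have h1 : w - z ≠ 0 := sub_ne_zero.mpr hwz
    have h2 : z - w ≠ 0 := sub_ne_zero.mpr hwz.symm
    rw [Finset.erase_insert_of_ne hwz, Finset.prod_insert (by simp [hw])]
    have h3 : w * (2 * z / (w - z)) + z * ((z + w) / (z - w)) = z := by
      rw [← neg_sub z w, div_neg]
      field_simp
      ring
    linear_combination (∏ y ∈ Z.erase z, (z + y) / (z - y)) * h3

theorem pointQ_one (Z : Finset K) : pointQ b [1] Z = 2 * ∑ z ∈ Z, z := by
  rw [← sum_mul_prod_add_div_sub, pointQ_cons, Finset.mul_sum]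
  refine Finset.sum_congr rfl fun z _ => ?_
  simp [pointQ, pointPow]
  ring

/-- Changing the sign of the first parameter. -/
def negFirst (j : ℕ) : K := if j = 0 then -b 0 else b j

theorem pointPow_self {k : ℕ} (hk : 2 ≤ k) : pointPow b (b 0) k = 0 := by
  rw [pointPow, Finset.prod_eq_zero (Finset.mem_range.mpr (by omega : 0 < k - 1)) (sub_self _),
    mul_zero]

theorem pointPow_mul_div {k : ℕ} (hk : 2 ≤ k) {x : K} (hx : x ≠ b 0) :
    pointPow b x k * ((x + b 0) / (x - b 0)) = pointPow (negFirst b) x k := by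
  obtain ⟨k, rfl⟩ : ∃ k', k = k' + 2 := ⟨k - 2, by omega⟩
  have h : x - b 0 ≠ 0 := sub_ne_zero.mpr hx
  simp only [pointPow, show k + 2 - 1 = k + 1 by omega, Finset.prod_range_succ', negFirst, if_true,
    Nat.succ_ne_zero, if_false, sub_neg_eq_add]
  field_simp

theorem pointQ_insert_cons (k : ℕ) (l : List ℕ) (X : Finset K) (z : K) (hz : z ∉ X) :
    pointQ b (k :: l) (insert z X) =
      pointPow b z k * (∏ y ∈ X, (z + y) / (z - y)) * pointQ b l X +
      ∑ x ∈ X, pointPow b x k * ((x + z) / (x - z) * ∏ y ∈ X.erase x, (x + y) / (x - y)) *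
        pointQ b l (insert z (X.erase x)) := by
  rw [pointQ_cons, Finset.sum_insert hz, Finset.erase_insert hz]
  congr 1
  refine Finset.sum_congr rfl fun x hx => ?_
  have hxz : z ≠ x := fun h => hz (h ▸ hx)
  rw [Finset.erase_insert_of_ne hxz, Finset.prod_insert (by simp [hz])]

/-- Powers of exponent at least 2 vanish at the point b_0, so only the part 1 can take it. For any
other point x, the factor (x + b_0)/(x - b_0) replaces x - b_0 by x + b_0, which negates the first
parameter. -/
theorem pointQ_insert_first (l : List ℕ) (hl : l.Pairwise (· > ·)) (hpos : ∀ p ∈ l, 0 < p)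
    (X : Finset K) (hX : b 0 ∉ X) :
    pointQ b l (insert (b 0) X) = pointQ (negFirst b) l X +
      if 1 ∈ l then 2 * b 0 * pointQ (negFirst b) (l.erase 1) X else 0 := by
  induction l generalizing X with
  | nil => simp [pointQ]
  | cons k l ih =>
    have hl' := List.pairwise_cons.mp hl
    have hpos' := List.forall_mem_cons.mp hpos
    by_cases hk : k = 1
    · subst hk
      have : l = [] := List.eq_nil_iff_forall_not_mem.mpr fun p hp => by
        have := hl'.1 p hp
        have := hpos'.2 p hp
        omega
      subst this
      rw [pointQ_one, pointQ_one, Finset.sum_insert hX]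
      simp [pointQ]
      ring
    · have hk2 : 2 ≤ k := by have := hpos'.1; omega
      have h1 : (1 ∈ k :: l) ↔ 1 ∈ l := by simp [Ne.symm hk]
      rw [pointQ_insert_cons b _ _ _ _ hX, pointPow_self b hk2, zero_mul, zero_mul, zero_add]
      simp only [h1]
      have e : ∀ x ∈ X, pointPow b x k * ((x + b 0) / (x - b 0) *
          ∏ y ∈ X.erase x, (x + y) / (x - y)) * pointQ b l (insert (b 0) (X.erase x)) =
          pointPow (negFirst b) x k * (∏ y ∈ X.erase x, (x + y) / (x - y)) *
            (pointQ (negFirst b) l (X.erase x) +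
              if 1 ∈ l then 2 * b 0 * pointQ (negFirst b) (l.erase 1) (X.erase x) else 0) := by
        intro x hx
        rw [ih hl'.2 hpos'.2 _ (by simp [hX]), ← mul_assoc (pointPow b x k),
          pointPow_mul_div b hk2 (fun h => hX (h ▸ hx))]
      rw [Finset.sum_congr rfl e, List.erase_cons_tail (by simpa using hk)]
      split_ifs
      · rw [pointQ_cons, pointQ_cons, Finset.mul_sum, ← Finset.sum_add_distrib]
        refine Finset.sum_congr rfl fun x _ => ?_
        ring
      · simp only [add_zero]
        rfl

/-- In the new point z there are at most simple poles, at the points of X. Either z is taken by the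
first row, or a point x of X is, and then (x + z)/(x - z) uses up the factor x - z while the
remaining rows involve only X without x. This prepares the interpolation in `kernelSum_eq`. -/
theorem exists_poly_pointQ (l : List ℕ) (X : Finset K) :
    ∃ p : Polynomial K, ∀ z, z ∉ X →
      p.eval z = (∏ x ∈ X, (x - z)) * pointQ b l (insert z X) := by
  induction l generalizing X with
  | nil =>
    refine ⟨∏ x ∈ X, (Polynomial.C x - Polynomial.X), fun z _ => ?_⟩
    simp [Polynomial.eval_prod, pointQ]
  | cons k l ih =>
    choose p hp using ih
    refine ⟨Polynomial.C (pointQ b l X) * (2 * Polynomial.X *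
      ∏ j ∈ Finset.range (k - 1), (Polynomial.X - Polynomial.C (b j))) *
      (∏ y ∈ X, (-(Polynomial.X + Polynomial.C y))) + ∑ x ∈ X,
      Polynomial.C (pointPow b x k * ∏ y ∈ X.erase x, (x + y) / (x - y)) *
        (Polynomial.C x + Polynomial.X) * p (X.erase x), fun z hz => ?_⟩
    have hne : ∀ x ∈ X, x - z ≠ 0 := fun x hx => sub_ne_zero.mpr fun h => hz (h ▸ hx)
    rw [pointQ_insert_cons b _ _ _ _ hz, mul_add, Finset.mul_sum, Polynomial.eval_add,
      Polynomial.eval_finsetSum]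
    congr 1
    · have : (∏ x ∈ X, (x - z)) * ∏ y ∈ X, (z + y) / (z - y) = ∏ y ∈ X, (-(z + y)) := by
        rw [← Finset.prod_mul_distrib]
        refine Finset.prod_congr rfl fun x hx => ?_
        rw [← neg_sub x z, div_neg, mul_neg, mul_div_cancel₀ _ (hne x hx)]
      simp only [Polynomial.eval_mul, Polynomial.eval_prod, Polynomial.eval_C, Polynomial.eval_neg,
        Polynomial.eval_X, Polynomial.eval_add, Polynomial.eval_sub, Polynomial.eval_ofNat]
      rw [← this, pointPow]
      ring
    · refine Finset.sum_congr rfl fun x hx => ?_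
      simp only [Polynomial.eval_mul, Polynomial.eval_C, Polynomial.eval_X, Polynomial.eval_add]
      rw [hp _ _ (by simp [hz]), ← Finset.mul_prod_erase _ _ hx]
      have := hne x hx
      field_simp

end

/-! ### Agreement with the symmetrization formula -/

open scoped Classical in
theorem sum_perm_eq_pointQ {K : Type*} [Field K] (b : ℕ → K) (l : List ℕ) (N : ℕ) (x : Fin N → K)
    (hx : Function.Injective x) (hl : l.length ≤ N) :
    ∑ w : Equiv.Perm (Fin N), ∏ i ∈ Finset.univ.filter (fun i : Fin N => i.val < l.length),
      (pointPow b (x (w i)) (l.getD i.val 0) * ∏ j ∈ Finset.univ.filter (fun j : Fin N => i < j),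
        (x (w i) + x (w j)) / (x (w i) - x (w j))) =
      ((N - l.length).factorial : K) * pointQ b l (Finset.univ.image x) := by
  induction l generalizing N with
  | nil => simp [pointQ, Fintype.card_perm]
  | cons k l ih =>
    obtain ⟨N, rfl⟩ : ∃ N', N = N' + 1 := ⟨N - 1, by simp at hl; omega⟩
    -- A permutation is split into i = w(0), the index of the point taken by the first row, and a
    -- permutation of the remaining N indices. The difference between the number of points and of
    -- rows is unchanged.
    rw [← Equiv.Perm.decomposeFin.symm.sum_comp, Fintype.sum_prod_type, pointQ_cons,
      Finset.sum_image hx.injOn, Finset.mul_sum]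
    refine Finset.sum_congr rfl fun i _ => ?_
    set x' : Fin N → K := fun j => x (Equiv.swap 0 i j.succ) with hx'
    have hinj : Function.Injective x' := fun j j' h =>
      Fin.succ_injective _ ((Equiv.swap 0 i).injective (hx h))
    have him : (Finset.univ.image x).erase (x i) = Finset.univ.image x' := by
      ext y
      simp only [Finset.mem_erase, Finset.mem_image, Finset.mem_univ, true_and]
      constructor
      · rintro ⟨hy, j, rfl⟩
        have hj : Equiv.swap 0 i j ≠ 0 := by
          intro h
          rw [Equiv.swap_apply_eq_iff, Equiv.swap_apply_left] at h
          exact hy (by rw [h])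
        obtain ⟨j', hj'⟩ := Fin.exists_succ_eq.mpr hj
        exact ⟨j', by rw [hx']; simp only; rw [hj', Equiv.swap_apply_self]⟩
      · rintro ⟨j, rfl⟩
        refine ⟨fun h => ?_, _, rfl⟩
        have := hx h
        rw [Equiv.swap_apply_eq_iff, Equiv.swap_apply_right] at this
        exact Fin.succ_ne_zero j this
    rw [him, Finset.prod_image hinj.injOn, List.length_cons, Nat.add_sub_add_right, mul_left_comm,
      ← ih N x' hinj (by simpa using hl), Finset.mul_sum]
    refine Finset.sum_congr rfl fun w _ => ?_
    rw [Finset.prod_filter, Fin.prod_univ_succ]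
    simp only [Equiv.Perm.decomposeFin_symm_apply_zero, Equiv.Perm.decomposeFin_symm_apply_succ,
      Fin.val_zero, Nat.zero_lt_succ, if_true, List.getD_cons_zero, Fin.val_succ,
      Nat.add_lt_add_iff_right, List.getD_cons_succ, Finset.prod_filter, Fin.prod_univ_succ,
      Fin.succ_lt_succ_iff, Fin.succ_pos, Fin.not_lt_zero, if_false, one_mul, lt_self_iff_false]
    congr 2
    exact Equiv.prod_comp w fun j => (x i + x' j) / (x i - x' j)

theorem pointQ_eq_zero_of_card_lt {K : Type*} [Field K] (b : ℕ → K) (l : List ℕ) (X : Finset K)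
    (h : X.card < l.length) : pointQ b l X = 0 := by
  classical
  induction l generalizing X with
  | nil => simp at h
  | cons k l ih =>
    rw [pointQ_cons]
    refine Finset.sum_eq_zero fun x hx => ?_
    rw [ih _ ?_, mul_zero]
    rw [Finset.card_erase_of_mem hx]
    have := Finset.card_pos.mpr ⟨x, hx⟩
    rw [List.length_cons] at h
    omega

theorem xVar_injective (N : ℕ) : Function.Injective (xVar N) := fun _ _ h =>
  MvPolynomial.X_injective (IsFractionRing.injective (MvPolynomial (Fin N) Ca) (FracX N) h)

theorem factorialQ_eq_pointQ (N : ℕ) (l : StrictPartition) :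
    factorialQ N l = pointQ (fun j => ofCa N (MvPolynomial.X j)) l.val
      (Finset.univ.map ⟨xVar N, xVar_injective N⟩) := by
  classical
  rw [factorialQ]
  split_ifs with h
  · have := sum_perm_eq_pointQ (fun j => ofCa N (MvPolynomial.X j)) l.val N (xVar N)
      (xVar_injective N) h
    rw [Finset.map_eq_image]
    exact (inv_mul_eq_iff_eq_mul₀ (by exact_mod_cast Nat.factorial_ne_zero _)).mpr (by convert this <;> rfl)
  · refine (pointQ_eq_zero_of_card_lt _ _ _ ?_).symm
    rw [Finset.card_map, Finset.card_univ, Fintype.card_fin]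
    omega

/-! ### Local finiteness -/

/-- Every coefficient of `f` at a monomial of degree `k` vanishes or has degree at most `k - d`. -/
def DegreeDrop (d : ℕ) (f : MvPowerSeries ℕ Ca) : Prop :=
  ∀ β, MvPowerSeries.coeff β f ≠ 0 →
    (MvPowerSeries.coeff β f).totalDegree + d ≤ Finsupp.degree β

theorem totalDegree_aeval_le {σ : Type*} (f : σ → MvPolynomial σ ℂ)
    (hf : ∀ i, (f i).totalDegree ≤ 1) (p : MvPolynomial σ ℂ) :
    (MvPolynomial.aeval f p).totalDegree ≤ p.totalDegree := by
  rw [MvPolynomial.aeval_def, MvPolynomial.eval₂_eq]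
  refine MvPolynomial.totalDegree_finsetSum_le fun d hd => ?_
  refine (MvPolynomial.totalDegree_mul _ _).trans ?_
  rw [MvPolynomial.algebraMap_eq, MvPolynomial.totalDegree_C, zero_add]
  refine (MvPolynomial.totalDegree_finsetProd _ _).trans
    ((Finset.sum_le_sum fun i _ => ?_).trans (MvPolynomial.le_totalDegree hd))
  refine (MvPolynomial.totalDegree_pow _ _).trans ?_
  simpa using Nat.mul_le_mul_left (d i) (hf i)

theorem totalDegree_reflCa_le (i : ℕ) (p : Ca) : (reflCa i p).totalDegree ≤ p.totalDegree := by
  refine totalDegree_aeval_le _ (fun k => ?_) p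
  cases i with
  | zero =>
    rw [reflVar]
    split_ifs <;> simp
  | succ i => simp [reflVar]

theorem totalDegree_coeff_Omega_le (k : ℕ) (β : ℕ →₀ ℕ) :
    (MvPowerSeries.coeff β (Omega (MvPolynomial.X k : Ca))).totalDegree ≤ Finsupp.degree β := by
  rw [coeff_Omega, Finsupp.degree_apply]
  refine (MvPolynomial.totalDegree_finsetProd _ _).trans (Finset.sum_le_sum fun j _ => ?_)
  simp only [omegaFactor, PowerSeries.coeff_mk]
  split_ifs
  · simp
  · refine (MvPolynomial.totalDegree_mul _ _).trans ?_
    rw [MvPolynomial.totalDegree_X_pow]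
    have : (2 : Ca).totalDegree = 0 := MvPolynomial.totalDegree_C (2 : ℂ)
    omega

theorem DegreeDrop.coeffRefl {d : ℕ} {f : MvPowerSeries ℕ Ca} (hf : DegreeDrop d f) (i : ℕ) :
    DegreeDrop d (coeffRefl i f) := fun β hβ => by
  rw [AffineC.coeffRefl, MvPowerSeries.coeff_map] at hβ ⊢
  have h1 := hf β fun h => hβ (by rw [h, map_zero])
  have h2 : ((reflCa i).toRingHom (MvPowerSeries.coeff β f)).totalDegree ≤ _ :=
    totalDegree_reflCa_le i (MvPowerSeries.coeff β f)
  omega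

theorem DegreeDrop.reflInf {d : ℕ} {f : MvPowerSeries ℕ Ca} (hf : DegreeDrop d f) (i : ℕ) :
    DegreeDrop d (reflInf i f) := by
  cases i with
  | succ i =>
    rw [reflInf_succ]
    exact hf.coeffRefl _
  | zero =>
    intro β hβ
    rw [AffineC.reflInf, MvPowerSeries.coeff_mul] at hβ ⊢
    have hd : d ≤ Finsupp.degree β := by
      obtain ⟨p, hp, hp0⟩ := Finset.exists_ne_zero_of_sum_ne_zero hβ
      have h1 := hf.coeffRefl 0 p.2 (right_ne_zero_of_mul hp0)
      rw [Finset.HasAntidiagonal.mem_antidiagonal] at hp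
      rw [← hp, map_add]
      omega
    suffices h : (∑ p ∈ Finset.HasAntidiagonal.antidiagonal β,
        MvPowerSeries.coeff p.1 (twist 0) *
          MvPowerSeries.coeff p.2 (AffineC.coeffRefl 0 f)).totalDegree ≤ Finsupp.degree β - d by
      omega
    refine MvPolynomial.totalDegree_finsetSum_le fun p hp => ?_
    rw [Finset.HasAntidiagonal.mem_antidiagonal] at hp
    by_cases h0 : MvPowerSeries.coeff p.2 (AffineC.coeffRefl 0 f) = 0
    · simp [h0]
    · refine (MvPolynomial.totalDegree_mul _ _).trans ?_
      have h1 := hf.coeffRefl 0 p.2 h0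
      have h2 := totalDegree_coeff_Omega_le 0 p.1
      rw [twist, if_pos rfl, ← hp, map_add]
      omega

theorem totalDegree_rootInf (i : ℕ) : (rootInf i).totalDegree = 1 := by
  refine MvPolynomial.IsHomogeneous.totalDegree ?_ (rootInf_ne_zero i)
  cases i with
  | zero =>
    exact ((MvPolynomial.isHomogeneous_X _ _).add (MvPolynomial.isHomogeneous_X _ _)).neg
  | succ i =>
    exact (MvPolynomial.isHomogeneous_X _ _).sub (MvPolynomial.isHomogeneous_X _ _)

/-- The action of s_i preserves the degree bound, because a coefficient of Ω(a_1|y) has at most the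
degree of its monomial; the division by the root then gains one. -/
theorem DegreeDrop.nilInf {d : ℕ} {f : MvPowerSeries ℕ Ca} (hf : DegreeDrop d f) (i : ℕ) :
    DegreeDrop (d + 1) (nilInf i f) := by
  intro β hβ
  have h := congrArg (MvPowerSeries.coeff β) (rootInf_mul_nilInf i f)
  rw [MvPowerSeries.coeff_C_mul, map_sub] at h
  have hne : rootInf i * MvPowerSeries.coeff β (AffineC.nilInf i f) ≠ 0 :=
    mul_ne_zero (rootInf_ne_zero i) hβ
  have hdeg := congrArg MvPolynomial.totalDegree h
  rw [MvPolynomial.totalDegree_mul_of_isDomain (rootInf_ne_zero i) hβ, totalDegree_rootInf] at hdeg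
  rw [h] at hne
  have hf' := hf.reflInf i
  by_cases h1 : MvPowerSeries.coeff β f = 0
  · have h2 : MvPowerSeries.coeff β (AffineC.reflInf i f) ≠ 0 := fun h2 => hne (by simp [h1, h2])
    have h3 := hf' β h2
    rw [h1, zero_sub, MvPolynomial.totalDegree_neg] at hdeg
    omega
  · have h3 := hf β h1
    by_cases h2 : MvPowerSeries.coeff β (AffineC.reflInf i f) = 0
    · rw [h2, sub_zero] at hdeg
      omega
    · have h4 := hf' β h2
      have h5 := MvPolynomial.totalDegree_sub (MvPowerSeries.coeff β f)
        (MvPowerSeries.coeff β (AffineC.reflInf i f))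
      rw [← hdeg] at h5
      rcases le_max_iff.mp h5 with h6 | h6 <;> omega

theorem DegreeDrop.nilRho {d : ℕ} {f : MvPowerSeries ℕ Ca} (hf : DegreeDrop d f) (k : ℕ) :
    DegreeDrop (d + k) (nilRho k f) := by
  induction k with
  | zero => exact hf
  | succ k ih => exact ih.nilInf k

theorem degreeDrop_nilSeries (m : List ℕ) : DegreeDrop m.sum (nilSeries m) := by
  induction m with
  | nil =>
    intro β hβ
    change MvPowerSeries.coeff β (1 : MvPowerSeries ℕ Ca) ≠ 0 at hβ
    change (MvPowerSeries.coeff β (1 : MvPowerSeries ℕ Ca)).totalDegree + 0 ≤ _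
    rw [MvPowerSeries.coeff_one] at hβ ⊢
    split_ifs <;> simp
  | cons k m ih =>
    rw [List.sum_cons, add_comm]
    exact ih.nilRho k

/-- The series attached to a list of parts in decreasing order. -/
def partSeries (l : List ℕ) : MvPowerSeries ℕ Ca := nilSeries l.reverse

/-- By the degree bound a nonzero coefficient forces |λ| ≤ deg β, and a strict partition is
determined by its set of parts. -/
theorem finite_coeff_partSeries_ne_zero (β : ℕ →₀ ℕ) :
    {l : StrictPartition | MvPowerSeries.coeff β (partSeries l.val) ≠ 0}.Finite := by
  refine Set.Finite.of_injOn (f := fun l : StrictPartition => l.val.toFinset)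
    (t := ((Finset.range (Finsupp.degree β + 1)).powerset : Set (Finset ℕ))) ?_ ?_
    (Finset.finite_toSet _)
  · intro l hl
    have h := degreeDrop_nilSeries _ β hl
    rw [List.sum_reverse] at h
    rw [Finset.mem_coe, Finset.mem_powerset]
    intro p hp
    rw [List.mem_toFinset] at hp
    have := List.le_sum_of_mem hp
    rw [Finset.mem_range]
    omega
  · intro l _ l' _ h
    apply Subtype.ext
    have hn : ∀ l : StrictPartition, l.val.Nodup := fun l =>
      l.property.1.imp fun h => ne_of_gt h
    exact List.Perm.eq_of_pairwise (le := (· > ·)) (fun a b _ _ h1 h2 => absurd h1 (lt_asymm h2))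
      l.property.1 l'.property.1 (List.perm_of_nodup_nodup_toFinset_eq (hn l) (hn l') h)

/-! ### Moving a box between rows of equal colour -/

/-- Exchanging the parts `i + 1` and `i + 2`. -/
def exchange (i : ℕ) (l : List ℕ) : List ℕ :=
  if i + 1 ∈ l ∧ i + 2 ∈ l then l else l.map (Equiv.swap (i + 1) (i + 2))

theorem isStrictPartition_exchange (i : ℕ) {l : List ℕ} (hl : IsStrictPartition l) :
    IsStrictPartition (exchange i l) := by
  rw [exchange]
  split_ifs with h
  · exact hl
  · refine ⟨?_, ?_⟩
    · rw [List.pairwise_map]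
      refine hl.1.imp_of_mem fun {a b} ha hb hab => ?_
      have : ¬ (b = i + 1 ∧ a = i + 2) := fun h' => h ⟨h'.1 ▸ hb, h'.2 ▸ ha⟩
      simp only [Equiv.swap_apply_def]
      split_ifs <;> omega
    · intro p hp
      obtain ⟨q, hq, rfl⟩ := List.mem_map.mp hp
      have := hl.2 q hq
      simp only [Equiv.swap_apply_def]
      split_ifs <;> omega

theorem mem_map_swap (a b k : ℕ) (l : List ℕ) :
    k ∈ l.map (Equiv.swap a b) ↔ Equiv.swap a b k ∈ l := by
  rw [List.mem_map]
  constructor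
  · rintro ⟨a, ha, rfl⟩
    rwa [Equiv.swap_apply_self]
  · exact fun hk => ⟨_, hk, Equiv.swap_apply_self _ _ _⟩

theorem exchange_exchange (i : ℕ) (l : List ℕ) : exchange i (exchange i l) = l := by
  rw [exchange]
  by_cases h : i + 1 ∈ l ∧ i + 2 ∈ l
  · have : exchange i l = l := if_pos h
    rw [this, if_pos h]
  · have he : exchange i l = l.map (Equiv.swap (i + 1) (i + 2)) := if_neg h
    rw [he, if_neg ?_, List.map_map]
    · simp [Function.comp_def]
    · rw [mem_map_swap, mem_map_swap, Equiv.swap_apply_left, Equiv.swap_apply_right]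
      exact fun h' => h h'.symm

/-- Exchanging the parts `i + 1` and `i + 2`, as a permutation of the strict partitions. -/
def exchangeEquiv (i : ℕ) : Equiv.Perm StrictPartition :=
  Function.Involutive.toPerm
    (fun l => (⟨exchange i l.val, isStrictPartition_exchange i l.property⟩ : StrictPartition))
    fun l => Subtype.ext (exchange_exchange i l.val)

theorem exchange_eq_raise {i : ℕ} {l : List ℕ} (h : i + 2 ∉ l) :
    exchange i l = raise (i + 1) l := by
  rw [exchange, if_neg fun h' => h h'.2, raise]
  refine List.map_congr_left fun k hk => ?_
  have : k ≠ i + 2 := fun e => h (e ▸ hk)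
  rw [Equiv.swap_apply_def, if_neg this]

theorem exchange_eq_lower {i : ℕ} {l : List ℕ} (h : i + 1 ∉ l) :
    exchange i l = lower (i + 1) l := by
  rw [exchange, if_neg fun h' => h h'.1, lower]
  refine List.map_congr_left fun k hk => ?_
  have : k ≠ i + 1 := fun e => h (e ▸ hk)
  rw [Equiv.swap_apply_def, if_neg this]

theorem mem_exchange {i : ℕ} (l : List ℕ) :
    (i + 1 ∈ exchange i l ↔ i + 2 ∈ l) ∧ (i + 2 ∈ exchange i l ↔ i + 1 ∈ l) := by
  rw [exchange]
  split_ifs with h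
  · simp [h.1, h.2]
  · rw [mem_map_swap, mem_map_swap, Equiv.swap_apply_left, Equiv.swap_apply_right]
    exact ⟨Iff.rfl, Iff.rfl⟩

theorem eq_append_one_of_mem {l : List ℕ} (hl : IsStrictPartition l) (h : 1 ∈ l) :
    ∃ l', l = l' ++ [1] ∧ 1 ∉ l' := by
  obtain ⟨s, t, rfl⟩ := List.mem_iff_append.mp h
  have h1 := List.pairwise_append.mp hl.1
  have ht : t = [] := List.eq_nil_iff_forall_not_mem.mpr fun p hp => by
    have h2 := (List.pairwise_cons.mp h1.2.1).1 p hp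
    have h3 := hl.2 p (by simp [hp])
    omega
  subst ht
  exact ⟨s, rfl, fun h2 => lt_irrefl _ (h1.2.2 1 h2 1 (by simp))⟩

/-- Adding the part `1`, or removing it if it is present. -/
def toggle (l : List ℕ) : List ℕ := if 1 ∈ l then l.erase 1 else l ++ [1]

theorem erase_append_one {l : List ℕ} (h : 1 ∉ l) : (l ++ [1]).erase 1 = l := by
  rw [List.erase_append_right _ h]
  simp

theorem isStrictPartition_toggle {l : List ℕ} (hl : IsStrictPartition l) :
    IsStrictPartition (toggle l) := by
  rw [toggle]
  split_ifs with h
  · exact ⟨hl.1.sublist List.erase_sublist, fun p hp => hl.2 p (List.mem_of_mem_erase hp)⟩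
  · refine ⟨List.pairwise_append.mpr ⟨hl.1, by simp, fun a ha b hb => ?_⟩, fun p hp => ?_⟩
    · rw [List.mem_singleton] at hb
      subst hb
      have := hl.2 a ha
      have : a ≠ 1 := fun e => h (e ▸ ha)
      omega
    · rcases List.mem_append.mp hp with hp | hp
      · exact hl.2 p hp
      · rw [List.mem_singleton] at hp
        omega

theorem toggle_toggle {l : List ℕ} (hl : IsStrictPartition l) : toggle (toggle l) = l := by
  by_cases h : 1 ∈ l
  · obtain ⟨l', rfl, h'⟩ := eq_append_one_of_mem hl h
    have h1 : toggle (l' ++ [1]) = l' := by rw [toggle, if_pos h, erase_append_one h']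
    rw [h1, toggle, if_neg h']
  · have h1 : toggle l = l ++ [1] := if_neg h
    rw [h1, toggle, if_pos (by simp), erase_append_one h]

/-- Adding or removing the part `1`, as a permutation of the strict partitions. -/
def toggleEquiv : Equiv.Perm StrictPartition :=
  Function.Involutive.toPerm
    (fun l => (⟨toggle l.val, isStrictPartition_toggle l.property⟩ : StrictPartition))
    fun l => Subtype.ext (toggle_toggle l.property)

theorem one_mem_toggle {l : List ℕ} (hl : IsStrictPartition l) : 1 ∈ toggle l ↔ 1 ∉ l := by
  by_cases h : 1 ∈ l
  · obtain ⟨l', rfl, h'⟩ := eq_append_one_of_mem hl h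
    have h1 : toggle (l' ++ [1]) = l' := by rw [toggle, if_pos h, erase_append_one h']
    rw [h1]
    simp [h']
  · rw [toggle, if_neg h]
    simp [h]

theorem partSeries_succ (i : ℕ) {l : List ℕ} (hl : IsStrictPartition l) :
    partSeries l = coeffRefl (i + 1) (partSeries l) + MvPowerSeries.C (rootInf (i + 1)) *
      if i + 1 ∈ l ∧ i + 2 ∉ l then partSeries (exchange i l) else 0 := by
  have h := coeffRefl_nilSeries i l.reverse (List.pairwise_reverse.mpr hl.1)
  simp only [List.mem_reverse] at h
  by_cases hc : i + 1 ∈ l ∧ i + 2 ∉ l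
  · rw [if_pos hc] at h ⊢
    rw [exchange_eq_raise hc.2]
    rw [raise, List.map_reverse] at h
    exact h
  · rw [if_neg hc] at h ⊢
    exact h

theorem partSeries_zero {l : List ℕ} (hl : IsStrictPartition l) :
    reflInf 0 (partSeries l) = partSeries l + MvPowerSeries.C (2 * MvPolynomial.X 0) *
      if 1 ∈ l then 0 else partSeries (toggle l) := by
  have h := rootInf_mul_nilInf 0 (partSeries l)
  have hr : rootInf 0 = -(2 * MvPolynomial.X 0) := by rw [rootInf, two_mul]
  rw [hr, map_neg] at h
  have hn : nilInf 0 (partSeries l) = if 1 ∈ l then 0 else partSeries (toggle l) := by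
    split_ifs with h1
    · obtain ⟨l', rfl, h'⟩ := eq_append_one_of_mem hl h1
      rw [partSeries, List.reverse_append]
      exact nilInf_zero_nilSeries_one _
    · rw [toggle, if_neg h1, partSeries, partSeries, List.reverse_append]
      rfl
  rw [hn] at h
  linear_combination h

/-! ### The Cauchy kernel -/

section

variable {K : Type*} [Field K]

/-- The coefficient of `∑_λ P_λ(y|a) Q_λ(X|a)` at a monomial in `y`, for values in `K` of the
parameters. -/
def kernelSum (φ : Ca →+* K) (X : Finset K) (β : ℕ →₀ ℕ) : K :=
  ∑ᶠ l : StrictPartition, φ (MvPowerSeries.coeff β (partSeries l.val)) *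
    pointQ (fun j => φ (MvPolynomial.X j)) l.val X

theorem hasFiniteSupport_of_coeff {β : ℕ →₀ ℕ} {f : StrictPartition → K}
    (h : ∀ l : StrictPartition, MvPowerSeries.coeff β (partSeries l.val) = 0 → f l = 0) :
    Function.HasFiniteSupport f :=
  (finite_coeff_partSeries_ne_zero β).subset fun l hl h0 => hl (h l h0)

/-- Both sides are ∑ (s P_λ) Q_λ plus a correction. On the left it comes from removing a box in Q_λ,
on the right from adding one in P_λ, and `exchangeEquiv` matches the two. -/
theorem kernelSum_reflCa (i : ℕ) (φ : Ca →+* K) (X : Finset K) (β : ℕ →₀ ℕ) :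
    kernelSum (φ.comp (reflCa (i + 1)).toRingHom) X β = kernelSum φ X β := by
  set b : ℕ → K := fun j => φ (MvPolynomial.X j) with hb
  set s : Ca →+* Ca := (reflCa (i + 1)).toRingHom with hs
  set α : K := φ (rootInf (i + 1)) with hα
  have hα' : b i - b (i + 1) = α := by rw [hα, rootInf, map_sub]
  have hbs : (fun j => (φ.comp s) (MvPolynomial.X j)) = fun j => b (Equiv.swap i (i + 1) j) := by
    funext j
    rw [RingHom.comp_apply]
    exact congrArg φ (reflCa_X (i + 1) j)
  set c : StrictPartition → Ca := fun l => MvPowerSeries.coeff β (partSeries l.val) with hc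
  have hcoeff : ∀ l : StrictPartition, c l = s (c l) + rootInf (i + 1) *
      if i + 1 ∈ l.val ∧ i + 2 ∉ l.val then c (exchangeEquiv i l) else 0 := by
    intro l
    have h := congrArg (MvPowerSeries.coeff β) (partSeries_succ i l.property)
    rw [map_add, MvPowerSeries.coeff_C_mul, coeffRefl, MvPowerSeries.coeff_map,
      apply_ite (MvPowerSeries.coeff β), map_zero] at h
    exact h
  set g : StrictPartition → K := fun l =>
    if i + 2 ∈ l.val ∧ i + 1 ∉ l.val then
      φ (c l) * (α * pointQ b (exchangeEquiv i l).val X) else 0 with hg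
  have hterm : ∀ l : StrictPartition, (φ.comp s) (c l) *
      pointQ (fun j => (φ.comp s) (MvPolynomial.X j)) l.val X =
      φ (s (c l)) * pointQ b l.val X + g l := by
    intro l
    rw [hbs, pointQ_swap b i l.val l.property.1, hα', RingHom.comp_apply, hg]
    by_cases h : i + 2 ∈ l.val ∧ i + 1 ∉ l.val
    · have h1 := hcoeff l
      -- Without a row of length i + 1 the coefficient is fixed by s.
      rw [if_neg fun h' => h.2 h'.1, mul_zero, add_zero] at h1
      have h2 : (exchangeEquiv i l).val = lower (i + 1) l.val := exchange_eq_lower h.2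
      simp only [if_pos h, ← h1, h2]
      ring
    · simp only [if_neg h]
      ring
  have hterm' : ∀ l : StrictPartition, φ (c l) * pointQ b l.val X =
      φ (s (c l)) * pointQ b l.val X + g (exchangeEquiv i l) := by
    intro l
    have hm1 : i + 2 ∈ (exchangeEquiv i l).val ↔ i + 1 ∈ l.val := (mem_exchange l.val).2
    have hm2 : i + 1 ∈ (exchangeEquiv i l).val ↔ i + 2 ∈ l.val := (mem_exchange l.val).1
    have he : exchangeEquiv i (exchangeEquiv i l) = l :=
      Subtype.ext (exchange_exchange i l.val)
    rw [hcoeff l, map_add, map_mul, add_mul, hg]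
    simp only [hm1, hm2, he]
    congr 1
    · rw [← hcoeff l]
    · split_ifs
      · ring
      · simp
  have hs0 : ∀ l, c l = 0 → φ (s (c l)) * pointQ b l.val X = 0 := fun l h => by simp [h]
  have hg0 : ∀ l, c l = 0 → g l = 0 := fun l h => by simp [hg, h]
  have hgf : Function.HasFiniteSupport g := hasFiniteSupport_of_coeff hg0
  have hgf' : Function.HasFiniteSupport fun l => g (exchangeEquiv i l) := by
    have : (fun l => g (exchangeEquiv i l)).support = exchangeEquiv i ⁻¹' g.support := rfl
    rw [Function.HasFiniteSupport, this]
    exact hgf.preimage (exchangeEquiv i).injective.injOn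
  rw [kernelSum, kernelSum, finsum_congr hterm, finsum_congr hterm',
    finsum_add_distrib (hasFiniteSupport_of_coeff hs0) hgf,
    finsum_add_distrib (hasFiniteSupport_of_coeff hs0) hgf', finsum_comp_equiv (exchangeEquiv i)]

theorem coeff_Omega_mul {R : Type*} [CommRing R] (u : R) (f : MvPowerSeries ℕ R) (β : ℕ →₀ ℕ) :
    MvPowerSeries.coeff β (Omega u * f) = ∑ p ∈ Finset.HasAntidiagonal.antidiagonal β,
      MvPowerSeries.coeff p.1 (Omega u) * MvPowerSeries.coeff p.2 f :=
  MvPowerSeries.coeff_mul _ _ _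

-- Putting a variable equal to a_1 removes the part 1 from Q_λ, and s_0 adds the part 1 to P_λ, with
-- the same factor 2 a_1. Matched by `toggleEquiv`, these turn the left side into ∑ (s_0 P_λ)
-- Q_λ(X|-a_1, a_2, …), and Ω(a_1|y) comes out of s_0.
open scoped Classical in
theorem kernelSum_insert_zero (φ : Ca →+* K) (X : Finset K) (β : ℕ →₀ ℕ)
    (hX : φ (MvPolynomial.X 0) ∉ X) :
    kernelSum φ (insert (φ (MvPolynomial.X 0)) X) β =
      ∑ p ∈ Finset.HasAntidiagonal.antidiagonal β,
        MvPowerSeries.coeff p.1 (Omega (φ (MvPolynomial.X 0))) *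
          kernelSum (φ.comp (reflCa 0).toRingHom) X p.2 := by
  set b : ℕ → K := fun j => φ (MvPolynomial.X j) with hb
  set s : Ca →+* Ca := (reflCa 0).toRingHom with hs
  have hbs : (fun j => (φ.comp s) (MvPolynomial.X j)) = negFirst b := by
    funext j
    rw [RingHom.comp_apply]
    refine (congrArg φ (reflCa_X 0 j)).trans ?_
    rw [reflVar, negFirst]
    split_ifs
    · rw [map_neg]
    · rfl
  set c : StrictPartition → Ca := fun l => MvPowerSeries.coeff β (partSeries l.val) with hc
  set g : StrictPartition → K := fun l =>
    if 1 ∈ l.val then φ (c l) * (2 * b 0 * pointQ (negFirst b) (toggleEquiv l).val X) else 0 with hg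
  have hterm : ∀ l : StrictPartition, φ (c l) * pointQ b l.val (insert (b 0) X) =
      φ (c l) * pointQ (negFirst b) l.val X + g l := by
    intro l
    rw [pointQ_insert_first b l.val l.property.1 l.property.2 X hX, mul_add, hg]
    congr 1
    by_cases h : 1 ∈ l.val
    · have : (toggleEquiv l).val = l.val.erase 1 := if_pos h
      simp only [if_pos h, this]
    · simp only [if_neg h, mul_zero]
  have hrefl : ∀ l : StrictPartition,
      φ (MvPowerSeries.coeff β (reflInf 0 (partSeries l.val))) * pointQ (negFirst b) l.val X =
        φ (c l) * pointQ (negFirst b) l.val X + g (toggleEquiv l) := by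
    intro l
    have h1 : 1 ∈ (toggleEquiv l).val ↔ 1 ∉ l.val := one_mem_toggle l.property
    have he : toggleEquiv (toggleEquiv l) = l := Subtype.ext (toggle_toggle l.property)
    rw [partSeries_zero l.property, map_add, map_add, MvPowerSeries.coeff_C_mul, add_mul, hg]
    simp only [h1, he]
    congr 1
    by_cases h : 1 ∈ l.val
    · simp [h]
    · have ht : c (toggleEquiv l) = MvPowerSeries.coeff β (partSeries (toggle l.val)) := rfl
      have hb0 : φ (MvPolynomial.X 0) = b 0 := rfl
      rw [if_neg h, if_pos h, ht, map_mul, map_mul, map_ofNat, hb0]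
      ring
  have hgf : Function.HasFiniteSupport g := hasFiniteSupport_of_coeff fun l (h : c l = 0) => by
    simp [hg, h]
  have hgf' : Function.HasFiniteSupport fun l => g (toggleEquiv l) := by
    have : (fun l => g (toggleEquiv l)).support = toggleEquiv ⁻¹' g.support := rfl
    rw [Function.HasFiniteSupport, this]
    exact hgf.preimage toggleEquiv.injective.injOn
  have hf : Function.HasFiniteSupport fun l : StrictPartition =>
      φ (c l) * pointQ (negFirst b) l.val X :=
    hasFiniteSupport_of_coeff fun l (h : c l = 0) => by simp [h]
  have h1 : kernelSum φ (insert (b 0) X) β = ∑ᶠ l : StrictPartition,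
      φ (MvPowerSeries.coeff β (reflInf 0 (partSeries l.val))) * pointQ (negFirst b) l.val X := by
    rw [finsum_congr hrefl, finsum_add_distrib hf hgf', finsum_comp_equiv toggleEquiv,
      ← finsum_add_distrib hf hgf]
    exact finsum_congr hterm
  refine h1.trans ?_
  have h2 : ∀ l : StrictPartition,
      φ (MvPowerSeries.coeff β (reflInf 0 (partSeries l.val))) * pointQ (negFirst b) l.val X =
      ∑ p ∈ Finset.HasAntidiagonal.antidiagonal β,
        MvPowerSeries.coeff p.1 (Omega (b 0)) *
          ((φ.comp s) (MvPowerSeries.coeff p.2 (partSeries l.val)) *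
            pointQ (negFirst b) l.val X) := by
    intro l
    rw [reflInf, twist, if_pos rfl, coeff_Omega_mul, map_sum, Finset.sum_mul]
    refine Finset.sum_congr rfl fun p _ => ?_
    rw [map_mul, coeffRefl, MvPowerSeries.coeff_map, ← MvPowerSeries.coeff_map, map_Omega,
      RingHom.comp_apply]
    ring
  rw [finsum_congr h2, finsum_sum_comm]
  · refine Finset.sum_congr rfl fun p _ => ?_
    rw [← mul_finsum, kernelSum, hbs]
  · intro p _
    exact hasFiniteSupport_of_coeff (β := p.2) fun l h => by simp [h]

theorem infinite_range_comp_reflCa (i : ℕ) (φ : Ca →+* K)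
    (h : (Set.range fun j => φ (MvPolynomial.X j)).Infinite) :
    (Set.range fun j => (φ.comp (reflCa i).toRingHom) (MvPolynomial.X j)).Infinite := by
  have hX : ∀ j, (φ.comp (reflCa i).toRingHom) (MvPolynomial.X j) = φ (reflVar i j) :=
    fun j => congrArg φ (reflCa_X i j)
  simp only [hX]
  cases i with
  | zero =>
    refine (h.sdiff (Set.finite_singleton (φ (MvPolynomial.X 0)))).mono ?_
    rintro _ ⟨⟨j, rfl⟩, hj⟩
    have h0 : j ≠ 0 := by
      rintro rfl
      exact hj rfl
    exact ⟨j, by simp [reflVar, h0]⟩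
  | succ i =>
    refine h.mono ?_
    rintro _ ⟨j, rfl⟩
    exact ⟨Equiv.swap i (i + 1) j, by simp [reflVar]⟩

-- The symmetry in the parameters moves the chosen parameter to the first place by adjacent
-- exchanges. Each exchange changes φ, so the identity for X is assumed for all φ.
open scoped Classical in
theorem kernelSum_insert_param (X : Finset K)
    (ih : ∀ (φ : Ca →+* K), (Set.range fun j => φ (MvPolynomial.X j)).Infinite → ∀ β,
      kernelSum φ X β = MvPowerSeries.coeff β (∏ x ∈ X, Omega x))
    (k : ℕ) (φ : Ca →+* K) (hφ : (Set.range fun j => φ (MvPolynomial.X j)).Infinite)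
    (hX : φ (MvPolynomial.X k) ∉ X) (β : ℕ →₀ ℕ) :
    kernelSum φ (insert (φ (MvPolynomial.X k)) X) β =
      MvPowerSeries.coeff β (Omega (φ (MvPolynomial.X k)) * ∏ x ∈ X, Omega x) := by
  induction k generalizing φ with
  | zero =>
    rw [kernelSum_insert_zero φ X β hX, coeff_Omega_mul]
    refine Finset.sum_congr rfl fun p _ => ?_
    rw [ih _ (infinite_range_comp_reflCa 0 φ hφ)]
  | succ k ihk =>
    have h := ihk (φ.comp (reflCa (k + 1)).toRingHom) (infinite_range_comp_reflCa (k + 1) φ hφ)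
    have hk : (φ.comp (reflCa (k + 1)).toRingHom) (MvPolynomial.X k) =
        φ (MvPolynomial.X (k + 1)) :=
      congrArg φ ((reflCa_X (k + 1) k).trans (by simp [reflVar]))
    rw [hk, kernelSum_reflCa] at h
    exact h hX

/-- Multiplied by ∏ (x - w), each coefficient of the identity becomes a polynomial identity in the
new point w. It holds at the parameter values outside X, of which there are infinitely many. -/
theorem kernelSum_eq (X : Finset K) (φ : Ca →+* K)
    (hφ : (Set.range fun j => φ (MvPolynomial.X j)).Infinite) (β : ℕ →₀ ℕ) :
    kernelSum φ X β = MvPowerSeries.coeff β (∏ x ∈ X, Omega x) := by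
  classical
  induction X using Finset.induction_on generalizing φ β with
  | empty =>
    refine (finsum_eq_single (α := StrictPartition) _ ⟨[], by simp [IsStrictPartition]⟩ ?_).trans ?_
    rotate_left
    · simp only [pointQ, mul_one, Finset.prod_empty]
      change φ (MvPowerSeries.coeff β 1) = _
      rw [MvPowerSeries.coeff_one, MvPowerSeries.coeff_one]
      split_ifs <;> simp
    · rintro ⟨_ | ⟨k, l⟩, hl⟩ hne
      · exact absurd rfl hne
      · simp [pointQ]
  | insert w X hw ih =>
    rw [Finset.prod_insert hw]
    -- The finite set of contributing λ depends on β only, not on the points.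
    set T := (finite_coeff_partSeries_ne_zero β).toFinset with hT
    have hsum : ∀ Y : Finset K, kernelSum φ Y β = ∑ l ∈ T,
        φ (MvPowerSeries.coeff β (partSeries l.val)) *
          pointQ (fun j => φ (MvPolynomial.X j)) l.val Y := by
      intro Y
      refine finsum_eq_sum_of_support_subset _ fun l hl => ?_
      rw [hT, Set.Finite.coe_toFinset]
      intro h0
      rw [Function.mem_support, h0] at hl
      simp at hl
    choose p hp using exists_poly_pointQ (fun j => φ (MvPolynomial.X j))
    set D : Polynomial K := ∏ x ∈ X, (Polynomial.C x - Polynomial.X) with hD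
    set P : Polynomial K := ∑ l ∈ T,
        Polynomial.C (φ (MvPowerSeries.coeff β (partSeries l.val))) * p l.val X -
      D * ∑ q ∈ Finset.HasAntidiagonal.antidiagonal β,
        MvPowerSeries.coeff q.1 (Omega (Polynomial.X : Polynomial K)) *
          Polynomial.C (MvPowerSeries.coeff q.2 (∏ x ∈ X, Omega x)) with hP
    have heval : ∀ z ∉ X, P.eval z = (∏ x ∈ X, (x - z)) * (kernelSum φ (insert z X) β -
        MvPowerSeries.coeff β (Omega z * ∏ x ∈ X, Omega x)) := by
      intro z hz
      rw [hP, hsum, coeff_Omega_mul, Polynomial.eval_sub, Polynomial.eval_mul,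
        Polynomial.eval_finsetSum, Polynomial.eval_finsetSum, mul_sub, hD,
        Polynomial.eval_prod]
      congr 1
      · rw [Finset.mul_sum]
        refine Finset.sum_congr rfl fun l _ => ?_
        rw [Polynomial.eval_mul, Polynomial.eval_C, hp _ _ _ hz]
        ring
      · congr 1
        · simp
        · refine Finset.sum_congr rfl fun q _ => ?_
          have h1 : (MvPowerSeries.coeff q.1 (Omega (Polynomial.X : Polynomial K))).eval z =
              MvPowerSeries.coeff q.1 (Omega z) := by
            have h2 := MvPowerSeries.coeff_map (Polynomial.evalRingHom z) q.1
              (Omega (Polynomial.X : Polynomial K))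
            rw [map_Omega, Polynomial.coe_evalRingHom, Polynomial.eval_X] at h2
            exact h2.symm
          rw [Polynomial.eval_mul, Polynomial.eval_C, h1]
    have hP0 : P = 0 := by
      refine Polynomial.eq_zero_of_infinite_isRoot P
        ((hφ.sdiff (Finset.finite_toSet X)).mono ?_)
      rintro _ ⟨⟨k, rfl⟩, hk⟩
      have hk' : φ (MvPolynomial.X k) ∉ X := hk
      change P.eval _ = 0
      rw [heval _ hk', kernelSum_insert_param X ih k φ hφ hk', sub_self, mul_zero]
    have h := heval w hw
    rw [hP0, Polynomial.eval_zero] at h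
    have hne : ∏ x ∈ X, (x - w) ≠ 0 := Finset.prod_ne_zero_iff.mpr fun x hx =>
      sub_ne_zero.mpr fun e => hw (e ▸ hx)
    exact sub_eq_zero.mp ((mul_eq_zero.mp h.symm).resolve_left hne)

end

theorem ofCa_injective (N : ℕ) : Function.Injective (ofCa N) :=
  (IsFractionRing.injective (MvPolynomial (Fin N) Ca) (FracX N)).comp (MvPolynomial.C_injective _ _)

theorem isDualFamily_partSeries : IsDualFamily fun l => partSeries l.val := by
  refine ⟨finite_coeff_partSeries_ne_zero, fun N β => ?_⟩
  have hinf : (Set.range fun j => ofCa N (MvPolynomial.X j)).Infinite :=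
    Set.infinite_range_of_injective ((ofCa_injective N).comp MvPolynomial.X_injective)
  have h := kernelSum_eq (Finset.univ.map ⟨xVar N, xVar_injective N⟩) (ofCa N) hinf β
  rw [Finset.prod_map] at h
  refine h.symm.trans (finsum_congr fun l => ?_)
  rw [factorialQ_eq_pointQ]

/-! ### Uniqueness of the dual family -/

/-- The parts of a list, indexed by `Fin N`. -/
def part (N : ℕ) (l : List ℕ) (i : Fin N) : ℕ := l.getD i.val 0

theorem ofFn_part {N : ℕ} {l : List ℕ} (hl : l.length = N) : List.ofFn (part N l) = l := by
  subst hl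
  refine List.ext_getElem (by simp) fun i h1 h2 => ?_
  simp [part, h2]

/-- `2 x (x - a_1) ⋯ (x - a_{k-1})` in the polynomial ring. -/
def polyPow {N : ℕ} (i : Fin N) (k : ℕ) : MvPolynomial (Fin N) Ca :=
  2 * MvPolynomial.X i * ∏ j ∈ Finset.range (k - 1),
    (MvPolynomial.X i - MvPolynomial.C (MvPolynomial.X j))

/-- The antisymmetrization of `∏_i ((x_i|a))^{λ_i}`. -/
def alternant (N : ℕ) (l : List ℕ) : MvPolynomial (Fin N) Ca :=
  ∑ w : Equiv.Perm (Fin N), (w.sign : MvPolynomial (Fin N) Ca) * ∏ i, polyPow (w i) (part N l i)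

/-- `∏_{i < j} (x_i + x_j) / (x_i - x_j)`. -/
def crossProd (N : ℕ) : FracX N :=
  ∏ i : Fin N, ∏ j ∈ Finset.Ioi i, (xVar N i + xVar N j) / (xVar N i - xVar N j)

theorem crossProd_ne_zero (N : ℕ) : crossProd N ≠ 0 := by
  refine Finset.prod_ne_zero_iff.mpr fun i _ => Finset.prod_ne_zero_iff.mpr fun j hj => ?_
  have hij : i ≠ j := (Finset.mem_Ioi.mp hj).ne
  refine div_ne_zero ?_ (sub_ne_zero.mpr fun h => hij (xVar_injective N h))
  rw [xVar, xVar, ← map_add]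
  refine (map_ne_zero_iff _ (IsFractionRing.injective (MvPolynomial (Fin N) Ca) (FracX N))).mpr ?_
  intro h
  have h1 := congrArg (MvPolynomial.eval fun _ => (1 : Ca)) h
  norm_num at h1

theorem add_div_sub_symm {K : Type*} [Field K] (x y : K) :
    (x + y) / (x - y) = -((y + x) / (y - x)) := by
  rw [← neg_sub y x, div_neg, add_comm]

/-- With as many rows as variables the cross factor runs over all pairs, and a permutation of the
variables multiplies it by the sign. -/
theorem factorialQ_of_length_eq {N : ℕ} (l : StrictPartition) (hl : l.val.length = N) :
    factorialQ N l = crossProd N *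
      algebraMap (MvPolynomial (Fin N) Ca) (FracX N) (alternant N l.val) := by
  have hfilter : Finset.univ.filter (fun i : Fin N => i.val < N) = Finset.univ :=
    Finset.filter_true_of_mem fun i _ => i.isLt
  rw [factorialQ, if_pos hl.le, hl, Nat.sub_self, Nat.factorial_zero, Nat.cast_one, inv_one,
    one_mul, alternant, map_sum, Finset.mul_sum]
  refine Finset.sum_congr rfl fun w _ => ?_
  rw [hfilter, Finset.prod_mul_distrib, map_mul, map_prod, mul_left_comm, mul_comm]
  have h := w.prod_Ioi_comp_eq_sign_mul_prod (f := fun i j =>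
    (xVar N i + xVar N j) / (xVar N i - xVar N j))
    fun i j => add_div_sub_symm _ _
  have hI : ∀ i : Fin N, Finset.univ.filter (fun j => i < j) = Finset.Ioi i := fun i => by ext j; simp
  simp only [hI]
  rw [h, crossProd, map_intCast, mul_assoc]
  congr 2
  refine Finset.prod_congr rfl fun i _ => ?_
  simp only [polyPow, facPow, xVar, ofCa, part, map_mul, map_prod, map_sub, RingHom.comp_apply]
  rw [map_ofNat]

/-- The values `2 a_m (a_m - a_1) ⋯ (a_m - a_{k-1})`. -/
def paramPow (m k : ℕ) : Ca :=
  2 * MvPolynomial.X (m - 1) * ∏ j ∈ Finset.range (k - 1),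
    (MvPolynomial.X (m - 1) - MvPolynomial.X j)

theorem paramPow_eq_zero {m k : ℕ} (hm : 0 < m) (h : m < k) : paramPow m k = 0 := by
  rw [paramPow, Finset.prod_eq_zero (Finset.mem_range.mpr (by omega : m - 1 < k - 1)) (sub_self _),
    mul_zero]

theorem paramPow_self_ne_zero (m : ℕ) : paramPow m m ≠ 0 := by
  refine mul_ne_zero (mul_ne_zero two_ne_zero (MvPolynomial.X_ne_zero _))
    (Finset.prod_ne_zero_iff.mpr fun j hj => sub_ne_zero.mpr fun h => ?_)
  have := MvPolynomial.X_injective h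
  rw [Finset.mem_range] at hj
  omega

theorem eval_alternant {N : ℕ} (l : List ℕ) (m : Fin N → ℕ) :
    MvPolynomial.eval (fun i => MvPolynomial.X (m i - 1)) (alternant N l) =
      ∑ w : Equiv.Perm (Fin N), (w.sign : Ca) * ∏ i, paramPow (m (w i)) (part N l i) := by
  rw [alternant, map_sum]
  refine Finset.sum_congr rfl fun w _ => ?_
  rw [map_mul, map_intCast, map_prod]
  congr 1
  refine Finset.prod_congr rfl fun i _ => ?_
  simp [polyPow, paramPow]

theorem perm_eq_one_of_strictMono {n : ℕ} (w : Equiv.Perm (Fin n)) (hw : StrictMono w) : w = 1 := by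
  have hw' : StrictMono w.symm := fun i j hij => by
    rcases lt_trichotomy (w.symm i) (w.symm j) with h | h | h
    · exact h
    · exact absurd (w.symm.injective h) hij.ne
    · have := hw h
      simp only [Equiv.apply_symm_apply] at this
      exact absurd this hij.not_gt
  ext i : 1
  refine le_antisymm ?_ (hw.id_le i)
  have := hw'.id_le (w i)
  simpa using this

/-- Among the λ with nonzero coefficient take the least number N of parts: in N variables all longer
ones vanish. Among those with N parts take μ of least size and set x_i = a_{μ_i}. A surviving term
(λ, w) has λ_i ≤ μ_{w(i)} for all i; minimality gives equality, and strict decrease forces w = 1 and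
λ = μ. -/
theorem eq_zero_of_finsum_factorialQ (c : StrictPartition → Ca) (hc : {l | c l ≠ 0}.Finite)
    (h : ∀ N, ∑ᶠ l : StrictPartition, ofCa N (c l) * factorialQ N l = 0) : c = 0 := by
  by_contra hne
  have hT : hc.toFinset.Nonempty := by
    obtain ⟨l, hl⟩ := Function.ne_iff.mp hne
    exact ⟨l, by simpa using hl⟩
  obtain ⟨ν, hν, hνmin⟩ := Finset.exists_min_image hc.toFinset
    (fun l : StrictPartition => l.val.length) hT
  set N := ν.val.length with hN
  set T := hc.toFinset.filter fun l : StrictPartition => l.val.length = N with hTdef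
  have hmemT : ∀ l, l ∈ T ↔ c l ≠ 0 ∧ l.val.length = N := fun l => by
    rw [hTdef, Finset.mem_filter, Set.Finite.mem_toFinset, Set.mem_ofPred_eq]
  obtain ⟨μ, hμ, hμmin⟩ := Finset.exists_min_image T (fun l : StrictPartition => l.val.sum)
    ⟨ν, (hmemT ν).mpr ⟨by simpa using hν, rfl⟩⟩
  obtain ⟨hcμ, hμN⟩ := (hmemT μ).mp hμ
  have h1 : ∑ l ∈ T, ofCa N (c l) * factorialQ N l = 0 := by
    rw [← h N]
    refine (finsum_eq_sum_of_support_subset _ fun l hl => ?_).symm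
    have hl' := Function.mem_support.mp hl
    have hcl : c l ≠ 0 := fun h0 => hl' (by rw [h0, map_zero, zero_mul])
    rw [Finset.mem_coe, hmemT]
    refine ⟨hcl, le_antisymm ?_ (hνmin l (by simpa using hcl))⟩
    by_contra hlt
    exact hl' (by rw [factorialQ, if_neg hlt, mul_zero])
  have h2 : ∑ l ∈ T, MvPolynomial.C (c l) * alternant N l.val = 0 := by
    apply IsFractionRing.injective (MvPolynomial (Fin N) Ca) (FracX N)
    apply mul_left_cancel₀ (crossProd_ne_zero N)
    rw [map_zero, mul_zero, ← h1, map_sum, Finset.mul_sum]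
    refine Finset.sum_congr rfl fun l hl => ?_
    rw [factorialQ_of_length_eq l ((hmemT l).mp hl).2, map_mul]
    change crossProd N * (ofCa N (c l) * _) = _
    ring
  have h3 := congrArg (MvPolynomial.eval fun i => MvPolynomial.X (part N μ.val i - 1)) h2
  rw [map_sum, map_zero] at h3
  have hpart : ∀ l : StrictPartition, l.val.length = N →
      (∀ i j, i < j → part N l.val j < part N l.val i) ∧ (∀ i, 0 < part N l.val i) ∧
        ∑ i, part N l.val i = l.val.sum := by
    intro l hl
    have hof := ofFn_part hl
    refine ⟨fun i j hij => ?_, fun i => ?_, ?_⟩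
    · have := l.property.1
      rw [← hof, List.pairwise_ofFn] at this
      exact this hij
    · refine l.property.2 _ ?_
      have : part N l.val i ∈ List.ofFn (part N l.val) := List.mem_ofFn.mpr ⟨i, rfl⟩
      rwa [hof] at this
    · rw [← List.sum_ofFn, hof]
  obtain ⟨hμdec, hμpos, hμsum⟩ := hpart μ hμN
  have hterm : ∀ l ∈ T, ∀ w : Equiv.Perm (Fin N),
      ∏ i, paramPow (part N μ.val (w i)) (part N l.val i) ≠ 0 → l = μ ∧ w = 1 := by
    intro l hl w hw
    obtain ⟨hldec, hlpos, hlsum⟩ := hpart l ((hmemT l).mp hl).2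
    have hle : ∀ i ∈ Finset.univ, part N l.val i ≤ part N μ.val (w i) := by
      intro i _
      by_contra hlt
      exact hw (Finset.prod_eq_zero (Finset.mem_univ i)
        (paramPow_eq_zero (hμpos _) (not_le.mp hlt)))
    have hsumw : ∑ i, part N μ.val (w i) = ∑ i, part N μ.val i :=
      Equiv.sum_comp w fun i => part N μ.val i
    have hsum : ∑ i, part N l.val i = ∑ i, part N μ.val (w i) := by
      refine le_antisymm (Finset.sum_le_sum hle) ?_
      rw [hsumw, hμsum, hlsum]
      exact hμmin l hl
    have heq := (Finset.sum_eq_sum_iff_of_le hle).mp hsum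
    have hw1 : w = 1 := by
      refine perm_eq_one_of_strictMono w fun i j hij => ?_
      have h4 := hldec i j hij
      rw [heq i (Finset.mem_univ i), heq j (Finset.mem_univ j)] at h4
      rcases lt_trichotomy (w i) (w j) with h5 | h5 | h5
      · exact h5
      · rw [h5] at h4
        exact absurd h4 (lt_irrefl _)
      · exact absurd (hμdec _ _ h5) h4.not_gt
    refine ⟨Subtype.ext ?_, hw1⟩
    rw [← ofFn_part ((hmemT l).mp hl).2, ← ofFn_part hμN]
    congr 1
    funext i
    rw [heq i (Finset.mem_univ i), hw1]
    rfl
  rw [Finset.sum_eq_single_of_mem μ hμ] at h3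
  · rw [map_mul, MvPolynomial.eval_C, eval_alternant,
      Finset.sum_eq_single_of_mem 1 (Finset.mem_univ _)] at h3
    · simp only [Equiv.Perm.sign_one, Units.val_one, Int.cast_one, one_mul,
        Equiv.Perm.coe_one, id] at h3
      exact (mul_ne_zero hcμ
        (Finset.prod_ne_zero_iff.mpr fun i _ => paramPow_self_ne_zero _)) h3
    · intro w _ hw1
      by_contra hw
      exact hw1 (hterm μ hμ w (right_ne_zero_of_mul hw)).2
  · intro l hl hlμ
    rw [map_mul, eval_alternant, Finset.sum_eq_zero, mul_zero]
    intro w _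
    by_contra hw
    exact hlμ (hterm l hl w (right_ne_zero_of_mul hw)).1

theorem IsDualFamily.unique {F G : StrictPartition → MvPowerSeries ℕ Ca} (hF : IsDualFamily F)
    (hG : IsDualFamily G) : F = G := by
  funext l
  ext β : 1
  have hfin : ∀ {H : StrictPartition → MvPowerSeries ℕ Ca}, IsDualFamily H → ∀ N,
      Function.HasFiniteSupport fun l : StrictPartition =>
        ofCa N (MvPowerSeries.coeff β (H l)) * factorialQ N l := fun hH N =>
    (hH.1 β).subset fun l hl h0 => hl (by simp [h0])
  have h := eq_zero_of_finsum_factorialQ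
    (fun l => MvPowerSeries.coeff β (F l) - MvPowerSeries.coeff β (G l))
    (((hF.1 β).union (hG.1 β)).subset fun l hl => ?_) fun N => ?_
  · exact sub_eq_zero.mp (congrFun h l)
  · by_contra h0
    simp only [Set.mem_union, Set.mem_ofPred_eq, not_or, not_not] at h0
    exact hl (by simp [h0.1, h0.2])
  · simp only [map_sub, sub_mul]
    rw [finsum_sub_distrib (hfin hF N) (hfin hG N), ← hF.2 N β, ← hG.2 N β, sub_self]

theorem dualFactorialP_eq (l : StrictPartition) : dualFactorialP l = partSeries l.val :=
  congrFun (IsDualFamily.unique (Classical.epsilon_spec ⟨_, isDualFamily_partSeries⟩)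
    isDualFamily_partSeries) l

/-! ### Dependence on finitely many parameters -/

/-- Setting the parameters `a_j`, `j > M`, to zero. -/
def truncParam (M : ℕ) : Ca →ₐ[ℂ] Ca :=
  MvPolynomial.aeval fun j => if j < M then MvPolynomial.X j else 0

/-- The series `f` involves the parameters `a_1, …, a_M` only. -/
def FirstParams (M : ℕ) (f : MvPowerSeries ℕ Ca) : Prop :=
  MvPowerSeries.map (truncParam M).toRingHom f = f

theorem truncParam_X (M j : ℕ) :
    truncParam M (MvPolynomial.X j) = if j < M then MvPolynomial.X j else 0 :=
  MvPolynomial.aeval_X _ _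

theorem truncParam_rootInf {M i : ℕ} (hi : i < M) : truncParam M (rootInf i) = rootInf i := by
  cases i with
  | zero => rw [rootInf, map_neg, map_add, truncParam_X, if_pos hi]
  | succ i => rw [rootInf, map_sub, truncParam_X, truncParam_X, if_pos hi, if_pos (by omega)]

theorem truncParam_reflCa {M i : ℕ} (hi : i < M) (p : Ca) :
    truncParam M (reflCa i p) = reflCa i (truncParam M p) := by
  have : (truncParam M).comp (reflCa i) = (reflCa i).comp (truncParam M) := by
    apply MvPolynomial.algHom_ext
    intro k
    simp only [AlgHom.comp_apply, reflCa_X, truncParam_X]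
    cases i with
    | zero =>
      by_cases hk : k = 0
      · subst hk
        simp [reflVar, hi, truncParam_X]
      · by_cases hkM : k < M <;> simp [reflVar, hk, truncParam_X, hkM]
    | succ i =>
      have h : Equiv.swap i (i + 1) k < M ↔ k < M := by
        rw [Equiv.swap_apply_def]
        split_ifs <;> omega
      by_cases hkM : k < M <;> simp [reflVar, truncParam_X, h, hkM]
  exact DFunLike.congr_fun this p

theorem FirstParams.reflInf {M i : ℕ} (hi : i < M) {f : MvPowerSeries ℕ Ca}
    (hf : FirstParams M f) : FirstParams M (reflInf i f) := by
  have h1 : MvPowerSeries.map (truncParam M).toRingHom (twist i) = twist i := by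
    cases i with
    | zero =>
      rw [twist, if_pos rfl, map_Omega]
      congr 1
      exact (truncParam_X M 0).trans (if_pos hi)
    | succ i => rw [twist_succ, map_one]
  have h2 : MvPowerSeries.map (truncParam M).toRingHom (coeffRefl i f) = coeffRefl i f := by
    conv_rhs => rw [← hf]
    ext β : 1
    simp only [coeffRefl, MvPowerSeries.coeff_map]
    exact truncParam_reflCa hi _
  rw [FirstParams, AffineC.reflInf, map_mul, h1, h2]

theorem FirstParams.nilInf {M i : ℕ} (hi : i < M) {f : MvPowerSeries ℕ Ca}
    (hf : FirstParams M f) : FirstParams M (nilInf i f) := by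
  apply mul_left_cancel₀ (C_ne_zero (rootInf_ne_zero i))
  have h := congrArg (MvPowerSeries.map (truncParam M).toRingHom) (rootInf_mul_nilInf i f)
  have hr : (truncParam M).toRingHom (rootInf i) = rootInf i := truncParam_rootInf hi
  rw [map_mul, map_sub, hf.reflInf hi, hf, ← rootInf_mul_nilInf, MvPowerSeries.map_C, hr] at h
  exact h

theorem FirstParams.nilRho {M k : ℕ} (hk : k ≤ M) {f : MvPowerSeries ℕ Ca}
    (hf : FirstParams M f) : FirstParams M (nilRho k f) := by
  induction k with
  | zero => exact hf
  | succ k ih => exact (ih (by omega)).nilInf (by omega)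

theorem firstParams_nilSeries {M : ℕ} (m : List ℕ) (h : ∀ p ∈ m, p ≤ M) :
    FirstParams M (nilSeries m) := by
  induction m with
  | nil => exact map_one _
  | cons k m ih =>
    have h' := List.forall_mem_cons.mp h
    exact (ih h'.2).nilRho h'.1

/-- On the periodic sequence s_i moves entries in every period, whereas one or two reflections over
ℂ[a] move them in the first period only; this is enough for series in the first 2n parameters. -/
theorem FirstParams.map_eq {M : ℕ} {f : MvPowerSeries ℕ Ca} (hf : FirstParams M f) {R : Type*}
    [CommRing R] [Algebra ℂ R] (φ ψ : Ca →ₐ[ℂ] R)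
    (h : ∀ j < M, φ (MvPolynomial.X j) = ψ (MvPolynomial.X j)) :
    MvPowerSeries.map φ.toRingHom f = MvPowerSeries.map ψ.toRingHom f := by
  have hc : φ.comp (truncParam M) = ψ.comp (truncParam M) := by
    apply MvPolynomial.algHom_ext
    intro j
    rw [AlgHom.comp_apply, AlgHom.comp_apply, truncParam_X]
    split_ifs with hj
    · exact h j hj
    · rw [map_zero, map_zero]
  rw [← hf]
  ext β : 1
  simp only [MvPowerSeries.coeff_map]
  exact DFunLike.congr_fun hc _

/-! ### Periodic parameters -/

/-- The substitution `a ↦ a^{(n)}`. -/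
def periodicHom (n : ℕ) : Ca →ₐ[ℂ] S n := MvPolynomial.aeval (aPeriodic n)

theorem periodicHom_X (n j : ℕ) : periodicHom n (MvPolynomial.X j) = aPeriodic n j :=
  MvPolynomial.aeval_X _ _

theorem specialize_eq (n : ℕ) (f : MvPowerSeries ℕ Ca) :
    specialize n f = MvPowerSeries.map (periodicHom n).toRingHom f := rfl

theorem aPeriodic_of_lt {n j : ℕ} (hj : j < n) : aPeriodic n j = aVar n j := by
  rw [aPeriodic, Nat.mod_eq_of_lt (by omega), if_pos hj]

theorem aPeriodic_of_ge {n j : ℕ} (hj : n ≤ j) (hj' : j < 2 * n) :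
    aPeriodic n j = -aVar n (2 * n - 1 - j) := by
  rw [aPeriodic, Nat.mod_eq_of_lt hj', if_neg (by omega)]

theorem simpleRoot_ne_zero {n : ℕ} (hn : 1 ≤ n) (i : Fin (n + 1)) : simpleRoot n i ≠ 0 := by
  have hX : ∀ k, k < n → aVar n k ≠ 0 := fun k hk => by
    rw [aVar, dif_pos hk]
    exact MvPolynomial.X_ne_zero _
  rw [simpleRoot]
  split_ifs with h0 h1
  · exact mul_ne_zero (by norm_num) (hX 0 hn)
  · exact mul_ne_zero (by norm_num) (hX _ (by omega))
  · have hi := i.isLt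
    rw [aVar, aVar, dif_pos (by omega), dif_pos (by omega), sub_ne_zero]
    intro h
    have := congrArg Fin.val (MvPolynomial.X_injective h)
    simp only at this
    omega

theorem nilHecke_eq {n : ℕ} (hn : 1 ≤ n) (i : Fin (n + 1)) {f g : MvPowerSeries ℕ (S n)}
    (h : MvPowerSeries.C (simpleRoot n i) * g = f - reflSeries n i f) : nilHecke n i f = g :=
  mul_left_cancel₀ (C_ne_zero (simpleRoot_ne_zero hn i)) ((simpleRoot_mul_nilHecke n i f).trans h.symm)

theorem reflS_aVar (n : ℕ) (i : Fin (n + 1)) (k : ℕ) (hk : k < n) :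
    reflS n i (aVar n k) =
      (coordSign n i ⟨k, hk⟩ : S n) * MvPolynomial.X (coordPerm n i ⟨k, hk⟩) := by
  rw [aVar, dif_pos hk, reflS, MvPolynomial.aeval_X]

theorem coordPerm_val (n : ℕ) (i : Fin (n + 1)) (k : Fin n) (h : 1 ≤ i.val ∧ i.val < n) :
    (coordPerm n i k).val = Equiv.swap (i.val - 1) i.val k.val := by
  rw [coordPerm, dif_pos h, Equiv.swap_apply_def, Equiv.swap_apply_def]
  simp only [Fin.ext_iff]
  split_ifs <;> rfl

theorem reflS_aVar_mid (n : ℕ) (i : Fin (n + 1)) (h : 1 ≤ i.val ∧ i.val < n) (k : ℕ) (hk : k < n) :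
    reflS n i (aVar n k) = aVar n (Equiv.swap (i.val - 1) i.val k) := by
  rw [reflS_aVar n i k hk]
  have h1 := coordPerm_val n i ⟨k, hk⟩ h
  simp only at h1
  rw [← h1, aVar, dif_pos (Fin.isLt _), coordSign, if_neg (by omega)]
  simp

theorem reflS_aVar_zero (n : ℕ) (hn : 1 ≤ n) (k : ℕ) (hk : k < n) :
    reflS n 0 (aVar n k) = if k = 0 then -aVar n 0 else aVar n k := by
  rw [reflS_aVar n 0 k hk]
  have hp : coordPerm n 0 = 1 := by rw [coordPerm, dif_neg (by simp)]
  have h0 : ¬ (0 : ℕ) = n := by omega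
  rw [hp, coordSign]
  by_cases hk0 : k = 0
  · subst hk0
    simp [aVar, hk]
  · simp [aVar, hk, hk0, h0]

theorem reflS_aVar_last (n : ℕ) (hn : 1 ≤ n) (k : ℕ) (hk : k < n) :
    reflS n (Fin.last n) (aVar n k) = if k + 1 = n then -aVar n k else aVar n k := by
  rw [reflS_aVar n _ k hk]
  have hp : coordPerm n (Fin.last n) = 1 := by rw [coordPerm, dif_neg (by simp)]
  have h0 : ¬ n = 0 := by omega
  rw [hp, coordSign]
  by_cases hk0 : k + 1 = n
  · simp [aVar, hk, hk0, h0]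
  · simp [aVar, hk, hk0, h0]

theorem map_reflS_specialize (n : ℕ) (i : Fin (n + 1)) (f : MvPowerSeries ℕ Ca) :
    MvPowerSeries.map (reflS n i).toRingHom (specialize n f) =
      MvPowerSeries.map ((reflS n i).comp (periodicHom n)).toRingHom f := by
  ext β : 1
  simp only [specialize_eq, MvPowerSeries.coeff_map]
  rfl

theorem specialize_coeffRefl (n i : ℕ) (f : MvPowerSeries ℕ Ca) :
    specialize n (coeffRefl i f) =
      MvPowerSeries.map ((periodicHom n).comp (reflCa i)).toRingHom f := by
  ext β : 1
  simp only [specialize_eq, coeffRefl, MvPowerSeries.coeff_map]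
  rfl

theorem specialize_C (n : ℕ) (c : Ca) :
    specialize n (MvPowerSeries.C c) = MvPowerSeries.C (periodicHom n c) :=
  MvPowerSeries.map_C _ _

/-- The parameter a_{2n} must be absent: it specializes to -a_1, which s_0 negates, while the
reflection over ℂ[a] fixes a_{2n}. -/
theorem nilHecke_zero_specialize {n : ℕ} (hn : 1 ≤ n) {f : MvPowerSeries ℕ Ca}
    (hf : FirstParams (2 * n - 1) f) : nilHecke n 0 (specialize n f) = specialize n (nilInf 0 f) := by
  apply nilHecke_eq hn
  have hr : simpleRoot n 0 = periodicHom n (rootInf 0) := by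
    rw [rootInf, map_neg, map_add, periodicHom_X, aPeriodic_of_lt (by omega), simpleRoot,
      if_pos (by simp)]
    ring
  rw [hr, ← specialize_C, ← map_mul, rootInf_mul_nilInf, map_sub, reflSeries, if_pos (by simp),
    map_reflS_specialize, reflInf, map_mul, specialize_coeffRefl, twist, if_pos rfl,
    specialize_eq n (Omega _), map_Omega]
  have hX : (periodicHom n).toRingHom (MvPolynomial.X 0) = aVar n 0 :=
    (periodicHom_X n 0).trans (aPeriodic_of_lt (by omega))
  rw [hX]
  congr 2
  refine hf.map_eq _ _ fun j hj => ?_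
  rw [AlgHom.comp_apply, AlgHom.comp_apply, periodicHom_X, reflCa_X, reflVar]
  by_cases hjn : j < n
  · rw [aPeriodic_of_lt hjn, reflS_aVar_zero n hn j hjn]
    split_ifs with h0
    · rw [map_neg, periodicHom_X, aPeriodic_of_lt (by omega)]
    · rw [periodicHom_X, aPeriodic_of_lt hjn]
  · rw [if_neg (by omega), aPeriodic_of_ge (by omega) (by omega), map_neg,
      reflS_aVar_zero n hn _ (by omega), if_neg (by omega), periodicHom_X,
      aPeriodic_of_ge (by omega) (by omega)]

/-- As a_n and a_{n+1} specialize to a_n and -a_n, their exchange becomes the sign change and their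
difference becomes 2 a_n. -/
theorem nilHecke_last_specialize {n : ℕ} (hn : 1 ≤ n) {f : MvPowerSeries ℕ Ca}
    (hf : FirstParams (2 * n) f) :
    nilHecke n (Fin.last n) (specialize n f) = specialize n (nilInf n f) := by
  obtain ⟨n, rfl⟩ : ∃ n', n = n' + 1 := ⟨n - 1, by omega⟩
  apply nilHecke_eq hn
  have hr : simpleRoot (n + 1) (Fin.last (n + 1)) = periodicHom (n + 1) (rootInf (n + 1)) := by
    rw [rootInf, map_sub, periodicHom_X, periodicHom_X, aPeriodic_of_lt (by omega),
      aPeriodic_of_ge (by omega) (by omega), simpleRoot, if_neg (by simp), if_pos (by simp),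
      show 2 * (n + 1) - 1 - (n + 1) = n by omega, Nat.add_sub_cancel]
    ring
  rw [hr, ← specialize_C, ← map_mul, rootInf_mul_nilInf, map_sub, reflSeries, if_neg (by simp),
    map_reflS_specialize, reflInf_succ, specialize_coeffRefl, one_mul]
  congr 1
  refine hf.map_eq _ _ fun j hj => ?_
  rw [AlgHom.comp_apply, AlgHom.comp_apply, periodicHom_X, reflCa_X, reflVar, periodicHom_X,
    Equiv.swap_apply_def]
  by_cases hjn : j < n + 1
  · rw [aPeriodic_of_lt hjn, reflS_aVar_last _ hn j hjn]
    by_cases h0 : j = n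
    · rw [if_pos (show j + 1 = n + 1 by omega), if_pos h0, aPeriodic_of_ge (by omega) (by omega), h0,
        show 2 * (n + 1) - 1 - (n + 1) = n by omega]
    · rw [if_neg (show ¬ j + 1 = n + 1 by omega), if_neg h0, if_neg (by omega), aPeriodic_of_lt hjn]
  · rw [aPeriodic_of_ge (j := j) (by omega) (by omega), map_neg,
      reflS_aVar_last _ hn _ (by omega), if_neg (by omega : ¬ j = n)]
    by_cases h0 : j = n + 1
    · rw [if_pos (show 2 * (n + 1) - 1 - j + 1 = n + 1 by omega), if_pos h0, aPeriodic_of_lt (by omega), h0,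
        show 2 * (n + 1) - 1 - (n + 1) = n by omega, neg_neg]
    · rw [if_neg (show ¬ 2 * (n + 1) - 1 - j + 1 = n + 1 by omega), if_neg h0, aPeriodic_of_ge (by omega) (by omega)]

/-- On the first period s_i acts as s_i s_{2n-i}, and both roots specialize to a_i - a_{i+1}. The
formula is f - s_i s_{2n-i} f = (f - s_i f) + s_i (f - s_{2n-i} f), divided by this root. -/
theorem nilHecke_mid_specialize {n : ℕ} (i : Fin (n + 1)) (hi : 1 ≤ i.val) (hi' : i.val < n)
    {f : MvPowerSeries ℕ Ca} (hf : FirstParams (2 * n) f) :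
    nilHecke n i (specialize n f) =
      specialize n (nilInf i.val f + coeffRefl i.val (nilInf (2 * n - i.val) f)) := by
  apply nilHecke_eq (by omega)
  obtain ⟨k, hk⟩ : ∃ k, i.val = k + 1 := ⟨i.val - 1, by omega⟩
  obtain ⟨j, hj⟩ : ∃ j, 2 * n - i.val = j + 1 := ⟨2 * n - i.val - 1, by omega⟩
  have hr : simpleRoot n i = aVar n k - aVar n (k + 1) := by
    rw [simpleRoot, if_neg (by omega), if_neg (by omega), hk, Nat.add_sub_cancel]
  have hr1 : periodicHom n (rootInf (k + 1)) = simpleRoot n i := by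
    rw [hr, rootInf, map_sub, periodicHom_X, periodicHom_X, aPeriodic_of_lt (by omega),
      aPeriodic_of_lt (by omega)]
  have hr2 : periodicHom n (rootInf (j + 1)) = simpleRoot n i := by
    rw [hr, rootInf, map_sub, periodicHom_X, periodicHom_X, aPeriodic_of_ge (by omega) (by omega),
      aPeriodic_of_ge (by omega) (by omega), show 2 * n - 1 - j = k + 1 by omega,
      show 2 * n - 1 - (j + 1) = k by omega]
    ring
  have hsum : f - coeffRefl (k + 1) (coeffRefl (j + 1) f) =
      MvPowerSeries.C (rootInf (k + 1)) * nilInf (k + 1) f +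
        MvPowerSeries.C (rootInf (j + 1)) * coeffRefl (k + 1) (nilInf (j + 1) f) := by
    have h1 := rootInf_mul_nilInf (k + 1) f
    have h2 := congrArg (coeffRefl (k + 1)) (rootInf_mul_nilInf (j + 1) f)
    rw [map_mul, map_sub, coeffRefl_C, (reflCa_rootInf_of_lt (by omega)).1, reflInf_succ] at h2
    rw [h1, h2, reflInf_succ]
    ring
  have hcomp : MvPowerSeries.map ((reflS n i).comp (periodicHom n)).toRingHom f =
      specialize n (coeffRefl (k + 1) (coeffRefl (j + 1) f)) := by
    have h1 : specialize n (coeffRefl (k + 1) (coeffRefl (j + 1) f)) = MvPowerSeries.map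
        (((periodicHom n).comp (reflCa (k + 1))).comp (reflCa (j + 1))).toRingHom f := by
      ext β : 1
      simp only [specialize_eq, coeffRefl, MvPowerSeries.coeff_map]
      rfl
    rw [h1]
    refine hf.map_eq _ _ fun l hl => ?_
    rw [AlgHom.comp_apply, AlgHom.comp_apply, AlgHom.comp_apply, periodicHom_X, reflCa_X, reflVar,
      reflCa_X, reflVar, periodicHom_X]
    by_cases hln : l < n
    · rw [aPeriodic_of_lt hln, reflS_aVar_mid n i ⟨hi, hi'⟩ l hln,
        Equiv.swap_apply_of_ne_of_ne (a := j) (by omega) (by omega), hk, Nat.add_sub_cancel,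
        aPeriodic_of_lt]
      rw [Equiv.swap_apply_def]
      split_ifs <;> omega
    · rw [aPeriodic_of_ge (by omega) hl, map_neg, reflS_aVar_mid n i ⟨hi, hi'⟩ _ (by omega)]
      have h2 : n ≤ Equiv.swap j (j + 1) l ∧ Equiv.swap j (j + 1) l < 2 * n := by
        rw [Equiv.swap_apply_def]
        split_ifs <;> omega
      rw [Equiv.swap_apply_of_ne_of_ne (a := k) (by omega) (by omega), aPeriodic_of_ge h2.1 h2.2]
      congr 2
      rw [Equiv.swap_apply_def, Equiv.swap_apply_def]
      split_ifs <;> omega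
  rw [reflSeries, if_neg (by omega), one_mul, map_reflS_specialize, hcomp, ← map_sub, hsum, hj, hk,
    map_add, map_add, map_mul, map_mul, specialize_C, specialize_C, hr1, hr2]
  ring

/-! ### The affine Weyl group in coordinates -/

/-- The coordinates of a lattice point, extended by zero. -/
def coord {n : ℕ} (x : Fin n → ℤ) (q : ℕ) : ℤ := if h : q < n then x ⟨q, h⟩ else 0

theorem coord_ext {n : ℕ} {x y : Fin n → ℤ} (h : ∀ q < n, coord x q = coord y q) : x = y := by
  funext k
  have := h k.val k.isLt
  simpa [coord] using this

theorem coord_zero {n : ℕ} (q : ℕ) : coord (0 : Fin n → ℤ) q = 0 := by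
  simp [coord]

theorem gen_apply (n : ℕ) (i : Fin (n + 1)) (x : Fin n → ℤ) :
    (gen n i).val x = simpleReflFun n i x := rfl

theorem coord_gen_zero {n : ℕ} (hn : 1 ≤ n) (x : Fin n → ℤ) {q : ℕ} (hq : q < n) :
    coord ((gen n 0).val x) q = if q = 0 then 1 - coord x q else coord x q := by
  have h0 : ¬ (0 : ℕ) = n := by omega
  simp only [coord, hq, dif_pos, gen_apply, simpleReflFun, coordSign, coordPerm]
  by_cases h : q = 0
  · simp [h]
    ring
  · simp [h, h0]

theorem coord_gen_last {n : ℕ} (hn : 1 ≤ n) (x : Fin n → ℤ) {q : ℕ} (hq : q < n) :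
    coord ((gen n (Fin.last n)).val x) q = if q + 1 = n then -coord x q else coord x q := by
  have h0 : ¬ n = 0 := by omega
  simp only [coord, hq, dif_pos, gen_apply, simpleReflFun, coordSign, coordPerm]
  by_cases h : q + 1 = n
  · simp [h, h0]
  · simp [h, h0]

theorem coord_gen_mid {n : ℕ} (i : Fin (n + 1)) (h1 : 1 ≤ i.val) (h2 : i.val < n)
    (x : Fin n → ℤ) {q : ℕ} (hq : q < n) :
    coord ((gen n i).val x) q = coord x (Equiv.swap (i.val - 1) i.val q) := by
  have h := coordPerm_val n i ⟨q, hq⟩ ⟨h1, h2⟩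
  simp only at h
  rw [← h]
  have h3 : ¬ i.val = 0 := by omega
  have h4 : ¬ i.val = n := by omega
  simp [coord, hq, gen_apply, simpleReflFun, coordSign, h3, h4]

theorem mul_apply {n : ℕ} (u v : affineWeyl n) (x : Fin n → ℤ) :
    (u * v).val x = u.val (v.val x) := rfl

theorem eq_of_coord {n : ℕ} {u v : affineWeyl n}
    (h : ∀ x, ∀ q < n, coord (u.val x) q = coord (v.val x) q) : u = v :=
  Subtype.ext (Equiv.ext fun x => coord_ext (h x))

theorem gen_mul_self (n : ℕ) (i : Fin (n + 1)) : gen n i * gen n i = 1 :=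
  Subtype.ext (Equiv.ext fun x => simpleReflFun_involutive n i x)

theorem gen_comm {n : ℕ} {i j : Fin (n + 1)} (h : i.val + 2 ≤ j.val) :
    gen n i * gen n j = gen n j * gen n i := by
  have hj := j.isLt
  have hn : 1 ≤ n := by omega
  apply eq_of_coord
  intro x q hq
  rw [mul_apply, mul_apply]
  have hs : ∀ (a b : ℕ), a < n → b < n → Equiv.swap a b q < n := fun a b ha hb => by
    rw [Equiv.swap_apply_def]
    split_ifs <;> omega
  by_cases hi0 : i.val = 0
  · obtain rfl : i = 0 := Fin.ext hi0
    by_cases hjn : j.val = n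
    · obtain rfl : j = Fin.last n := Fin.ext hjn
      rw [Fin.val_zero, Fin.val_last] at h
      rw [coord_gen_zero hn _ hq, coord_gen_last hn _ hq, coord_gen_last hn _ hq,
        coord_gen_zero hn _ hq]
      split_ifs <;> omega
    · rw [Fin.val_zero] at h
      rw [coord_gen_zero hn _ hq, coord_gen_mid j (by omega) (by omega) _ hq,
        coord_gen_mid j (by omega) (by omega) _ hq,
        coord_gen_zero hn _ (hs _ _ (by omega) (by omega)), Equiv.swap_apply_def]
      split_ifs <;> omega
  · by_cases hjn : j.val = n
    · obtain rfl : j = Fin.last n := Fin.ext hjn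
      rw [Fin.val_last] at h
      rw [coord_gen_last hn _ hq, coord_gen_mid i (by omega) (by omega) _ hq,
        coord_gen_mid i (by omega) (by omega) _ hq,
        coord_gen_last hn _ (hs _ _ (by omega) (by omega)), Equiv.swap_apply_def]
      split_ifs <;> omega
    · rw [coord_gen_mid i (by omega) (by omega) _ hq, coord_gen_mid j (by omega) (by omega) _ hq,
        coord_gen_mid i (by omega) (by omega) _ (hs _ _ (by omega) (by omega)),
        coord_gen_mid j (by omega) (by omega) _ (hs _ _ (by omega) (by omega))]
      congr 1
      simp only [Equiv.swap_apply_def]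
      split_ifs <;> omega

theorem rho_zero (n : ℕ) : rho n 0 = 1 := rfl

theorem rho_succ (n k : ℕ) : rho n (k + 1) = gen n (residue n k) * rho n k := by
  rw [rho, List.range_succ, List.reverse_append, List.map_append, wordProd, List.map_append,
    List.prod_append]
  simp [rho, wordProd]

theorem residue_val_of_le {n j : ℕ} (h : j ≤ n) : (residue n j).val = j := if_pos h

theorem residue_val_of_gt {n j : ℕ} (h : n < j) : (residue n j).val = 2 * n - j :=
  if_neg (by omega)

theorem gen_mul_rho {n k : ℕ} {i : Fin (n + 1)} (h : k < i.val) :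
    gen n i * rho n k = rho n k * gen n i := by
  have hi := i.isLt
  induction k with
  | zero => simp [rho_zero]
  | succ k ih =>
    have hr : (residue n k).val = k := residue_val_of_le (by omega)
    rw [rho_succ, ← mul_assoc, ← gen_comm (by omega), mul_assoc, ih (by omega), mul_assoc]

theorem coord_rho_of_le {n k : ℕ} (hk : k ≤ n) (x : Fin n → ℤ) {q : ℕ} (hq : q < n) :
    coord ((rho n k).val x) q =
      if q + 1 < k then coord x (q + 1) else if q + 1 = k then 1 - coord x 0 else coord x q := by
  have hn : 1 ≤ n := by omega
  induction k generalizing q with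
  | zero => rfl
  | succ k ih =>
    rw [rho_succ, mul_apply]
    by_cases hk0 : k = 0
    · subst hk0
      have : residue n 0 = 0 := Fin.ext (residue_val_of_le (by omega))
      rw [this, coord_gen_zero hn _ hq, rho_zero]
      split_ifs with h1 h2 <;> first | omega | rfl | (subst h1; rfl)
    · have hr : (residue n k).val = k := residue_val_of_le (by omega)
      rw [coord_gen_mid _ (by omega) (by omega) _ hq, hr]
      have hs : Equiv.swap (k - 1) k q < n := by
        rw [Equiv.swap_apply_def]
        split_ifs <;> omega
      rw [ih (by omega) hs, Equiv.swap_apply_def]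
      split_ifs <;> first | omega | rfl | (congr 1; omega)

/-- The letter s_n turns the entry 1 - x_1 into x_1 - 1, and the further letters carry it back to
the left. -/
theorem coord_rho_of_gt {n k : ℕ} (hk : n < k) (hk2 : k ≤ 2 * n) (x : Fin n → ℤ) {q : ℕ}
    (hq : q < n) :
    coord ((rho n k).val x) q =
      if q + k < 2 * n then coord x (q + 1)
      else if q + k = 2 * n then coord x 0 - 1 else coord x q := by
  have hn : 1 ≤ n := by omega
  induction k, hk using Nat.le_induction generalizing q with
  | base =>
    have hr : residue n n = Fin.last n := Fin.ext (residue_val_of_le le_rfl)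
    rw [rho_succ, mul_apply, hr, coord_gen_last hn _ hq, coord_rho_of_le le_rfl _ hq]
    split_ifs <;> omega
  | succ k hk ih =>
    have hr : (residue n k).val = 2 * n - k := residue_val_of_gt (by omega)
    rw [rho_succ, mul_apply, coord_gen_mid _ (by omega) (by omega) _ hq, hr]
    have hs : Equiv.swap (2 * n - k - 1) (2 * n - k) q < n := by
      rw [Equiv.swap_apply_def]
      split_ifs <;> omega
    rw [ih (by omega) hs, Equiv.swap_apply_def]
    split_ifs <;> first | omega | rfl | (congr 1; omega)

/-- The product `ρ_{m_1} ρ_{m_2} ⋯`. -/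
def rhoProd (n : ℕ) (m : List ℕ) : affineWeyl n := (m.map (rho n)).prod

theorem rhoProd_cons (n k : ℕ) (m : List ℕ) : rhoProd n (k :: m) = rho n k * rhoProd n m := by
  simp [rhoProd]

/-- The bound on the sum keeps the rows from interfering. If the first part p is at most n, the
other parts r satisfy p < r ≤ 2n - p, so they leave the first p coordinates zero, and ρ_p only makes
the p-th equal to 1. If p > n, there is no other row. -/
theorem coord_rhoProd {n : ℕ} (m : List ℕ) (hm : m.Pairwise (· < ·)) (hpos : ∀ p ∈ m, 0 < p)
    (hsum : m.sum ≤ 2 * n) {q : ℕ} (hq : q < n) :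
    coord ((rhoProd n m).val 0) q =
      (if q + 1 ∈ m then 1 else 0) - if 2 * n - q ∈ m then 1 else 0 := by
  induction m generalizing q with
  | nil => exact coord_zero q
  | cons p m ih =>
    have hm' := List.pairwise_cons.mp hm
    have hpos' := List.forall_mem_cons.mp hpos
    rw [List.sum_cons] at hsum
    have hbound : ∀ r ∈ m, p < r ∧ p + r ≤ 2 * n := fun r hr =>
      ⟨hm'.1 r hr, by have := List.le_sum_of_mem hr; omega⟩
    have ih' := fun {q : ℕ} (hq : q < n) => ih hm'.2 hpos'.2 (by omega) hq
    rw [rhoProd_cons, mul_apply]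
    have hmem : ∀ r, r ≤ p ∨ 2 * n < p + r → r ∉ m := fun r hr hr' => by
      have := hbound r hr'
      omega
    rcases le_or_gt p n with hpn | hpn
    · rw [coord_rho_of_le hpn _ hq]
      rcases lt_trichotomy (q + 1) p with h | h | h
      · rw [if_pos h, ih' (by omega), if_neg (hmem _ (by omega)), if_neg (hmem _ (by omega)),
          if_neg, if_neg]
        · rw [List.mem_cons, not_or]
          exact ⟨by omega, hmem _ (by omega)⟩
        · rw [List.mem_cons, not_or]
          exact ⟨by omega, hmem _ (by omega)⟩
      · rw [if_neg (by omega), if_pos h, ih' (by omega), if_neg (hmem _ (by omega)),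
          if_neg (hmem _ (by omega)), if_pos (by simp [h]), if_neg]
        · rfl
        · rw [List.mem_cons, not_or]
          exact ⟨by omega, hmem _ (by omega)⟩
      · rw [if_neg (by omega), if_neg (by omega), ih' hq]
        have h1 : ¬ q + 1 = p := by omega
        have h2 : ¬ 2 * n - q = p := by omega
        simp only [List.mem_cons, h1, h2, false_or]
    · have hmnil : m = [] := List.eq_nil_iff_forall_not_mem.mpr fun r hr => by
        have := hbound r hr
        omega
      subst hmnil
      have h1 : ¬ q + 1 = p := by omega
      have h0 : ∀ r, coord ((rhoProd n []).val 0) r = 0 := fun r => coord_zero r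
      rw [coord_rho_of_gt hpn (by omega) _ hq, h0, h0, h0]
      simp only [List.mem_singleton, h1, if_false]
      split_ifs <;> omega

/-! ### The stabilizer of the origin -/

theorem exists_neg_coord_mem_finiteWeyl {n : ℕ} (k : ℕ) (hk : k < n) :
    ∃ θ ∈ finiteWeyl n, ∀ x, ∀ q < n,
      coord (θ.val x) q = if q = k then -coord x q else coord x q := by
  obtain ⟨d, hd⟩ : ∃ d, d + k + 1 = n := ⟨n - k - 1, by omega⟩
  induction d generalizing k with
  | zero =>
    refine ⟨gen n (Fin.last n), Subgroup.subset_closure ⟨_, ?_, rfl⟩, fun x q hq => ?_⟩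
    · rw [Fin.val_last]
      omega
    · rw [coord_gen_last (by omega) _ hq]
      split_ifs <;> omega
  | succ d ih =>
    obtain ⟨θ, hθ, hx⟩ := ih (k + 1) (by omega) (by omega)
    set i : Fin (n + 1) := ⟨k + 1, by omega⟩ with hi
    have hs : gen n i ∈ finiteWeyl n := Subgroup.subset_closure ⟨i, by simp [hi], rfl⟩
    refine ⟨gen n i * θ * gen n i, mul_mem (mul_mem hs hθ) hs, fun x q hq => ?_⟩
    have hq' : Equiv.swap k (k + 1) q < n := by
      rw [Equiv.swap_apply_def]
      split_ifs <;> omega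
    have e : ∀ x, ∀ q < n, coord ((gen n i).val x) q = coord x (Equiv.swap k (k + 1) q) :=
      fun x q hq => coord_gen_mid i (by simp [hi]) (by simp [hi]; omega) x hq
    rw [mul_apply, mul_apply, e _ _ hq, hx _ _ hq', e _ _ hq', Equiv.swap_apply_self]
    have : Equiv.swap k (k + 1) q = k + 1 ↔ q = k := by
      rw [Equiv.swap_apply_def]
      split_ifs <;> omega
    simp only [this]

theorem finiteWeyl_apply_add {n : ℕ} (u : affineWeyl n) (hu : u ∈ finiteWeyl n) (x y : Fin n → ℤ) :
    u.val (x + y) = u.val x + u.val y := by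
  revert x y
  refine Subgroup.closure_induction (p := fun u _ => ∀ x y : Fin n → ℤ,
    u.val (x + y) = u.val x + u.val y) ?_ ?_ ?_ ?_ hu
  · rintro _ ⟨i, hi, rfl⟩ x y
    funext k
    simp only [gen_apply, simpleReflFun, hi, false_and, if_false, add_zero, Pi.add_apply]
    ring
  · intro x y
    rfl
  · intro u v _ _ hu hv x y
    rw [mul_apply, hv, hu]
    rfl
  · intro u _ hu x y
    have h : ∀ z, u.val ((u⁻¹).val z) = z := fun z => Equiv.apply_symm_apply u.val z
    apply u.val.injective
    rw [h, hu, h, h]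

/-- The generator s_0 is the sign change of the first coordinate, which lies in W, followed by a
translation; W acts additively. Hence the stabilizer of the origin is contained in W. -/
theorem exists_finiteWeyl_add {n : ℕ} (hn : 1 ≤ n) (g : affineWeyl n) :
    ∃ u ∈ finiteWeyl n, ∃ t : Fin n → ℤ, ∀ x, g.val x = u.val x + t := by
  obtain ⟨ω, rfl⟩ := exists_word n g
  induction ω with
  | nil => exact ⟨1, one_mem _, 0, fun x => (add_zero x).symm⟩
  | cons i ω ih =>
    obtain ⟨u, hu, t, hut⟩ := ih
    have hw : wordProd n (i :: ω) = gen n i * wordProd n ω := by simp [wordProd]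
    by_cases hi : i.val = 0
    · obtain rfl : i = 0 := Fin.ext hi
      obtain ⟨θ, hθ, hx⟩ := exists_neg_coord_mem_finiteWeyl (n := n) 0 hn
      set e : Fin n → ℤ := fun k => if k.val = 0 then 1 else 0 with he
      have h0 : ∀ x, (gen n 0).val x = θ.val x + e := by
        intro x
        apply coord_ext
        intro q hq
        have : coord (θ.val x + e) q = coord (θ.val x) q + if q = 0 then 1 else 0 := by
          simp [coord, hq, he]
        rw [this, coord_gen_zero hn _ hq, hx _ _ hq]
        split_ifs <;> ring
      refine ⟨θ * u, mul_mem hθ hu, θ.val t + e, fun x => ?_⟩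
      rw [hw, mul_apply, hut, h0, finiteWeyl_apply_add θ hθ, add_assoc]
      rfl
    · have hs : gen n i ∈ finiteWeyl n := Subgroup.subset_closure ⟨i, hi, rfl⟩
      refine ⟨gen n i * u, mul_mem hs hu, (gen n i).val t, fun x => ?_⟩
      rw [hw, mul_apply, hut, finiteWeyl_apply_add _ hs]
      rfl

theorem mem_finiteWeyl_of_apply_zero {n : ℕ} (hn : 1 ≤ n) (g : affineWeyl n)
    (hg : g.val 0 = 0) : g ∈ finiteWeyl n := by
  obtain ⟨u, hu, t, hut⟩ := exists_finiteWeyl_add hn g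
  have hu0 : u.val 0 = 0 := by
    have := finiteWeyl_apply_add u hu 0 0
    rw [add_zero] at this
    exact left_eq_add.mp this
  have ht : t = 0 := by
    rw [hut, hu0, zero_add] at hg
    exact hg
  have : g = u := Subtype.ext (Equiv.ext fun x => by rw [hut, ht, add_zero])
  rwa [this]

/-! ### Length -/

theorem len_wordProd_le (n : ℕ) (ω : List (Fin (n + 1))) : len n (wordProd n ω) ≤ ω.length :=
  Nat.sInf_le ⟨ω, rfl, rfl⟩

theorem len_mul_le {n : ℕ} (u v : affineWeyl n) : len n (u * v) ≤ len n u + len n v := by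
  obtain ⟨ω, h1, h2⟩ := exists_reducedWord n u
  obtain ⟨ω', h1', h2'⟩ := exists_reducedWord n v
  have h := len_wordProd_le n (ω ++ ω')
  rw [List.length_append, h2, h2', wordProd, List.map_append, List.prod_append, ← wordProd,
    ← wordProd, h1, h1'] at h
  exact h

theorem len_gen_mul_le {n : ℕ} (i : Fin (n + 1)) (v : affineWeyl n) :
    len n (gen n i * v) ≤ len n v + 1 := by
  have h1 : len n (gen n i) ≤ 1 := by simpa [wordProd] using len_wordProd_le n [i]
  have := len_mul_le (gen n i) v
  omega

theorem len_rhoProd_le (n : ℕ) (m : List ℕ) : len n (rhoProd n m) ≤ m.sum := by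
  induction m with
  | nil => exact len_wordProd_le n []
  | cons k m ih =>
    have h1 : len n (rho n k) ≤ k :=
      (len_wordProd_le n ((List.range k).reverse.map (residue n))).trans (by simp)
    have h2 := len_mul_le (rho n k) (rhoProd n m)
    rw [rhoProd_cons, List.sum_cons]
    omega

/-- If s_i fixed the image of the origin, w would lie in the coset of s_i w and be shorter. -/
theorem not_fixed_of_isAffineGrassmannian {n : ℕ} (hn : 1 ≤ n) (i : Fin (n + 1))
    (w : affineWeyl n) (hw : IsAffineGrassmannian n (gen n i * w))
    (hl : len n (gen n i * w) = len n w + 1) : (gen n i).val (w.val 0) ≠ w.val 0 := by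
  intro h
  have hmem : (gen n i * w)⁻¹ * w ∈ finiteWeyl n := by
    apply mem_finiteWeyl_of_apply_zero hn
    rw [mul_apply, ← h]
    exact Equiv.symm_apply_apply (gen n i * w).val 0
  have := hw _ hmem
  rw [mul_inv_cancel_left] at this
  omega

/-! ### Words of affine Grassmannian elements of length at most `2 n` -/

theorem exists_append_of_mem {m : List ℕ} (hm : m.Pairwise (· < ·)) {k : ℕ} (hk : k ∈ m) :
    ∃ A B, m = A ++ k :: B ∧ (∀ a ∈ A, a < k) ∧ ∀ b ∈ B, k < b := by
  obtain ⟨A, B, rfl⟩ := List.mem_iff_append.mp hk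
  have h := List.pairwise_append.mp hm
  exact ⟨A, B, rfl, fun a ha => h.2.2 a ha k (by simp),
    fun b hb => (List.pairwise_cons.mp h.2.1).1 b hb⟩

theorem raise_append {A B : List ℕ} {j : ℕ} (hA : ∀ a ∈ A, a < j) (hB : ∀ b ∈ B, j < b) :
    raise j (A ++ j :: B) = A ++ (j + 1) :: B := by
  have h1 : raise j A = A := raise_eq_self fun h => lt_irrefl _ (hA _ h)
  have h2 : raise j B = B := raise_eq_self fun h => lt_irrefl _ (hB _ h)
  rw [raise] at h1 h2
  rw [raise, List.map_append, List.map_cons, if_pos rfl, h1, h2]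

theorem pairwise_append_cons_iff {A B : List ℕ} {j : ℕ} :
    (A ++ j :: B).Pairwise (· < ·) ↔ A.Pairwise (· < ·) ∧ B.Pairwise (· < ·) ∧
      (∀ a ∈ A, a < j) ∧ (∀ b ∈ B, j < b) ∧ ∀ a ∈ A, ∀ b ∈ B, a < b := by
  simp only [List.pairwise_append, List.pairwise_cons, List.mem_cons, forall_eq_or_imp]
  constructor
  · rintro ⟨h1, ⟨h2, h3⟩, h4⟩
    exact ⟨h1, h3, fun a ha => (h4 a ha).1, h2, fun a ha => (h4 a ha).2⟩
  · rintro ⟨h1, h2, h3, h4, h5⟩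
    exact ⟨h1, ⟨h4, h2⟩, fun a ha => ⟨h3 a ha, h5 a ha⟩⟩

/-- The letter passes the rows a before row j because a is below its index; for j > n the index is
2n - j, and a + j < 2n. -/
theorem gen_residue_mul_rhoProd {n j : ℕ} {A B : List ℕ} (hA : ∀ a ∈ A, a < j)
    (hsum : (A ++ j :: B).sum < 2 * n) :
    gen n (residue n j) * rhoProd n (A ++ j :: B) = rhoProd n (A ++ (j + 1) :: B) := by
  induction A with
  | nil => rw [List.nil_append, List.nil_append, rhoProd_cons, rhoProd_cons, rho_succ, mul_assoc]
  | cons a A ih =>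
    have hA' := List.forall_mem_cons.mp hA
    rw [List.cons_append, List.sum_cons] at hsum
    have hj : j ≤ (A ++ j :: B).sum := List.le_sum_of_mem (by simp)
    have ha : a < (residue n j).val := by
      rcases le_or_gt j n with h | h
      · rw [residue_val_of_le h]
        exact hA'.1
      · rw [residue_val_of_gt h]
        omega
    rw [List.cons_append, List.cons_append, rhoProd_cons, rhoProd_cons, ← mul_assoc,
      gen_mul_rho ha, mul_assoc, ih hA'.2 (by omega)]

theorem not_mem_of_sum_lt {m : List ℕ} {j k c : ℕ} (hjk : j ≠ k) (hj : j ∈ m) (hsum : m.sum < c)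
    (hc : c ≤ j + k) : k ∉ m := by
  intro hk
  have h1 := List.sum_erase hj
  have h2 := List.le_sum_of_mem ((List.mem_erase_of_ne hjk.symm).mpr hk)
  omega

/-- Let i be the residue of j. For i < n the specialized operator has two summands, for the rows i
and 2n - i. The row other than j is absent because the sum is below 2n, so its summand vanishes. -/
theorem nilHecke_specialize_nilSeries {n j : ℕ} {m : List ℕ} (hm : m.Pairwise (· < ·))
    (hsum : m.sum < 2 * n) (hj : 1 ≤ j) (hjm : j ∈ m) (hjm' : j + 1 ∉ m) :
    nilHecke n (residue n j) (specialize n (nilSeries m)) =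
      specialize n (nilSeries (raise j m)) := by
  have hle : ∀ p ∈ m, p ≤ 2 * n := fun p hp => by
    have := List.le_sum_of_mem hp
    omega
  have hf := firstParams_nilSeries m hle
  have hjn : j < 2 * n := (List.le_sum_of_mem hjm).trans_lt hsum
  have hraise : nilInf j (nilSeries m) = nilSeries (raise j m) := by
    obtain ⟨k, rfl⟩ : ∃ k, j = k + 1 := ⟨j - 1, by omega⟩
    rw [nilInf_succ_nilSeries k m hm, if_pos ⟨hjm, hjm'⟩]
  have hzero : ∀ k, 1 ≤ k → k ∉ m → nilInf k (nilSeries m) = 0 := by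
    intro k hk hkm
    obtain ⟨k, rfl⟩ : ∃ k', k = k' + 1 := ⟨k - 1, by omega⟩
    rw [nilInf_succ_nilSeries k m hm, if_neg fun h => hkm h.1]
  rcases lt_trichotomy j n with h | h | h
  · have hr : (residue n j).val = j := residue_val_of_le h.le
    rw [nilHecke_mid_specialize _ (by omega) (by omega) hf, hr, hraise,
      hzero _ (by omega) (not_mem_of_sum_lt (by omega) hjm hsum (by omega)), map_zero, add_zero]
  · have hr : residue n j = Fin.last n := Fin.ext (by rw [residue_val_of_le h.le, h, Fin.val_last])
    rw [hr, nilHecke_last_specialize (by omega) hf, ← h, hraise]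
  · have hr : (residue n j).val = 2 * n - j := residue_val_of_gt h
    have hnot : 2 * n - j ∉ m := not_mem_of_sum_lt (by omega) hjm hsum (by omega)
    rw [nilHecke_mid_specialize _ (by omega) (by omega) hf, hr, hzero _ (by omega) hnot,
      Nat.sub_sub_self hjn.le, hraise, zero_add]
    -- What is left is s_{2n-j} applied to the new series. It acts trivially, as the lengthened
    -- partition has no row of length 2n - j.
    congr 1
    obtain ⟨A, B, rfl, hA, hB⟩ := exists_append_of_mem hm hjm
    have hp : (raise j (A ++ j :: B)).Pairwise (· < ·) := by
      rw [raise_append hA hB]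
      rw [pairwise_append_cons_iff] at hm ⊢
      refine ⟨hm.1, hm.2.1, fun a ha => (hA a ha).trans (by omega), fun b hb => ?_, hm.2.2.2.2⟩
      have : b ≠ j + 1 := by
        rintro rfl
        exact hjm' (by simp [hb])
      have := hB b hb
      omega
    obtain ⟨k, hk⟩ : ∃ k, 2 * n - j = k + 1 := ⟨2 * n - j - 1, by omega⟩
    have e := coeffRefl_nilSeries k _ hp
    rw [if_neg, mul_zero, add_zero, ← hk] at e
    · exact e.symm
    · rintro ⟨h1, -⟩
      rw [raise_append hA hB, ← hk] at h1
      apply hnot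
      rw [List.mem_append, List.mem_cons] at h1 ⊢
      rcases h1 with h1 | h1 | h1
      · exact Or.inl h1
      · omega
      · exact Or.inr (Or.inr h1)

theorem residue_eq {n j : ℕ} {i : Fin (n + 1)} (h : j = i.val ∨ j = 2 * n - i.val) :
    residue n j = i := by
  have hi := i.isLt
  apply Fin.ext
  rcases le_or_gt j n with hj | hj
  · rw [residue_val_of_le hj]
    omega
  · rw [residue_val_of_gt hj]
    omega

/-- By `coord_rhoProd` the coordinates i and i + 1 depend only on the parts i, i + 1, 2n - i and 2n
- i + 1. The hypotheses make them equal, or make the last coordinate zero when i = n. -/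
theorem gen_apply_rhoProd_zero {n : ℕ} {i : Fin (n + 1)} (hi : i.val ≠ 0) {m : List ℕ}
    (hm : m.Pairwise (· < ·)) (hpos : ∀ p ∈ m, 0 < p) (hsum : m.sum ≤ 2 * n)
    (h1 : i.val ∈ m ↔ i.val + 1 ∈ m) (h2 : 2 * n - i.val ∉ m) (h3 : 2 * n - i.val + 1 ∉ m) :
    (gen n i).val ((rhoProd n m).val 0) = (rhoProd n m).val 0 := by
  have hin := i.isLt
  apply coord_ext
  intro q hq
  by_cases hl : i.val = n
  · obtain rfl : i = Fin.last n := Fin.ext hl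
    rw [coord_gen_last (by omega) _ hq]
    split_ifs with hqn
    · rw [coord_rhoProd m hm hpos hsum hq]
      rw [Fin.val_last] at h2 h3
      have e1 : q + 1 = 2 * n - n := by omega
      have e2 : 2 * n - q = 2 * n - n + 1 := by omega
      simp only [e1, e2, h2, h3, if_false, sub_self, neg_zero]
    · rfl
  · have hlt : i.val < n := by omega
    have hx : coord ((rhoProd n m).val 0) (i.val - 1) = coord ((rhoProd n m).val 0) i.val := by
      rw [coord_rhoProd m hm hpos hsum (by omega), coord_rhoProd m hm hpos hsum hlt]
      have e1 : i.val - 1 + 1 = i.val := by omega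
      have e2 : 2 * n - (i.val - 1) = 2 * n - i.val + 1 := by omega
      simp only [e1, e2, h1, h2, h3]
    rw [coord_gen_mid i (by omega) hlt _ hq, Equiv.swap_apply_def]
    split_ifs with ha hb
    · rw [ha, hx]
    · rw [hb, hx]
    · rfl

/-- Induction on the word, removing its first letter i. The letter can lengthen row i or 2n - i (or
create the row 1 if i = 0), in which case the operator does the same to the series. If it would
instead shorten a row, the word is not reduced; if it does neither, it fixes the image of the
origin, which `not_fixed_of_isAffineGrassmannian` forbids. -/
theorem exists_rhoProd_eq_wordProd {n : ℕ} (hn : 1 ≤ n) (ω : List (Fin (n + 1)))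
    (hred : ω.length = len n (wordProd n ω)) (hw : IsAffineGrassmannian n (wordProd n ω))
    (hl : ω.length ≤ 2 * n) :
    ∃ m : List ℕ, m.Pairwise (· < ·) ∧ (∀ p ∈ m, 0 < p) ∧ m.sum = ω.length ∧
      rhoProd n m = wordProd n ω ∧ ω.foldr (nilHecke n) 1 = specialize n (nilSeries m) := by
  induction ω with
  | nil => exact ⟨[], List.Pairwise.nil, by simp, rfl, rfl, (map_one (specialize n)).symm⟩
  | cons i ω ih =>
    have hcons : wordProd n (i :: ω) = gen n i * wordProd n ω := by simp [wordProd]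
    rw [hcons] at hred hw
    rw [List.length_cons] at hred hl
    have hl1 := len_wordProd_le n ω
    have hl2 := len_gen_mul_le i (wordProd n ω)
    -- The tail is minimal in its coset as well: one letter adds at most 1 to the length of any
    -- element of the coset, and exactly 1 to that of the tail.
    obtain ⟨m, hm, hpos, hsum, hprod, hfold⟩ := ih (by omega) (fun u hu => by
      have h1 := hw u hu
      have h2 := len_gen_mul_le i (wordProd n ω * u)
      rw [← mul_assoc] at h2
      omega) (by omega)
    rw [hcons, ← hprod, List.foldr_cons, hfold, List.length_cons]
    rw [← hprod] at hred hw hl1 hl2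
    -- A product of rows with at most as many boxes as the tail has letters is too short to equal
    -- the whole word.
    have hno : ∀ m' : List ℕ, m'.sum ≤ ω.length → gen n i * rhoProd n m ≠ rhoProd n m' := by
      intro m' hm' h
      have := len_rhoProd_le n m'
      rw [h] at hred
      omega
    by_cases hi : i.val = 0
    · obtain rfl : i = 0 := Fin.ext hi
      have h0 : residue n 0 = 0 := Fin.ext (residue_val_of_le (Nat.zero_le n))
      have hrho : rho n 1 = gen n 0 := by rw [rho_succ, rho_zero, mul_one, h0]
      by_cases h1 : 1 ∈ m
      · exfalso
        cases m with
        | nil => simp at h1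
        | cons p m =>
          have hp : p = 1 := by
            have hp0 := hpos p (by simp)
            rcases List.mem_cons.mp h1 with h | h
            · exact h.symm
            · have := (List.pairwise_cons.mp hm).1 1 h
              omega
          subst hp
          rw [List.sum_cons] at hsum
          refine hno m (by omega) ?_
          rw [rhoProd_cons, hrho, ← mul_assoc, gen_mul_self, one_mul]
      · refine ⟨1 :: m, List.pairwise_cons.mpr ⟨fun p hp => ?_, hm⟩,
          List.forall_mem_cons.mpr ⟨one_pos, hpos⟩, by rw [List.sum_cons, hsum, add_comm],
          by rw [rhoProd_cons, hrho], ?_⟩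
        · have := hpos p hp
          have : p ≠ 1 := by
            rintro rfl
            exact h1 hp
          omega
        · rw [nilHecke_zero_specialize hn (firstParams_nilSeries m fun p hp => ?_),
            nilInf_zero_nilSeries]
          have := List.le_sum_of_mem hp
          omega
    · have hin := i.isLt
      have hadd : ∀ j, j = i.val ∨ j = 2 * n - i.val → j ∈ m → j + 1 ∉ m →
          ∃ m' : List ℕ, m'.Pairwise (· < ·) ∧ (∀ p ∈ m', 0 < p) ∧ m'.sum = ω.length + 1 ∧
            rhoProd n m' = gen n i * rhoProd n m ∧
            nilHecke n i (specialize n (nilSeries m)) = specialize n (nilSeries m') := by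
        intro j hj hjm hjm'
        have hA := nilHecke_specialize_nilSeries (n := n) hm (by omega) (by omega) hjm hjm'
        rw [residue_eq hj] at hA
        refine ⟨raise j m, ?_, ?_, ?_, ?_, hA⟩ <;>
          obtain ⟨A, B, rfl, hA, hB⟩ := exists_append_of_mem hm hjm <;> rw [raise_append hA hB]
        · rw [pairwise_append_cons_iff] at hm ⊢
          refine ⟨hm.1, hm.2.1, fun a ha => (hA a ha).trans (by omega), fun b hb => ?_,
            hm.2.2.2.2⟩
          have : b ≠ j + 1 := by
            rintro rfl
            exact hjm' (by simp [hb])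
          have := hB b hb
          omega
        · intro p hp
          rw [List.mem_append, List.mem_cons] at hp
          rcases hp with hp | rfl | hp
          · exact hpos p (by simp [hp])
          · exact Nat.succ_pos _
          · exact hpos p (by simp [hp])
        · rw [← hsum, List.sum_append, List.sum_cons, List.sum_append, List.sum_cons]
          ring
        · have := gen_residue_mul_rhoProd (n := n) (B := B) hA (by omega)
          rw [← this, residue_eq hj]
      have hdel : ∀ j, j = i.val ∨ j = 2 * n - i.val → j ∉ m → j + 1 ∉ m := by
        intro j hj hjm hjm'
        obtain ⟨A, B, rfl, hA, hB⟩ := exists_append_of_mem hm hjm'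
        have hA' : ∀ a ∈ A, a < j := fun a ha => by
          have := hA a ha
          have : a ≠ j := by
            rintro rfl
            exact hjm (by simp [ha])
          omega
        rw [List.sum_append, List.sum_cons] at hsum
        have hs : (A ++ j :: B).sum < 2 * n := by
          rw [List.sum_append, List.sum_cons]
          omega
        have := gen_residue_mul_rhoProd hA' hs
        rw [residue_eq hj] at this
        refine hno (A ++ j :: B) (by rw [List.sum_append, List.sum_cons]; omega) ?_
        rw [← this, ← mul_assoc, gen_mul_self, one_mul]
      by_cases ha : i.val ∈ m ∧ i.val + 1 ∉ m
      · exact hadd _ (Or.inl rfl) ha.1 ha.2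
      by_cases hb : 2 * n - i.val ∈ m ∧ 2 * n - i.val + 1 ∉ m
      · exact hadd _ (Or.inr rfl) hb.1 hb.2
      exfalso
      -- Otherwise 2n - i and 2n - i + 1 are both parts, and as i ≤ n they add up to more than 2n.
      have h2 : 2 * n - i.val ∉ m := fun h => by
        have h' : 2 * n - i.val + 1 ∈ m := not_not.mp fun h' => hb ⟨h, h'⟩
        exact not_mem_of_sum_lt (c := 2 * n) (by omega) h (by omega) (by omega) h'
      refine not_fixed_of_isAffineGrassmannian hn i (rhoProd n m) hw (by omega)
        (gen_apply_rhoProd_zero hi hm hpos (by omega) ?_ h2 (hdel _ (Or.inr rfl) h2))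
      exact ⟨fun h => not_not.mp fun h' => ha ⟨h, h'⟩,
        fun h => not_not.mp fun h' => hdel _ (Or.inl rfl) h' h⟩

/-! ### Recovering the partition from the group element -/

/-- The weakly increasing lists of the parts of a partition in `𝒫_C^n`. -/
def IsIncreasingC (n : ℕ) (m : List ℕ) : Prop :=
  m.Pairwise (· ≤ ·) ∧ (∀ p ∈ m, 0 < p ∧ p ≤ 2 * n) ∧ ∀ k ≤ n, m.count k ≤ 1

theorem IsIncreasingC.tail {n p : ℕ} {m : List ℕ} (h : IsIncreasingC n (p :: m)) :
    IsIncreasingC n m :=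
  ⟨(List.pairwise_cons.mp h.1).2, (List.forall_mem_cons.mp h.2.1).2,
    fun k hk => List.count_le_count_cons.trans (h.2.2 k hk)⟩

theorem IsIncreasingC.notMem {n p : ℕ} {m : List ℕ} (h : IsIncreasingC n (p :: m))
    (hp : p ≤ n) : p ∉ m := fun hpm => by
  have h1 := h.2.2 p hp
  have h2 := List.count_pos_iff.mpr hpm
  rw [List.count_cons_self] at h1
  omega

/-- Rows longer than n act first on the origin and never make a coordinate positive. A row p ≤ n
then moves the nonpositive x_1 to place p as 1 - x_1 > 0, and later rows are shorter and leave that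
place alone. -/
theorem coord_rhoProd_pos_iff {n : ℕ} {m : List ℕ} (h : IsIncreasingC n m) {q : ℕ} (hq : q < n) :
    0 < coord ((rhoProd n m).val 0) q ↔ q + 1 ∈ m := by
  induction m generalizing q with
  | nil =>
    have : coord ((rhoProd n []).val 0) q = 0 := coord_zero q
    simp [this]
  | cons p m ih =>
    have ih' := fun {q : ℕ} (hq : q < n) => ih h.tail hq
    have hle := (List.pairwise_cons.mp h.1).1
    have hp := h.2.1 p (by simp)
    rw [rhoProd_cons, mul_apply, List.mem_cons]
    rcases le_or_gt p n with hpn | hpn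
    · have hpm := h.notMem hpn
      have hlow : ∀ k ≤ p, k ∉ m := fun k hk hkm => by
        have := hle k hkm
        obtain rfl : k = p := by omega
        exact hpm hkm
      rw [coord_rho_of_le hpn _ hq]
      split_ifs with h1 h2
      · rw [ih' (by omega)]
        exact iff_of_false (hlow _ h1) fun h => h.elim (by omega) (hlow _ (by omega))
      · have h0 := (ih' (q := 0) (by omega)).not.mpr (hlow _ (by omega))
        exact iff_of_true (by omega) (Or.inl h2)
      · rw [ih' hq]
        exact ⟨Or.inr, fun h => h.resolve_left h2⟩
    · have hlow : ∀ k ≤ n, k ∉ m := fun k hk hkm => by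
        have := hle k hkm
        omega
      have hnon : ∀ r < n, ¬ 0 < coord ((rhoProd n m).val 0) r := fun r hr =>
        (ih' hr).not.mpr (hlow _ hr)
      rw [coord_rho_of_gt hpn hp.2 _ hq]
      refine iff_of_false ?_ fun h => h.elim (by omega) (hlow _ (by omega))
      split_ifs
      · exact hnon _ (by omega)
      · have := hnon 0 (by omega)
        omega
      · exact hnon _ hq

theorem sum_coord_rho {n k : ℕ} (hk : n < k) (hk2 : k ≤ 2 * n) (x : Fin n → ℤ) :
    ∑ q ∈ Finset.range n, coord ((rho n k).val x) q = ∑ q ∈ Finset.range n, coord x q - 1 := by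
  obtain ⟨r, hr⟩ : ∃ r, r + k = 2 * n := ⟨2 * n - k, by omega⟩
  obtain ⟨s, hs⟩ : ∃ s, n = r + 1 + s := ⟨n - (r + 1), by omega⟩
  have h : ∀ f : ℕ → ℤ, ∑ q ∈ Finset.range n, f q =
      ∑ q ∈ Finset.range r, f q + f r + ∑ q ∈ Finset.range s, f (r + 1 + q) := fun f => by
    rw [hs, Finset.sum_range_add, Finset.sum_range_succ]
  have h' : ∑ q ∈ Finset.range n, coord x q = ∑ q ∈ Finset.range r, coord x (q + 1) + coord x 0 +
      ∑ q ∈ Finset.range s, coord x (r + 1 + q) := by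
    rw [h, ← Finset.sum_range_succ, Finset.sum_range_succ']
  rw [h, h', coord_rho_of_gt hk hk2 _ (by omega), if_neg (by omega), if_pos hr,
    Finset.sum_congr rfl fun q hq => ?_, Finset.sum_congr (s₁ := Finset.range s) rfl fun q hq => ?_]
  · ring
  · have := Finset.mem_range.mp hq
    rw [coord_rho_of_gt hk hk2 _ (by omega), if_neg (by omega), if_neg (by omega)]
  · have := Finset.mem_range.mp hq
    rw [coord_rho_of_gt hk hk2 _ (by omega), if_pos (by omega)]

theorem sum_coord_rhoProd {n : ℕ} (m : List ℕ) (h : ∀ p ∈ m, n < p ∧ p ≤ 2 * n) :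
    ∑ q ∈ Finset.range n, coord ((rhoProd n m).val 0) q = -m.length := by
  induction m with
  | nil => exact Finset.sum_eq_zero fun q _ => coord_zero q
  | cons p m ih =>
    have h' := List.forall_mem_cons.mp h
    rw [rhoProd_cons, mul_apply, sum_coord_rho h'.1.1 h'.1.2, ih h'.2, List.length_cons]
    push_cast
    ring

theorem rho_injOn {n p p' : ℕ} (hp : n < p) (hp2 : p ≤ 2 * n) (hp' : n < p') (hp2' : p' ≤ 2 * n)
    (h : (rho n p).val 0 = (rho n p').val 0) : p = p' := by
  have h1 := coord_rho_of_gt hp hp2 0 (q := 2 * n - p) (by omega)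
  rw [h, coord_rho_of_gt hp' hp2' 0 (by omega), coord_zero, coord_zero, coord_zero] at h1
  split_ifs at h1 <;> omega

/-- Only m is bounded: `Function.invFun` returns some preimage, so m' must be allowed to be any
element of 𝒫_C^n. Positive coordinates determine the parts up to n, hence a smallest part p ≤ n is
common to both lists and can be cancelled. -/
theorem eq_of_rhoProd_eq {n : ℕ} {m m' : List ℕ} (hm : IsIncreasingC n m) (hsum : m.sum ≤ 2 * n)
    (hm' : IsIncreasingC n m') (h : rhoProd n m = rhoProd n m') : m = m' := by
  induction m generalizing m' with
  | nil =>
    have hbig : ∀ p ∈ m', n < p ∧ p ≤ 2 * n := fun p hp => by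
      refine ⟨?_, (hm'.2.1 p hp).2⟩
      by_contra hpn
      have hp0 := (hm'.2.1 p hp).1
      have hpos := (coord_rhoProd_pos_iff hm' (q := p - 1) (by omega)).mpr
        (by rwa [Nat.sub_add_cancel hp0])
      rw [← h, coord_rhoProd_pos_iff hm (by omega)] at hpos
      simp at hpos
    have h1 := sum_coord_rhoProd m' hbig
    rw [← h, sum_coord_rhoProd [] (by simp)] at h1
    rw [eq_comm, ← List.length_eq_zero_iff]
    simpa using h1
  | cons p m ih =>
    have hmem : ∀ k, 0 < k → k ≤ n → (k ∈ p :: m ↔ k ∈ m') := fun k hk0 hk => by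
      have h1 := coord_rhoProd_pos_iff hm (q := k - 1) (by omega)
      rw [h, coord_rhoProd_pos_iff hm' (by omega), Nat.sub_add_cancel hk0] at h1
      exact h1.symm
    have hle := (List.pairwise_cons.mp hm.1).1
    have hp := hm.2.1 p (by simp)
    rw [List.sum_cons] at hsum
    rcases le_or_gt p n with hpn | hpn
    · have hpm' := (hmem p hp.1 hpn).mp (by simp)
      cases m' with
      | nil => simp at hpm'
      | cons p' m' =>
        have hp' := hm'.2.1 p' (by simp)
        have hle' := (List.pairwise_cons.mp hm'.1).1
        have h1 : p' ≤ p := by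
          rcases List.mem_cons.mp hpm' with h | h
          · exact h.ge
          · exact hle' p h
        have h2 : p ≤ p' := by
          rcases List.mem_cons.mp ((hmem p' hp'.1 (h1.trans hpn)).mpr (by simp)) with h | h
          · exact h.ge
          · exact hle p' h
        obtain rfl : p = p' := le_antisymm h2 h1
        rw [rhoProd_cons, rhoProd_cons] at h
        rw [ih hm.tail (by omega) hm'.tail (mul_left_cancel h)]
    · obtain rfl : m = [] := List.eq_nil_iff_forall_not_mem.mpr fun r hr => by
        have h1 := hle r hr
        have h2 := List.le_sum_of_mem hr
        omega
      have hbig : ∀ k ∈ m', n < k ∧ k ≤ 2 * n := fun k hk => by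
        refine ⟨?_, (hm'.2.1 k hk).2⟩
        by_contra hkn
        have h1 := (hmem k (hm'.2.1 k hk).1 (by omega)).mpr hk
        rw [List.mem_singleton] at h1
        omega
      have h1 := sum_coord_rhoProd m' hbig
      rw [← h, sum_coord_rhoProd [p] (by simpa using ⟨hpn, hp.2⟩)] at h1
      obtain ⟨p', rfl⟩ := List.length_eq_one_iff.mp (by simpa using h1.symm : m'.length = 1)
      have hp' := hbig p' (by simp)
      rw [rho_injOn hpn hp.2 hp'.1 hp'.2]
      simpa [rhoProd] using congrArg (fun g => g.val 0) h

theorem isIncreasingC_reverse {n : ℕ} (l : PartitionC n) : IsIncreasingC n l.val.reverse :=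
  ⟨List.pairwise_reverse.mpr l.2.1, fun p hp => l.2.2.1 p (List.mem_reverse.mp hp),
    fun k hk => by
      rw [List.count_reverse]
      exact l.2.2.2 k hk⟩

theorem ofPartition_eq (n : ℕ) (l : PartitionC n) : ofPartition n l = rhoProd n l.val.reverse := rfl

theorem toPartition_rhoProd {n : ℕ} {m : List ℕ} (hm : m.Pairwise (· < ·)) (hpos : ∀ p ∈ m, 0 < p)
    (hsum : m.sum ≤ 2 * n) : (toPartition n (rhoProd n m)).val = m.reverse := by
  have hm' : IsIncreasingC n m := ⟨hm.imp le_of_lt,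
    fun p hp => ⟨hpos p hp, (List.le_sum_of_mem hp).trans hsum⟩,
    fun k _ => List.nodup_iff_count_le_one.mp (hm.imp ne_of_lt) k⟩
  have hl : ∃ l, ofPartition n l = rhoProd n m := by
    refine ⟨⟨m.reverse, List.pairwise_reverse.mpr hm'.1,
      fun p hp => hm'.2.1 p (List.mem_reverse.mp hp), fun k hk => ?_⟩, ?_⟩
    · rw [List.count_reverse]
      exact hm'.2.2 k hk
    · exact (ofPartition_eq n _).trans (congrArg (rhoProd n) (List.reverse_reverse m))
  have h : ofPartition n (toPartition n (rhoProd n m)) = rhoProd n m := Function.invFun_eq hl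
  exact List.reverse_eq_iff.mp (eq_of_rhoProd_eq hm' hsum (isIncreasingC_reverse _) h.symm).symm

end AffineC
end

/-! ### Conclusion -/

theorem theorem1p2 (n : ℕ) (hn : 1 ≤ n) (w : AffineC.affineWeyl n)
    (hw : AffineC.IsAffineGrassmannian n w) (hl : AffineC.len n w ≤ 2 * n) :
    ∃ h : AffineC.IsStrictPartition (AffineC.toPartition n w).val,
      AffineC.dualAffineSchurP n w =
        AffineC.specialize n
          (AffineC.dualFactorialP ⟨(AffineC.toPartition n w).val, h⟩) := by
  obtain ⟨hprod, hlen⟩ : AffineC.IsReducedWord n w (AffineC.reducedWord n w) :=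
    (AffineC.exists_reducedWord n w).choose_spec
  obtain ⟨m, hm, hpos, hsum, hm', hfold⟩ := AffineC.exists_rhoProd_eq_wordProd hn
    (AffineC.reducedWord n w) (by rw [hprod, hlen]) (by rwa [hprod]) (by rwa [hlen])
  have hpart : (AffineC.toPartition n w).val = m.reverse := by
    rw [← hprod, ← hm']
    exact AffineC.toPartition_rhoProd hm hpos (by omega)
  have hstrict : AffineC.IsStrictPartition (AffineC.toPartition n w).val := by
    rw [hpart]
    exact ⟨List.pairwise_reverse.mpr hm, fun p hp => hpos p (List.mem_reverse.mp hp)⟩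
  refine ⟨hstrict, hfold.trans (congrArg (AffineC.specialize n) ?_)⟩
  refine Eq.trans ?_ (AffineC.dualFactorialP_eq ⟨_, hstrict⟩).symm
  exact congrArg AffineC.nilSeries (List.reverse_eq_iff.mp hpart.symm)
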